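/- Let $\Phi$ be a wireless network of $v$ nodes at distinct points of the Euclidean plane with transmission power $P>0$, noise density $N_0>0$, path loss factor $\alpha>0$ and thresholds $0<\gamma_i<\gamma_c$. Its communication graph $\mathcal G_c$ has the directed edges $j\to k$ and $k\to j$ for all nodes $j\ne k$ with $D(j,k)\le R_c:=(P/(N_0\gamma_c))^{1/\alpha}$, where $D$ is the Euclidean distance. Let $e$ be the number of directed edges of $\mathcal G_c$, and let $\theta$ be its thickness, that is, the minimum number of planar graphs into which the undirected graph underlying $\mathcal G_c$ can be partitioned. Assume $e\ge 1$. The algorithm ConflictFreeLinkSchedule colours the edges of $\mathcal G_c$ with colours $1,2,\dots$ as follows. Phase 1: label the vertices by a uniformly random permutation of $1,\dots,v$. Phase 2: decompose the undirected graph into forests by successive breadth first searches, each performed on the edges left over by the previous ones until no edge is left, and replace each rooted forest by an out-oriented graph (its edges directed away from the roots) followed by an in-oriented graph (its edges directed toward the roots). This gives oriented graphs $T_1,\dots,T_k$. Phase 3: for $i=1,\dots,k$ and $j=1,\dots,v$ let $x$ be the edge of $T_i$ into (if $T_i$ is out-oriented) or out of (if $T_i$ is in-oriented) the vertex with label $j$,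 if there is one. Among the colours used so far that occur on no edge sharing a vertex with $x$, give $x$ the smallest colour $r$ such that, for the set $S$ consisting of $x$ and all edges of colour $r$, every edge $t\to u$ in $S$ satisfies $$\frac{P/D(t,u)^{\alpha}}{N_0+\sum_{(t'\to u')\in S\setminus\{t\to u\}}P/D(t',u)^{\alpha}}\ \ge\ \gamma_c .$$ If there is no such colour, give $x$ a new colour, namely the number of colours used so far plus one. Then the running time of ConflictFreeLinkSchedule is $O(ev\log v+ev\theta)$. Precisely: on a random access machine with registers and arrays of natural and of real numbers, on which each arithmetic operation (addition, subtraction and comparison of natural numbers; the four operations, powers and comparison of real numbers), each memory access and each uniform random draw from a set $\{0,\dots,n\}$ costs one unit of time, there are one program and one absolute constant $c$ such that for every network with $e\ge1$, given by its parameters, the coordinates of its nodes and a list of the directed edges of $\mathcal G_c$ in any order, and for all outcomes of the random draws, the program halts after at most $c\,(ev\log v+ev\theta)$ units of time with a vertex labelling and the colouring that the algorithm produces from this labelling and some successive breadth first search decomposition; and the labelling is uniformly distributed over all $v!$ labellings. -/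

import Mathlib

noncomputable section

namespace STDMA

/-! ### Planarity and thickness -/

/-- A crossing-free drawing of `G` in the Euclidean plane: vertices are distinct points, the edge
`s(u, v)` is drawn as a simple arc from the point of `u` to the point of `v`, an arc passes through
no vertex other than its ends, and two different arcs meet only in common ends. -/
structure PlaneDrawing {V : Type*} (G : SimpleGraph V) where
  pt : V → EuclideanSpace ℝ (Fin 2)
  pt_injective : Function.Injective pt
  arc : Sym2 V → Set (EuclideanSpace ℝ (Fin 2))
  isArc : ∀ u v, G.Adj u v →
    ∃ f : Path (pt u) (pt v), Function.Injective f ∧ Set.range f = arc s(u, v)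
  vertex_of_mem_arc : ∀ e ∈ G.edgeSet, ∀ w, pt w ∈ arc e → w ∈ e
  arc_inter : ∀ e ∈ G.edgeSet, ∀ e' ∈ G.edgeSet, e ≠ e' →
    arc e ∩ arc e' ⊆ {p | ∃ w, w ∈ e ∧ w ∈ e' ∧ p = pt w}

def IsPlanar {V : Type*} (G : SimpleGraph V) : Prop := Nonempty (PlaneDrawing G)

/-- The minimum number of planar graphs into which (the edge set of) `G` can be partitioned. -/
def thickness {V : Type*} (G : SimpleGraph V) : ℕ :=
  sInf {t | ∃ H : Fin t → SimpleGraph V,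
    (∀ i, IsPlanar (H i)) ∧ Pairwise (fun i j => Disjoint (H i) (H j)) ∧ ⨆ i, H i = G}

/-! ### The physical network and its communication graph -/

/-- A network of `N` nodes in the plane with common transmission power `P`, communication
threshold `γc`, interference threshold `γi`, path loss factor `α` and noise density `N₀`. -/
structure Network (N : ℕ) where
  pos : Fin N → EuclideanSpace ℝ (Fin 2)
  P : ℝ
  γc : ℝ
  γi : ℝ
  α : ℝ
  N₀ : ℝ
  pos_injective : Function.Injective pos
  P_pos : 0 < P
  γi_pos : 0 < γi
  γi_lt_γc : γi < γc
  α_pos : 0 < α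
  N₀_pos : 0 < N₀

/-- A link `(t, r)` with transmitter `t` and receiver `r`. -/
abbrev Link (N : ℕ) := Fin N × Fin N

namespace Network

variable {N : ℕ} (Φ : Network N)

/-- Communication range. -/
def Rc : ℝ := (Φ.P / (Φ.N₀ * Φ.γc)) ^ (1 / Φ.α)

/-- The undirected equivalent of the communication graph. -/
def graph : SimpleGraph (Fin N) where
  Adj j k := j ≠ k ∧ dist (Φ.pos j) (Φ.pos k) ≤ Φ.Rc
  symm := ⟨fun _ _ h => ⟨h.1.symm, by rw [dist_comm]; exact h.2⟩⟩
  loopless := ⟨fun _ h => h.1 rfl⟩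

open Classical in
/-- The directed communication edges; both orientations of each adjacent pair occur. -/
def commEdges : Finset (Link N) := Finset.univ.filter fun x => Φ.graph.Adj x.1 x.2

/-- Power received at node `r` from node `t`. -/
def power (t r : Fin N) : ℝ := Φ.P / dist (Φ.pos t) (Φ.pos r) ^ Φ.α

/-- SINR at the receiver of the link `h` when the links in `S` are active simultaneously. -/
def SINR (S : Finset (Link N)) (h : Link N) : ℝ :=
  Φ.power h.1 h.2 / (Φ.N₀ + ∑ g ∈ S.erase h, Φ.power g.1 h.2)

end Network

/-! ### Phase 2: successive breadth first searches -/

/-- `F`, rooted in every component by `root`, is a breadth first search forest of `R`: it is a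
forest in `R` with one root per component of `R`, and it joins each vertex to the root of its
component by a path which is a shortest path in `R`. -/
structure IsBFSForest {V : Type*} (R F : SimpleGraph V) (root : V → V) : Prop where
  le : F ≤ R
  acyclic : F.IsAcyclic
  root_eq : ∀ u v, R.Reachable u v → root u = root v
  reachable_root : ∀ u, F.Reachable (root u) u
  dist_eq : ∀ u, F.dist (root u) u = R.dist (root u) u

/-- What is left of `G` after the removal of the first `i` forests. -/
def residual {V : Type*} (G : SimpleGraph V) (F : ℕ → SimpleGraph V) : ℕ → SimpleGraph V
  | 0 => G
  | i + 1 => residual G F i \ F i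

/-- A decomposition of `G` into `m` forests by successive breadth first searches, each performed on
the edges left over by the previous ones, until no edge is left. -/
structure BFSDecomposition {V : Type*} (G : SimpleGraph V) where
  m : ℕ
  F : ℕ → SimpleGraph V
  root : ℕ → V → V
  isBFSForest : ∀ i < m, IsBFSForest (residual G F i) (F i) (root i)
  residual_ne_bot : ∀ i < m, residual G F i ≠ ⊥
  residual_eq_bot : residual G F m = ⊥

namespace BFSDecomposition

variable {V : Type*} {G : SimpleGraph V} (D : BFSDecomposition G)

/-- The number `k` of oriented graphs: each undirected forest gives two. -/
def k : ℕ := 2 * D.m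

/-- `D.oriented i x`: the directed edge `x` belongs to the oriented graph `T i`, for `i < D.k`.
The forest `F i` gives the out-oriented graph `T (2 * i)` of its edges pointing away from the
root, and the in-oriented graph `T (2 * i + 1)` of its edges pointing toward the root. -/
def oriented (i : ℕ) (x : V × V) : Prop :=
  (D.F (i / 2)).Adj x.1 x.2 ∧
    if Even i then
      (D.F (i / 2)).dist (D.root (i / 2) x.2) x.2 =
        (D.F (i / 2)).dist (D.root (i / 2) x.2) x.1 + 1
    else
      (D.F (i / 2)).dist (D.root (i / 2) x.1) x.1 =
        (D.F (i / 2)).dist (D.root (i / 2) x.1) x.2 + 1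

/-- `x` is the edge of `T i` associated with the vertex `u`: the edge into `u` if `T i` is
out-oriented, the edge out of `u` if `T i` is in-oriented. -/
def IsEdgeOf (i : ℕ) (u : V) (x : V × V) : Prop :=
  D.oriented i x ∧ if Even i then x.2 = u else x.1 = u

end BFSDecomposition

/-! ### Phase 3: colouring -/

/-- A partial colouring of links by `1, 2, …`; the value `0` means "not coloured". -/
abbrev Coloring (N : ℕ) := Link N → ℕ

/-- Primary edge conflict: the ends of the two links are not all distinct. -/
def PrimaryConflict {N : ℕ} (x h : Link N) : Prop :=
  x.1 = h.1 ∨ x.1 = h.2 ∨ x.2 = h.1 ∨ x.2 = h.2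

variable {N : ℕ}

open Classical in
/-- The set of existing colours. -/
def existing (C : Coloring N) : Finset ℕ := (Finset.univ.filter fun h => C h ≠ 0).image C

open Classical in
/-- The colours of the coloured links which have a primary conflict with `x`. -/
def conflicting (C : Coloring N) (x : Link N) : Finset ℕ :=
  (Finset.univ.filter fun h => C h ≠ 0 ∧ PrimaryConflict x h).image C

open Classical in
/-- If `x` gets the colour `r`, then the SINR at all receivers of colour `r` is sufficient. -/
def SINRCompliant (Φ : Network N) (C : Coloring N) (x : Link N) (r : ℕ) : Prop :=
  ∀ h ∈ insert x (Finset.univ.filter fun h => C h = r),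
    Φ.γc ≤ Φ.SINR (insert x (Finset.univ.filter fun h => C h = r)) h

open Classical in
def firstConflictFreeColor (Φ : Network N) (C : Coloring N) (x : Link N) : ℕ :=
  if h : ((existing C \ conflicting C x).filter (SINRCompliant Φ C x)).Nonempty then
    ((existing C \ conflicting C x).filter (SINRCompliant Φ C x)).min' h
  else (existing C).card + 1

open Classical in
/-- One pass of the inner loop: colour the edge of `T i` associated with the vertex of label `j`,
if there is one. -/
def colorStep (Φ : Network N) (L : Equiv.Perm (Fin N)) (D : BFSDecomposition Φ.graph)
    (C : Coloring N) (p : ℕ × Fin N) : Coloring N :=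
  if h : ∃ x, D.IsEdgeOf p.1 (L.symm p.2) x then
    Function.update C h.choose (firstConflictFreeColor Φ C h.choose)
  else C

/-- The colouring produced by ConflictFreeLinkSchedule from the labelling `L` (Phase 1) and the
decomposition `D` (Phase 2): the oriented graphs are scanned one after the other, and in each of
them the vertices in increasing order of their labels. -/
def conflictFreeLinkSchedule (Φ : Network N) (L : Equiv.Perm (Fin N))
    (D : BFSDecomposition Φ.graph) : Coloring N :=
  ((List.range D.k).flatMap fun i => (List.finRange N).map fun j => (i, j)).foldl
    (colorStep Φ L D) fun _ => 0

/-! ### The machine model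

A randomized real random access machine.  There are registers and arrays of two sorts: natural
numbers (with addition, truncated subtraction and comparison) and real numbers (with the four
arithmetic operations, powers and comparison).  There is no conversion between the two sorts.
A number can be drawn uniformly from `{0, …, n}`.  Each operation costs one unit of time. -/

inductive NExp
  | const (n : ℕ)
  | reg (i : ℕ)
  | get (a : ℕ) (idx : NExp)
  | add (x y : NExp)
  | sub (x y : NExp)

inductive RExp
  | const (n : ℕ)
  | reg (i : ℕ)
  | get (a : ℕ) (idx : NExp)
  | add (x y : RExp)
  | sub (x y : RExp)
  | mul (x y : RExp)
  | div (x y : RExp)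
  | pow (x y : RExp)

inductive Test
  | nle (x y : NExp)
  | rle (x y : RExp)
  | not (b : Test)
  | and (b c : Test)

inductive Cmd
  | skip
  | nset (i : ℕ) (x : NExp)
  | rset (i : ℕ) (x : RExp)
  | nput (a : ℕ) (idx x : NExp)
  | rput (a : ℕ) (idx : NExp) (x : RExp)
  | draw (i : ℕ) (bound : NExp)
  | seq (p q : Cmd)
  | ite (b : Test) (p q : Cmd)
  | while (b : Test) (p : Cmd)

/-- Contents of the memory, and the number of random draws made so far. -/
@[ext] structure State where
  nreg : ℕ → ℕ
  rreg : ℕ → ℝ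
  narr : ℕ → ℕ → ℕ
  rarr : ℕ → ℕ → ℝ
  draws : ℕ

namespace NExp

def eval (s : State) : NExp → ℕ
  | const n => n
  | reg i => s.nreg i
  | get a idx => s.narr a (idx.eval s)
  | add x y => x.eval s + y.eval s
  | sub x y => x.eval s - y.eval s

/-- The time to evaluate an expression. -/
def cost : NExp → ℕ
  | const _ => 1
  | reg _ => 1
  | get _ idx => idx.cost + 1
  | add x y => x.cost + y.cost + 1
  | sub x y => x.cost + y.cost + 1

end NExp

namespace RExp

def eval (s : State) : RExp → ℝ
  | const n => n
  | reg i => s.rreg i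
  | get a idx => s.rarr a (idx.eval s)
  | add x y => x.eval s + y.eval s
  | sub x y => x.eval s - y.eval s
  | mul x y => x.eval s * y.eval s
  | div x y => x.eval s / y.eval s
  | pow x y => x.eval s ^ y.eval s

def cost : RExp → ℕ
  | const _ => 1
  | reg _ => 1
  | get _ idx => idx.cost + 1
  | add x y => x.cost + y.cost + 1
  | sub x y => x.cost + y.cost + 1
  | mul x y => x.cost + y.cost + 1
  | div x y => x.cost + y.cost + 1
  | pow x y => x.cost + y.cost + 1

end RExp

namespace Test

def eval (s : State) : Test → Prop
  | nle x y => x.eval s ≤ y.eval s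
  | rle x y => x.eval s ≤ y.eval s
  | not b => ¬ b.eval s
  | and b c => b.eval s ∧ c.eval s

def cost : Test → ℕ
  | nle x y => x.cost + y.cost + 1
  | rle x y => x.cost + y.cost + 1
  | not b => b.cost + 1
  | and b c => b.cost + c.cost + 1

end Test

/-- The source of randomness: `ω (i, n) ∈ {0, …, n}` is the outcome of the `i`-th draw if that is a
draw from `{0, …, n}`. -/
abbrev Tape := (p : ℕ × ℕ) → Fin (p.2 + 1)

/-- All the entries of the tape are independent and uniformly distributed. -/
def tapeMeasure : MeasureTheory.Measure Tape :=
  MeasureTheory.Measure.infinitePi fun p : ℕ × ℕ =>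
    (PMF.uniformOfFintype (Fin (p.2 + 1))).toMeasure

/-- `Exec ω p s t s'`: started in the state `s`, and with the random outcomes `ω`, the program `p`
halts in the state `s'` after `t` units of time. -/
inductive Exec (ω : Tape) : Cmd → State → ℕ → State → Prop
  | skip (s : State) : Exec ω Cmd.skip s 1 s
  | nset (i : ℕ) (x : NExp) (s : State) :
      Exec ω (Cmd.nset i x) s (x.cost + 1)
        { s with nreg := Function.update s.nreg i (x.eval s) }
  | rset (i : ℕ) (x : RExp) (s : State) :
      Exec ω (Cmd.rset i x) s (x.cost + 1)
        { s with rreg := Function.update s.rreg i (x.eval s) }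
  | nput (a : ℕ) (idx x : NExp) (s : State) :
      Exec ω (Cmd.nput a idx x) s (idx.cost + x.cost + 1)
        { s with narr := Function.update s.narr a
                  (Function.update (s.narr a) (idx.eval s) (x.eval s)) }
  | rput (a : ℕ) (idx : NExp) (x : RExp) (s : State) :
      Exec ω (Cmd.rput a idx x) s (idx.cost + x.cost + 1)
        { s with rarr := Function.update s.rarr a
                  (Function.update (s.rarr a) (idx.eval s) (x.eval s)) }
  | draw (i : ℕ) (bound : NExp) (s : State) :
      Exec ω (Cmd.draw i bound) s (bound.cost + 1)
        { s with nreg := Function.update s.nreg i (ω (s.draws, bound.eval s)).val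
                 draws := s.draws + 1 }
  | seq {p q : Cmd} {s s' s'' : State} {t t' : ℕ} (hp : Exec ω p s t s') (hq : Exec ω q s' t' s'') :
      Exec ω (Cmd.seq p q) s (t + t') s''
  | ite_true {b : Test} {p q : Cmd} {s s' : State} {t : ℕ} (hb : b.eval s) (hp : Exec ω p s t s') :
      Exec ω (Cmd.ite b p q) s (b.cost + t) s'
  | ite_false {b : Test} {p q : Cmd} {s s' : State} {t : ℕ} (hb : ¬ b.eval s)
      (hq : Exec ω q s t s') : Exec ω (Cmd.ite b p q) s (b.cost + t) s'
  | while_true {b : Test} {p : Cmd} {s s' s'' : State} {t t' : ℕ} (hb : b.eval s)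
      (hp : Exec ω p s t s') (hw : Exec ω (Cmd.while b p) s' t' s'') :
      Exec ω (Cmd.while b p) s (b.cost + t + t') s''
  | while_false {b : Test} {p : Cmd} {s : State} (hb : ¬ b.eval s) :
      Exec ω (Cmd.while b p) s b.cost s

/-- The machine is deterministic once the random outcomes are fixed. -/
theorem Exec.unique {ω : Tape} {p : Cmd} {s s₁ s₂ : State} {t₁ t₂ : ℕ}
    (h₁ : Exec ω p s t₁ s₁) (h₂ : Exec ω p s t₂ s₂) : t₁ = t₂ ∧ s₁ = s₂ := by
  induction h₁ generalizing t₂ s₂ with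
  | skip => cases h₂; exact ⟨rfl, rfl⟩
  | nset => cases h₂; exact ⟨rfl, rfl⟩
  | rset => cases h₂; exact ⟨rfl, rfl⟩
  | nput => cases h₂; exact ⟨rfl, rfl⟩
  | rput => cases h₂; exact ⟨rfl, rfl⟩
  | draw => cases h₂; exact ⟨rfl, rfl⟩
  | seq _ _ ihp ihq =>
    cases h₂ with
    | seq hp' hq' =>
      obtain ⟨rfl, rfl⟩ := ihp hp'
      obtain ⟨rfl, rfl⟩ := ihq hq'
      exact ⟨rfl, rfl⟩
  | ite_true hb _ ih =>
    cases h₂ with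
    | ite_true _ hp' => obtain ⟨rfl, rfl⟩ := ih hp'; exact ⟨rfl, rfl⟩
    | ite_false hb' _ => exact absurd hb hb'
  | ite_false hb _ ih =>
    cases h₂ with
    | ite_true hb' _ => exact absurd hb' hb
    | ite_false _ hq' => obtain ⟨rfl, rfl⟩ := ih hq'; exact ⟨rfl, rfl⟩
  | while_true hb _ _ ihp ihw =>
    cases h₂ with
    | while_true _ hp' hw' =>
      obtain ⟨rfl, rfl⟩ := ihp hp'
      obtain ⟨rfl, rfl⟩ := ihw hw'
      exact ⟨rfl, rfl⟩
    | while_false hb' => exact absurd hb hb'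
  | while_false hb =>
    cases h₂ with
    | while_true hb' _ _ => exact absurd hb' hb
    | while_false _ => exact ⟨rfl, rfl⟩

/-! ### Input and output -/

/-- The initial state.  The network is given by the parameters and the coordinates of the nodes,
the communication graph by the list `ed` of its directed edges, in an arbitrary order.  All other
registers and array entries are `0`. -/
def input (Φ : Network N) (ed : Fin Φ.commEdges.card ≃ Φ.commEdges) : State where
  nreg i := if i = 0 then N else if i = 1 then Φ.commEdges.card else 0
  rreg i := if i = 0 then Φ.P else if i = 1 then Φ.γc else if i = 2 then Φ.γi
    else if i = 3 then Φ.α else if i = 4 then Φ.N₀ else 0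
  narr a i := if h : i < Φ.commEdges.card then
      if a = 0 then ((ed ⟨i, h⟩).1.1 : ℕ) else if a = 1 then ((ed ⟨i, h⟩).1.2 : ℕ) else 0
    else 0
  rarr a i := if h : i < N then
      if a = 0 then Φ.pos ⟨i, h⟩ 0 else if a = 1 then Φ.pos ⟨i, h⟩ 1 else 0
    else 0
  draws := 0

/-- Array `2` of naturals holds the labels, which are `1, …, N`. -/
def HasLabels (s : State) (L : Equiv.Perm (Fin N)) : Prop :=
  ∀ j : Fin N, s.narr 2 j = (L j : ℕ) + 1

/-- Array `3` of naturals holds the colours of the communication edges, in the order of `ed`. -/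
def HasColors (Φ : Network N) (ed : Fin Φ.commEdges.card ≃ Φ.commEdges) (s : State)
    (C : Coloring N) : Prop :=
  ∀ i : Fin Φ.commEdges.card, s.narr 3 i = C (ed i)

end STDMA

end

open STDMA

/-!
A scan of all edges finds the next vertex of a breadth first search in time `O(e)`. Another one
colours an edge in time `O(e)`: it accumulates the interference which each colour causes at the new
receiver and finds out which colours the new link conflicts with. If a search starts new trees only
at vertices with an edge left, it finds at least as many parents as roots, and each parent is an
edge to be coloured. As the passes over the vertices take time `O(v)` in each of the at most `e`
rounds, the total is `O(e * (e + v))`.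

This is within the bound because a planar graph has at most `32 * v` arcs, whence
`e ≤ 32 * v * θ`. Indeed a denser graph has a minor `K₅`, found by contracting edges as long as the
graph stays dense (Mader), while `K₅` is not planar: for five points joined by pairwise paths which
meet only in common ends, the turns of the vectors between two paths do not add up modulo two.

The labelling is drawn by an incremental shuffle, whose choices can be read off its result.
-/

noncomputable section

namespace STDMA

/-! ### The complete graph on five vertices is not planar -/

section Angles

open unitInterval

variable {X Y : Type*} [TopologicalSpace X] [TopologicalSpace Y]

/-- `θ` is a continuous choice of an angle of the complex-valued function `g`. It says nothing about
`θ` at the zeros of `g`. -/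
def IsAngle (θ : X → ℝ) (g : X → ℂ) : Prop :=
  Continuous θ ∧ ∀ x, g x = ‖g x‖ * Complex.exp (θ x * Complex.I)

theorem IsAngle.comp {θ : X → ℝ} {g : X → ℂ} (h : IsAngle θ g) {f : Y → X} (hf : Continuous f) :
    IsAngle (fun y => θ (f y)) (fun y => g (f y)) :=
  ⟨h.1.comp hf, fun y => h.2 (f y)⟩

theorem IsAngle.neg {θ : X → ℝ} {g : X → ℂ} (h : IsAngle θ g) :
    IsAngle (fun x => θ x + Real.pi) (fun x => -g x) := by
  refine ⟨h.1.add continuous_const, fun x => ?_⟩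
  push_cast
  rw [add_mul, Complex.exp_add, Complex.exp_pi_mul_I, norm_neg, ← mul_assoc, ← h.2 x, mul_neg_one]

theorem exists_isAngle_square (g : C(I × I, ℂ)) (hg : ∀ x, g x ≠ 0) :
    ∃ θ : I × I → ℝ, IsAngle θ g := by
  have norm_ne : ∀ x, (‖g x‖ : ℂ) ≠ 0 := fun x => by simpa using hg x
  let H : C(I × I, Circle) :=
    ⟨fun x => ⟨g x / ‖g x‖, mem_sphere_zero_iff_norm.2 (by simp [hg x])⟩, by
      refine Continuous.subtype_mk ?_ _
      exact (map_continuous g).div (Complex.continuous_ofReal.comp (map_continuous g).norm) norm_ne⟩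
  let side : C(I, Circle) := H.comp ((ContinuousMap.const I 0).prodMk (ContinuousMap.id I))
  have start : side 0 = Circle.exp (Complex.arg (H (0, 0))) := (Circle.exp_arg _).symm
  let f := Circle.isCoveringMap_exp.liftPath side _ start
  have hf : ∀ t, H (0, t) = Circle.exp (f t) := fun t =>
    (congr_fun (Circle.isCoveringMap_exp.liftPath_lifts side _ start) t).symm
  let θ := Circle.isCoveringMap_exp.liftHomotopy H f hf
  refine ⟨θ, map_continuous θ, fun x => ?_⟩
  have lifts : Circle.exp (θ x) = H x :=
    congr_fun (Circle.isCoveringMap_exp.liftHomotopy_lifts H f hf) x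
  have exp_eq : Complex.exp (θ x * Complex.I) = g x / ‖g x‖ := by
    rw [← Circle.coe_exp, lifts]
    rfl
  rw [exp_eq, mul_div_cancel₀ _ (norm_ne x)]

theorem exists_int_angle_eq_arg {z : ℂ} (hz : z ≠ 0) {x : ℝ}
    (h : z = ‖z‖ * Complex.exp (x * Complex.I)) : ∃ k : ℤ, x = z.arg + 2 * Real.pi * k := by
  have norm_ne : (‖z‖ : ℂ) ≠ 0 := by simpa using hz
  have exp_eq : Complex.exp (x * Complex.I) = Complex.exp (z.arg * Complex.I) :=
    mul_left_cancel₀ norm_ne (h.symm.trans (Complex.norm_mul_exp_arg_mul_I z).symm)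
  obtain ⟨k, hk⟩ := Complex.exp_eq_exp_iff_exists_int.1 exp_eq
  refine ⟨k, ?_⟩
  have him := congrArg Complex.im hk
  simp only [Complex.mul_im, Complex.ofReal_re, Complex.I_im, mul_one, Complex.ofReal_im,
    Complex.I_re, mul_zero, add_zero, Complex.add_im, Complex.intCast_re, Complex.intCast_im,
    Complex.re_ofNat, Complex.im_ofNat, Complex.mul_re, sub_zero, zero_mul] at him
  linarith

theorem exists_int_arg_sub_arg_neg {z : ℂ} (hz : z ≠ 0) :
    ∃ k : ℤ, z.arg - (-z).arg = Real.pi * (2 * k + 1) := by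
  have angle : IsAngle (fun _ : Unit => z.arg) (fun _ => z) :=
    ⟨continuous_const, fun _ => (Complex.norm_mul_exp_arg_mul_I z).symm⟩
  obtain ⟨k, hk⟩ := exists_int_angle_eq_arg (neg_ne_zero.2 hz) (angle.neg.2 ())
  refine ⟨k - 1, ?_⟩
  push_cast
  linarith

theorem IsAngle.change_unique {θ θ' : I → ℝ} {g : I → ℂ} (hg : ∀ x, g x ≠ 0) (h : IsAngle θ g)
    (h' : IsAngle θ' g) : θ 1 - θ 0 = θ' 1 - θ' 0 := by
  have exp_sub : ∀ t, Circle.exp (θ t - θ' t) = 1 := by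
    intro t
    have norm_ne : (‖g t‖ : ℂ) ≠ 0 := by simpa using hg t
    rw [Circle.exp_sub, div_eq_one]
    apply Circle.ext
    rw [Circle.coe_exp, Circle.coe_exp]
    exact mul_left_cancel₀ norm_ne ((h.2 t).symm.trans (h'.2 t))
  have const := Circle.isCoveringMap_exp.const_of_comp (g := fun t => θ t - θ' t)
    (h.1.sub h'.1) (fun a a' => (exp_sub a).trans (exp_sub a').symm) 0 1
  linarith

theorem exists_turns (g : I → ℂ) (hg : ∀ x, g x ≠ 0) :
    ∃ n : ℤ, ∀ θ, IsAngle θ g → θ 1 - θ 0 = (g 1).arg - (g 0).arg + 2 * Real.pi * n := by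
  by_cases h : ∃ θ, IsAngle θ g
  · obtain ⟨θ₀, h₀⟩ := h
    obtain ⟨k, hk⟩ := exists_int_angle_eq_arg (hg 0) (h₀.2 0)
    obtain ⟨l, hl⟩ := exists_int_angle_eq_arg (hg 1) (h₀.2 1)
    refine ⟨l - k, fun θ hθ => ?_⟩
    rw [hθ.change_unique hg h₀, hk, hl]
    push_cast
    ring
  · exact ⟨0, fun θ hθ => (h ⟨θ, hθ⟩).elim⟩

/-- The four angles are those of `γ s - δ t` on the sides of the square of all `(s, t)`. -/
theorem exists_isAngle_of_disjoint {a b c d : ℂ} (γ : Path a b) (δ : Path c d)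
    (h : Disjoint (Set.range γ) (Set.range δ)) :
    ∃ θa θb θc θd : I → ℝ,
      (IsAngle θc (fun s => γ s - c) ∧ IsAngle θd (fun s => γ s - d) ∧
        IsAngle θa (fun t => δ t - a) ∧ IsAngle θb (fun t => δ t - b)) ∧
      (θc 1 - θc 0) + (θb 1 - θb 0) = (θd 1 - θd 0) + (θa 1 - θa 0) := by
  obtain ⟨θ, hθ⟩ := exists_isAngle_square ⟨fun x : I × I => γ x.1 - δ x.2, by fun_prop⟩
    fun x hx => Set.disjoint_left.1 h ⟨x.1, rfl⟩ ⟨x.2, (sub_eq_zero.1 hx).symm⟩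
  refine ⟨_, _, _, _,
    ⟨by simpa using hθ.comp (f := fun s : I => (s, (0 : I))) (by fun_prop),
      by simpa using hθ.comp (f := fun s : I => (s, (1 : I))) (by fun_prop),
      by simpa using (hθ.comp (f := fun t : I => ((0 : I), t)) (by fun_prop)).neg,
      by simpa using (hθ.comp (f := fun t : I => ((1 : I), t)) (by fun_prop)).neg⟩, by ring⟩

theorem exists_half_turns {ι : Type*} {p : ι → ℂ} (hp : Function.Injective p) :
    ∃ x : ι → ι → ℤ, ∀ i j, i ≠ j →
      (p i - p j).arg - (p j - p i).arg = Real.pi * (2 * x i j + 1) ∧ x i j + x j i = -1 := by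
  choose! x hx using fun i j (h : i ≠ j) => exists_int_arg_sub_arg_neg (sub_ne_zero.2 (hp.ne h))
  simp only [neg_sub] at hx
  refine ⟨x, fun i j h => ⟨hx i j h, ?_⟩⟩
  have sum_eq : Real.pi * (2 * ((x i j : ℝ) + x j i + 1)) = 0 := by
    linarith [hx i j h, hx j i h.symm]
  have cast_eq : (x i j : ℝ) + x j i + 1 = 0 := by simpa [Real.pi_ne_zero] using sum_eq
  have : x i j + x j i + 1 = 0 := by exact_mod_cast cast_eq
  omega

/-- `n i j k` counts the turns of the path from `p i` to `p j` around `p k`, relative to the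
principal arguments at its ends, and `x i j` the half turns between the principal arguments of
`p i - p j` and `p j - p i`. -/
theorem exists_turns_relation {ι : Type*} {p : ι → ℂ} (hp : Function.Injective p)
    (γ : ∀ i j, Path (p i) (p j)) :
    ∃ (n : ι → ι → ι → ℤ) (x : ι → ι → ℤ), (∀ i j, i ≠ j → x i j + x j i = -1) ∧
      ∀ a b c d, a ≠ c → a ≠ d → b ≠ c → b ≠ d →
        Disjoint (Set.range (γ a b)) (Set.range (γ c d)) →
        x b c - x a c - x b d + x a d + n a b c - n a b d - n c d a + n c d b = 0 := by
  obtain ⟨x, hx⟩ := exists_half_turns hp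
  choose! n hn using fun a b c (h : ∀ t, γ a b t - p c ≠ 0) => exists_turns _ h
  simp only [Path.source, Path.target] at hn
  refine ⟨n, x, fun i j h => (hx i j h).2, fun a b c d hac had hbc hbd hdis => ?_⟩
  have hne : ∀ s t, γ a b s ≠ γ c d t := fun s t h =>
    Set.disjoint_left.1 hdis ⟨s, rfl⟩ ⟨t, h.symm⟩
  obtain ⟨θa, θb, θc, θd, ⟨hc, hd, ha, hb⟩, square⟩ := exists_isAngle_of_disjoint _ _ hdis
  have around_c := hn a b c (fun t => sub_ne_zero.2 (by simpa using hne t 0)) _ hc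
  have around_d := hn a b d (fun t => sub_ne_zero.2 (by simpa using hne t 1)) _ hd
  have around_a := hn c d a (fun t => sub_ne_zero.2 (by simpa using (hne 0 t).symm)) _ ha
  have around_b := hn c d b (fun t => sub_ne_zero.2 (by simpa using (hne 1 t).symm)) _ hb
  have sum_eq : Real.pi * (2 * ((x b c : ℝ) - x a c - x b d + x a d + n a b c - n a b d - n c d a
      + n c d b)) = 0 := by
    linarith [(hx b c hbc).1, (hx a c hac).1, (hx b d hbd).1, (hx a d had).1]
  have cast_eq :
      (x b c : ℝ) - x a c - x b d + x a d + n a b c - n a b d - n c d a + n c d b = 0 := by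
    simpa [Real.pi_ne_zero] using sum_eq
  exact_mod_cast cast_eq

theorem not_pairwise_disjoint_paths_five (p : Fin 5 → ℂ) (γ : ∀ i j, Path (p i) (p j))
    (h : ∀ a b c d, a ≠ c → a ≠ d → b ≠ c → b ≠ d →
      Disjoint (Set.range (γ a b)) (Set.range (γ c d))) : False := by
  have hp : Function.Injective p := by
    intro i j hij
    by_contra hne
    exact Set.disjoint_left.1 (h i i j j hne hne hne hne) ⟨0, (γ i i).source⟩ ⟨0, by simp [hij]⟩
  obtain ⟨n, x, hx, hn⟩ := exists_turns_relation hp γ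
  have rel : ∀ a b c d, a ≠ c ∧ a ≠ d ∧ b ≠ c ∧ b ≠ d →
      x b c - x a c - x b d + x a d + n a b c - n a b d - n c d a + n c d b = 0 :=
    fun a b c d ⟨hac, had, hbc, hbd⟩ =>
      hn a b c d hac had hbc hbd (h a b c d hac had hbc hbd)
  -- The sum of these fifteen relations is odd: each `n i j k` occurs twice, and each unordered pair
  -- `{i, j}` in six terms `x i j` or `x j i`, of which altogether fifteen have `j < i`.
  have := rel 0 1 2 3 (by decide)
  have := rel 0 2 1 3 (by decide)
  have := rel 0 3 1 2 (by decide)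
  have := rel 0 1 2 4 (by decide)
  have := rel 0 2 1 4 (by decide)
  have := rel 0 4 1 2 (by decide)
  have := rel 0 1 3 4 (by decide)
  have := rel 0 3 1 4 (by decide)
  have := rel 0 4 1 3 (by decide)
  have := rel 0 2 3 4 (by decide)
  have := rel 0 3 2 4 (by decide)
  have := rel 0 4 2 3 (by decide)
  have := rel 1 2 3 4 (by decide)
  have := rel 1 3 2 4 (by decide)
  have := rel 1 4 2 3 (by decide)
  have := hx 0 1 (by decide)
  have := hx 0 2 (by decide)
  have := hx 0 3 (by decide)
  have := hx 0 4 (by decide)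
  have := hx 1 2 (by decide)
  have := hx 1 3 (by decide)
  have := hx 1 4 (by decide)
  have := hx 2 3 (by decide)
  have := hx 2 4 (by decide)
  have := hx 3 4 (by decide)
  omega

end Angles

/-! ### Dense graphs have complete minors -/

section Minor

variable {V : Type*} (G : SimpleGraph V)

/-- A model of the complete graph on `t` vertices as a minor of `G` inside `A`: connected branch
sets, any two of which are disjoint and joined by an edge. -/
structure CompleteMinor (t : ℕ) (A : Set V) where
  branch : Fin t → Set V
  subset : ∀ i, branch i ⊆ A
  connected : ∀ i, (G.induce (branch i)).Connected
  disjoint : ∀ i j, i ≠ j → Disjoint (branch i) (branch j)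
  adj : ∀ i j, i ≠ j → ∃ a ∈ branch i, ∃ b ∈ branch j, G.Adj a b

open Classical in
/-- The neighbours of `x` in `A`. -/
def nbrs (A : Finset V) (x : V) : Finset V := A.filter (G.Adj x)

/-- The number of ordered pairs of adjacent vertices of `A`, twice the number of edges inside
`A`. -/
def arcCount (A : Finset V) : ℕ := ∑ x ∈ A, (nbrs G A x).card

open Classical in
/-- The vertices of `A \ U` adjacent to `U`. -/
def boundary [DecidableEq V] (A U : Finset V) : Finset V :=
  (A \ U).filter fun x => ∃ u ∈ U, G.Adj u x

/-- `U` is connected, and the contraction of `U` to a single vertex leaves in `A` a graph with at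
least `m` edges per vertex. -/
def IsDenseContraction [DecidableEq V] (m : ℕ) (A U : Finset V) : Prop :=
  (G.induce (U : Set V)).Connected ∧
    2 * m * ((A \ U).card + 1) ≤ arcCount G (A \ U) + 2 * (boundary G A U).card

variable {G} {m : ℕ} {A U : Finset V}

theorem CompleteMinor.nonempty {t : ℕ} {A : Set V} (M : CompleteMinor G t A) (i : Fin t) :
    (M.branch i).Nonempty :=
  Set.nonempty_coe_sort.1 (M.connected i).nonempty

theorem nonempty_completeMinor_one {A : Set V} (hA : A.Nonempty) :
    Nonempty (CompleteMinor G 1 A) := by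
  obtain ⟨a, ha⟩ := hA
  exact ⟨⟨fun _ => {a}, by simpa using ha, fun _ => by simp,
    fun i j h => (h (Subsingleton.elim i j)).elim, fun i j h => (h (Subsingleton.elim i j)).elim⟩⟩

/-- The set `U` is the additional branch set. -/
theorem CompleteMinor.nonempty_succ {t : ℕ} {A A' U : Set V} (M : CompleteMinor G t A)
    (hA : A ⊆ A') (hU : U ⊆ A') (hconn : (G.induce U).Connected) (hdisj : Disjoint U A)
    (hadj : ∀ x ∈ A, ∃ a ∈ U, G.Adj a x) : Nonempty (CompleteMinor G (t + 1) A') := by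
  have adj_branch : ∀ i, ∃ a ∈ U, ∃ b ∈ M.branch i, G.Adj a b := fun i => by
    obtain ⟨b, hb⟩ := M.nonempty i
    obtain ⟨a, ha, hab⟩ := hadj b (M.subset i hb)
    exact ⟨a, ha, b, hb, hab⟩
  refine ⟨⟨Fin.cons U M.branch, Fin.cases hU fun i => (M.subset i).trans hA,
    Fin.cases hconn M.connected, ?_, ?_⟩⟩
  · intro i j
    induction i using Fin.cases <;> induction j using Fin.cases
    · simp
    · exact fun _ => hdisj.mono_right (M.subset _)
    · exact fun _ => (hdisj.mono_right (M.subset _)).symm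
    · exact fun h => M.disjoint _ _ fun h' => h (congrArg Fin.succ h')
  · intro i j
    induction i using Fin.cases with
    | zero =>
      induction j using Fin.cases with
      | zero => simp
      | succ j => exact fun _ => adj_branch j
    | succ i =>
      induction j using Fin.cases with
      | zero =>
        obtain ⟨a, ha, b, hb, hab⟩ := adj_branch i
        exact fun _ => ⟨b, hb, a, ha, hab.symm⟩
      | succ j => exact fun h => M.adj i j fun h' => h (congrArg Fin.succ h')

theorem arcCount_eq_erase [DecidableEq V] {x : V} (hx : x ∈ A) :
    arcCount G A = arcCount G (A.erase x) + 2 * (nbrs G A x).card := by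
  classical
  have card_nbrs : ∀ y ∈ A.erase x,
      (nbrs G A y).card = (nbrs G (A.erase x) y).card + if G.Adj x y then 1 else 0 := by
    intro y _
    unfold nbrs
    rw [Finset.filter_erase]
    split_ifs with h
    · rw [Finset.card_erase_add_one (by simp [hx, h.symm])]
    · rw [Finset.erase_eq_of_notMem (by simp [G.adj_comm y, h]), add_zero]
  have card_eq : ((A.erase x).filter (G.Adj x)).card = (nbrs G A x).card := by
    rw [Finset.filter_erase, Finset.erase_eq_of_notMem (by simp), nbrs]
  rw [arcCount, ← Finset.add_sum_erase A _ hx, Finset.sum_congr rfl card_nbrs,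
    Finset.sum_add_distrib, Finset.sum_boole, Nat.cast_id, card_eq, arcCount]
  ring

theorem mem_boundary [DecidableEq V] {x : V} :
    x ∈ boundary G A U ↔ (x ∈ A ∧ x ∉ U) ∧ ∃ u ∈ U, G.Adj u x := by
  classical
  rw [boundary, Finset.mem_filter, Finset.mem_sdiff]

theorem card_nbrs_add_card_boundary [DecidableEq V] {w : V} (hw : w ∈ boundary G A U) :
    (nbrs G (A \ U) w).card + (boundary G A U).card =
      (boundary G A (insert w U)).card + 1 + (nbrs G (boundary G A U) w).card := by
  have union_eq : nbrs G (A \ U) w ∪ (boundary G A U).erase w = boundary G A (insert w U) := by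
    ext x
    have : G.Adj w x → x ≠ w := fun h => h.ne'
    simp only [nbrs, mem_boundary, Finset.mem_union, Finset.mem_filter, Finset.mem_erase,
      Finset.mem_sdiff, Finset.mem_insert, not_or, exists_eq_or_imp]
    tauto
  have inter_eq : nbrs G (A \ U) w ∩ (boundary G A U).erase w = nbrs G (boundary G A U) w := by
    ext x
    have : G.Adj w x → x ≠ w := fun h => h.ne'
    simp only [nbrs, mem_boundary, Finset.mem_inter, Finset.mem_filter, Finset.mem_erase,
      Finset.mem_sdiff]
    tauto
  rw [← union_eq, ← inter_eq, add_right_comm, Finset.card_union_add_card_inter, add_assoc,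
    Finset.card_erase_add_one hw]

theorem isDenseContraction_singleton [DecidableEq V] {a : V} (ha : a ∈ A)
    (h : 2 * m * A.card ≤ arcCount G A) : IsDenseContraction G m A {a} := by
  have nbrs_eq : boundary G A {a} = nbrs G A a := by
    ext x
    have : G.Adj a x → x ≠ a := fun h => h.ne'
    simp only [mem_boundary, nbrs, Finset.mem_singleton, exists_eq_left, Finset.mem_filter]
    tauto
  refine ⟨by rw [Finset.coe_singleton]; simp, ?_⟩
  rw [nbrs_eq, Finset.sdiff_singleton_eq_erase, Finset.card_erase_add_one ha]
  rwa [arcCount_eq_erase ha] at h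

theorem IsDenseContraction.le_card_nbrs_boundary [DecidableEq V]
    (hU : IsDenseContraction G m A U) {w : V} (hw : w ∈ boundary G A U)
    (hmax : ¬ IsDenseContraction G m A (insert w U)) : m ≤ (nbrs G (boundary G A U) w).card := by
  obtain ⟨hwAU, u, hu, huw⟩ := mem_boundary.1 hw
  have hwAU : w ∈ A \ U := Finset.mem_sdiff.2 hwAU
  have connected : (G.induce (insert w U : Finset V)).Connected := by
    rw [Finset.coe_insert, Set.insert_eq, Set.union_comm]
    exact SimpleGraph.connected_induce_union hU.1.preconnected (by simp) hu rfl huw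
  have sparse : arcCount G (A \ insert w U) + 2 * (boundary G A (insert w U)).card <
      2 * m * ((A \ insert w U).card + 1) :=
    not_le.1 fun h => hmax ⟨connected, h⟩
  rw [Finset.sdiff_insert, Finset.card_erase_add_one hwAU] at sparse
  have dense := hU.2
  rw [arcCount_eq_erase hwAU] at dense
  have := card_nbrs_add_card_boundary hw
  have : 2 * m < 2 * ((nbrs G (boundary G A U) w).card + 1) := by linarith
  omega

theorem exists_dense_remainder_or_boundary [DecidableEq V] (hm : 0 < m) (hA : A.Nonempty)
    (h : 2 * m * A.card ≤ arcCount G A) :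
    (∃ B ⊂ A, B.Nonempty ∧ 2 * m * B.card ≤ arcCount G B) ∨
      ∃ U ⊆ A, (G.induce (U : Set V)).Connected ∧ (boundary G A U).Nonempty ∧
        m * (boundary G A U).card ≤ arcCount G (boundary G A U) := by
  classical
  obtain ⟨a, ha⟩ := hA
  obtain ⟨U, hU, hmax⟩ := (A.powerset.filter (IsDenseContraction G m A)).exists_maximal
    ⟨{a}, by simp [ha, isDenseContraction_singleton ha h]⟩
  simp only [Finset.mem_filter, Finset.mem_powerset] at hU hmax
  obtain ⟨hUA, hU⟩ := hU
  have hUne : U.Nonempty := Finset.coe_nonempty.1 (Set.nonempty_coe_sort.1 hU.1.nonempty)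
  rcases (boundary G A U).eq_empty_or_nonempty with hB | hB
  · have dense := hU.2
    rw [hB, Finset.card_empty, mul_zero, add_zero, mul_add_one] at dense
    refine .inl ⟨A \ U, Finset.sdiff_ssubset hUA hUne, ?_, by omega⟩
    rw [Finset.nonempty_iff_ne_empty]
    intro hempty
    rw [hempty, arcCount, Finset.sum_empty] at dense
    omega
  · refine .inr ⟨U, hUA, hU.1, hB, ?_⟩
    rw [mul_comm, ← smul_eq_mul]
    refine Finset.card_nsmul_le_sum _ _ _ fun w hw => hU.le_card_nbrs_boundary hw fun hins => ?_
    have hwA := (mem_boundary.1 hw).1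
    exact hwA.2 (hmax ⟨Finset.insert_subset hwA.1 hUA, hins⟩ (Finset.subset_insert w U)
      (Finset.mem_insert_self w U))

theorem exists_completeMinor (t : ℕ) (A : Finset V) (hA : A.Nonempty)
    (h : 2 ^ (t + 1) * A.card ≤ arcCount G A) : Nonempty (CompleteMinor G (t + 1) A) := by
  classical
  induction t generalizing A with
  | zero => exact nonempty_completeMinor_one (by exact_mod_cast hA)
  | succ t ih =>
    induction A using Finset.strongInduction with
    | H A ihA =>
    rw [pow_succ'] at h
    rcases exists_dense_remainder_or_boundary (by positivity) hA h with
      ⟨B, hBA, hB, dense⟩ | ⟨U, hUA, hU, hB, dense⟩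
    · obtain ⟨M⟩ := ihA B hBA hB (by rwa [pow_succ'])
      exact ⟨{ M with subset := fun i => (M.subset i).trans (by exact_mod_cast hBA.1) }⟩
    · obtain ⟨M⟩ := ih _ hB dense
      exact M.nonempty_succ (fun x hx => (mem_boundary.1 hx).1.1) (by exact_mod_cast hUA) hU
        (Set.disjoint_left.2 fun x hx hx' => (mem_boundary.1 hx').1.2 hx)
        fun x hx => (mem_boundary.1 hx).2

end Minor

/-! ### Planar graphs and thickness -/

section Planar

variable {V : Type*} {G : SimpleGraph V}

/-- The part of a drawing that belongs to the subgraph induced by `S`. -/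
def PlaneDrawing.trace (d : PlaneDrawing G) (S : Set V) : Set (EuclideanSpace ℝ (Fin 2)) :=
  d.pt '' S ∪ {q | ∃ u ∈ S, ∃ w ∈ S, G.Adj u w ∧ q ∈ d.arc s(u, w)}

theorem PlaneDrawing.disjoint_trace (d : PlaneDrawing G) {S T : Set V} (h : Disjoint S T) :
    Disjoint (d.trace S) (d.trace T) := by
  have mem_of_mem_edge : ∀ {R : Set V} {u w z : V}, u ∈ R → w ∈ R → z ∈ s(u, w) → z ∈ R :=
    fun hu hw hz => by rcases Sym2.mem_iff.1 hz with rfl | rfl <;> assumption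
  rw [Set.disjoint_left] at h ⊢
  rintro q (⟨u, hu, rfl⟩ | ⟨u, hu, w, hw, huw, hq⟩)
    (⟨u', hu', hpt⟩ | ⟨u', hu', w', hw', huw', hq'⟩)
  · exact h hu (d.pt_injective hpt ▸ hu')
  · exact h hu (mem_of_mem_edge hu' hw' (d.vertex_of_mem_arc _ (G.mem_edgeSet.2 huw') u hq'))
  · exact h (mem_of_mem_edge hu hw
      (d.vertex_of_mem_arc _ (G.mem_edgeSet.2 huw) u' (hpt ▸ hq))) hu'
  · have hne : s(u, w) ≠ s(u', w') := fun he =>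
      h hu (mem_of_mem_edge hu' hw' (he ▸ Sym2.mem_mk_left u w))
    obtain ⟨z, hz, hz', -⟩ := d.arc_inter _ (G.mem_edgeSet.2 huw) _ (G.mem_edgeSet.2 huw') hne
      ⟨hq, hq'⟩
    exact h (mem_of_mem_edge hu hw hz) (mem_of_mem_edge hu' hw' hz')

theorem PlaneDrawing.joinedIn_trace (d : PlaneDrawing G) {S : Set V} {u w : S}
    (h : (G.induce S).Reachable u w) : JoinedIn (d.trace S) (d.pt u) (d.pt w) := by
  obtain ⟨p⟩ := h
  induction p with
  | @nil u => exact JoinedIn.refl (.inl ⟨u, u.2, rfl⟩)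
  | @cons u v _ huv _ ih =>
    obtain ⟨f, -, range_eq⟩ := d.isArc u v huv
    exact JoinedIn.trans ⟨f, fun t => .inr ⟨u, u.2, v, v.2, huv, range_eq ▸ ⟨t, rfl⟩⟩⟩ ih

theorem IsPlanar.isEmpty_completeMinor_five (h : IsPlanar G) {A : Set V} :
    IsEmpty (CompleteMinor G 5 A) := by
  refine ⟨fun M => ?_⟩
  obtain ⟨d⟩ := h
  choose c hc using fun i => M.nonempty i
  have joined : ∀ i j,
      JoinedIn (d.trace (M.branch i ∪ M.branch j)) (d.pt (c i)) (d.pt (c j)) := by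
    intro i j
    rcases eq_or_ne i j with rfl | hij
    · exact JoinedIn.refl (.inl ⟨_, .inl (hc i), rfl⟩)
    · obtain ⟨a, ha, b, hb, hab⟩ := M.adj i j hij
      exact d.joinedIn_trace (u := ⟨c i, .inl (hc i)⟩) (w := ⟨c j, .inr (hc j)⟩)
        ((SimpleGraph.connected_induce_union (M.connected i).preconnected
          (M.connected j).preconnected ha hb hab).preconnected _ _)
  choose γ hγ using joined
  let toComplex : EuclideanSpace ℝ (Fin 2) ≃ₗᵢ[ℝ] ℂ := Complex.orthonormalBasisOneI.repr.symm
  refine not_pairwise_disjoint_paths_five (fun i => toComplex (d.pt (c i)))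
    (fun i j => (γ i j).map toComplex.continuous) fun i j k l hik hil hjk hjl => ?_
  have disjoint : Disjoint (d.trace (M.branch i ∪ M.branch j))
      (d.trace (M.branch k ∪ M.branch l)) := d.disjoint_trace <| by
    simp only [Set.disjoint_union_left, Set.disjoint_union_right]
    exact ⟨⟨M.disjoint _ _ hik, M.disjoint _ _ hjk⟩, M.disjoint _ _ hil, M.disjoint _ _ hjl⟩
  rw [Set.disjoint_left]
  rintro _ ⟨s, rfl⟩ ⟨t, ht⟩
  exact Set.disjoint_left.1 disjoint (hγ i j s) (toComplex.injective ht ▸ hγ k l t)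

theorem IsPlanar.arcCount_le (h : IsPlanar G) (A : Finset V) : arcCount G A ≤ 32 * A.card := by
  rcases A.eq_empty_or_nonempty with rfl | hA
  · simp [arcCount]
  · by_contra hlt
    obtain ⟨M⟩ := exists_completeMinor (G := G) 4 A hA (by omega)
    exact h.isEmpty_completeMinor_five.elim M

/-- The point with abscissa `x` of the standard parabola, no three points of which are
collinear. -/
def parabola (x : ℝ) : EuclideanSpace ℝ (Fin 2) := !₂[x, x ^ 2]

theorem parabola_injective : Function.Injective parabola :=
  fun x y h => by simpa [parabola] using congrArg (· 0) h

theorem eq_or_eq_of_parabola_mem_segment {x y z : ℝ}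
    (h : parabola z ∈ segment ℝ (parabola x) (parabola y)) : z = x ∨ z = y := by
  obtain ⟨a, b, -, -, hab, hz⟩ := h
  obtain rfl : a = 1 - b := by linarith
  have abscissa : (1 - b) * x + b * y = z := by simpa [parabola] using congrArg (· 0) hz
  have ordinate : (1 - b) * x ^ 2 + b * y ^ 2 = z ^ 2 := by
    simpa [parabola] using congrArg (· 1) hz
  have : (z - x) * (z - y) = 0 := by
    linear_combination (x + y) * abscissa - ordinate
  simpa only [mul_eq_zero, sub_eq_zero] using this

theorem isPlanar_fromEdgeSet_singleton (f : V ↪ ℝ) (e : Sym2 V) :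
    IsPlanar (SimpleGraph.fromEdgeSet {e}) := by
  have hinj : Function.Injective fun v => parabola (f v) :=
    parabola_injective.comp f.injective
  refine ⟨⟨fun v => parabola (f v), hinj,
    fun e => {q | ∃ u w, e = s(u, w) ∧ q ∈ segment ℝ (parabola (f u)) (parabola (f w))},
    ?_, ?_, ?_⟩⟩
  · intro u w huw
    refine ⟨Path.segment (parabola (f u)) (parabola (f w)), ?_, ?_⟩
    · exact Path.segment_injective_of_ne (hinj.ne huw.ne)
    · rw [Path.range_segment]
      refine Set.Subset.antisymm (fun q hq => ⟨u, w, rfl, hq⟩) ?_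
      rintro q ⟨u', w', he, hq⟩
      rcases Sym2.eq_iff.1 he with ⟨rfl, rfl⟩ | ⟨rfl, rfl⟩
      · exact hq
      · rwa [segment_symm]
  · rintro e - z ⟨u, w, rfl, hz⟩
    exact Sym2.mem_iff.2 ((eq_or_eq_of_parabola_mem_segment hz).imp
      (fun h => f.injective h) fun h => f.injective h)
  · intro e he e' he' hne
    simp only [SimpleGraph.edgeSet_fromEdgeSet, Set.mem_sdiff, Set.mem_singleton_iff] at he he'
    exact (hne (he.1.trans he'.1.symm)).elim

theorem exists_planar_partition [Finite V] (G : SimpleGraph V) :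
    ∃ (t : ℕ) (H : Fin t → SimpleGraph V), (∀ i, IsPlanar (H i)) ∧
      Pairwise (fun i j => Disjoint (H i) (H j)) ∧ ⨆ i, H i = G := by
  obtain ⟨f⟩ := nonempty_embedding_nat V
  let edge := (Finite.equivFin G.edgeSet).symm
  refine ⟨_, fun i => SimpleGraph.fromEdgeSet {(edge i : Sym2 V)},
    fun i => isPlanar_fromEdgeSet_singleton (f.trans Nat.castEmbedding) _, ?_, ?_⟩
  · intro i j hij
    rw [SimpleGraph.disjoint_left]
    intro x y hx hy
    simp only [SimpleGraph.fromEdgeSet_adj, Set.mem_singleton_iff] at hx hy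
    exact hij (edge.injective (Subtype.ext (hx.1.symm.trans hy.1)))
  · ext x y
    simp only [SimpleGraph.iSup_adj, SimpleGraph.fromEdgeSet_adj, Set.mem_singleton_iff]
    refine ⟨fun ⟨i, hi, _⟩ => ?_, fun h => ⟨edge.symm ⟨s(x, y), h⟩,
      by rw [edge.apply_symm_apply], h.ne⟩⟩
    exact G.mem_edgeSet.1 (hi ▸ (edge i).2)

theorem arcCount_iSup_le {ι : Type*} [Fintype ι] (H : ι → SimpleGraph V) (A : Finset V) :
    arcCount (⨆ i, H i) A ≤ ∑ i, arcCount (H i) A := by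
  classical
  simp only [arcCount]
  rw [Finset.sum_comm]
  refine Finset.sum_le_sum fun x _ => ?_
  have nbrs_subset : nbrs (⨆ i, H i) A x ⊆ Finset.univ.biUnion fun i => nbrs (H i) A x := by
    intro y hy
    simpa [nbrs] using hy
  exact (Finset.card_le_card nbrs_subset).trans Finset.card_biUnion_le

theorem arcCount_le_thickness [Finite V] (G : SimpleGraph V) (A : Finset V) :
    arcCount G A ≤ 32 * A.card * thickness G := by
  obtain ⟨H, planar, -, iSup_eq⟩ : ∃ H : Fin (thickness G) → SimpleGraph V, (∀ i, IsPlanar (H i)) ∧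
      Pairwise (fun i j => Disjoint (H i) (H j)) ∧ ⨆ i, H i = G :=
    Nat.sInf_mem (exists_planar_partition G)
  calc arcCount G A ≤ ∑ i, arcCount (H i) A := by
        conv_lhs => rw [← iSup_eq]
        exact arcCount_iSup_le H A
    _ ≤ ∑ _i : Fin (thickness G), 32 * A.card :=
      Finset.sum_le_sum fun i _ => (planar i).arcCount_le A
    _ = 32 * A.card * thickness G := by simp [mul_comm]

end Planar

theorem Network.card_commEdges_le {N : ℕ} (Φ : Network N) :
    Φ.commEdges.card ≤ 32 * N * thickness Φ.graph := by
  have card_eq : Φ.commEdges.card = arcCount Φ.graph Finset.univ := by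
    rw [commEdges, ← Finset.univ_product_univ, Finset.card_filter, Finset.sum_product]
    simp only [arcCount, nbrs, Finset.card_filter]
  simpa [card_eq] using arcCount_le_thickness Φ.graph Finset.univ

/-! ### Reasoning about programs -/

section Logic

/-- A memory location: a register, or a whole array. -/
inductive Loc
  | nreg (i : ℕ)
  | rreg (i : ℕ)
  | narr (a : ℕ)
  | rarr (a : ℕ)
  deriving DecidableEq

/-- The states `s` and `s'` have the same contents at a location. -/
def State.AgreeAt (s s' : State) : Loc → Prop
  | .nreg i => s'.nreg i = s.nreg i
  | .rreg i => s'.rreg i = s.rreg i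
  | .narr a => s'.narr a = s.narr a
  | .rarr a => s'.rarr a = s.rarr a

/-- The state with the register `i` set to `x`. -/
def State.setN (s : State) (i x : ℕ) : State := { s with nreg := Function.update s.nreg i x }

namespace Cmd

/-- The locations that a program may change. -/
def writes : Cmd → List Loc
  | skip => []
  | nset i _ => [.nreg i]
  | rset i _ => [.rreg i]
  | nput a _ _ => [.narr a]
  | rput a _ _ => [.rarr a]
  | draw i _ => [.nreg i]
  | seq p q => p.writes ++ q.writes
  | ite _ p q => p.writes ++ q.writes
  | .while _ p => p.writes

/-- The program has no loops. -/
def loopFree : Cmd → Bool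
  | seq p q => p.loopFree && q.loopFree
  | ite _ p q => p.loopFree && q.loopFree
  | .while _ _ => false
  | _ => true

/-- A bound for the running time of a loop-free program (`0` for a loop). -/
def maxCost : Cmd → ℕ
  | skip => 1
  | nset _ x => x.cost + 1
  | rset _ x => x.cost + 1
  | nput _ idx x => idx.cost + x.cost + 1
  | rput _ idx x => idx.cost + x.cost + 1
  | draw _ bound => bound.cost + 1
  | seq p q => p.maxCost + q.maxCost
  | ite b p q => b.cost + (p.maxCost + q.maxCost)
  | .while _ _ => 0

open Classical in
/-- The final state of a loop-free program (a loop is skipped). -/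
def run (ω : Tape) : Cmd → State → State
  | skip, s => s
  | nset i x, s => s.setN i (x.eval s)
  | rset i x, s => { s with rreg := Function.update s.rreg i (x.eval s) }
  | nput a idx x, s =>
    { s with
      narr := Function.update s.narr a (Function.update (s.narr a) (idx.eval s) (x.eval s)) }
  | rput a idx x, s =>
    { s with
      rarr := Function.update s.rarr a (Function.update (s.rarr a) (idx.eval s) (x.eval s)) }
  | draw i bound, s =>
    { s with
      nreg := Function.update s.nreg i (ω (s.draws, bound.eval s)).val
      draws := s.draws + 1 }
  | seq p q, s => q.run ω (p.run ω s)
  | ite b p q, s => if b.eval s then p.run ω s else q.run ω s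
  | .while _ _, s => s

end Cmd

/-- The states agree outside the locations which `p` may change. -/
def Frame (p : Cmd) (s s' : State) : Prop := ∀ l ∉ p.writes, s.AgreeAt s' l

/-- The program `p`, started in `s`, halts after a time `t` in a state `s'` with `Q t s'`. -/
def Runs (ω : Tape) (p : Cmd) (s : State) (Q : ℕ → State → Prop) : Prop :=
  ∃ t s', Exec ω p s t s' ∧ Q t s'

/-- `for i = 0, …, n - 1 do body`. -/
def forN (i : ℕ) (n : NExp) (body : Cmd) : Cmd :=
  .seq (.nset i (.const 0))
    (.while (.not (.nle n (.reg i))) (.seq body (.nset i (.add (.reg i) (.const 1)))))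

variable {ω : Tape} {p q : Cmd} {s s' s'' : State} {Q Q' : ℕ → State → Prop}

@[simp]
theorem setN_nreg_self (s : State) (i x : ℕ) : (s.setN i x).nreg i = x := Function.update_self ..

theorem Test.cost_pos (b : Test) : 0 < b.cost := by
  cases b <;> exact Nat.succ_pos _

theorem Frame.refl (p : Cmd) (s : State) : Frame p s s := fun l _ => by cases l <;> rfl

theorem Frame.trans (h : Frame p s s') (h' : Frame p s' s'') : Frame p s s'' := fun l hl => by
  have := h l hl
  have := h' l hl
  cases l <;> simp_all only [State.AgreeAt]

theorem Frame.mono (h : Frame p s s') (hpq : p.writes ⊆ q.writes) : Frame q s s' :=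
  fun l hl => h l fun hl' => hl (hpq hl')

section

variable (h : Frame p s s') {i : ℕ}
include h

theorem Frame.nreg (hi : .nreg i ∉ p.writes := by decide) : s'.nreg i = s.nreg i := h _ hi

theorem Frame.rreg (hi : .rreg i ∉ p.writes := by decide) : s'.rreg i = s.rreg i := h _ hi

theorem Frame.narr (hi : .narr i ∉ p.writes := by decide) : s'.narr i = s.narr i := h _ hi

theorem Frame.rarr (hi : .rarr i ∉ p.writes := by decide) : s'.rarr i = s.rarr i := h _ hi

end

theorem Exec.frame {t : ℕ} (h : Exec ω p s t s') : Frame p s s' := by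
  induction h with
  | skip | while_false => exact Frame.refl _ _
  | nset | rset | nput | rput | draw =>
    intro l hl
    cases l <;> first | rfl | exact Function.update_of_ne (by simpa [Cmd.writes] using hl) _ _
  | seq _ _ ihp ihq =>
    exact (ihp.mono (List.subset_append_left _ _)).trans (ihq.mono (List.subset_append_right _ _))
  | ite_true _ _ ih => exact ih.mono (List.subset_append_left _ _)
  | ite_false _ _ ih => exact ih.mono (List.subset_append_right _ _)
  | while_true _ _ _ ihp ihw => exact (ihp.mono (List.Subset.refl _)).trans ihw

theorem Runs.mono (h : Runs ω p s Q) (hQ : ∀ t s', Frame p s s' → Q t s' → Q' t s') :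
    Runs ω p s Q' :=
  let ⟨t, s', exec, hs'⟩ := h
  ⟨t, s', exec, hQ t s' exec.frame hs'⟩

theorem Runs.seq (h : Runs ω p s fun t s' => Runs ω q s' fun t' s'' => Q (t + t') s'') :
    Runs ω (p.seq q) s Q :=
  let ⟨t, _, exec, t', s'', exec', hs''⟩ := h
  ⟨t + t', s'', .seq exec exec', hs''⟩

theorem Runs.ite {b : Test} (ht : b.eval s → Runs ω p s fun t s' => Q (b.cost + t) s')
    (hf : ¬ b.eval s → Runs ω q s fun t s' => Q (b.cost + t) s') : Runs ω (.ite b p q) s Q := by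
  by_cases hb : b.eval s
  · obtain ⟨t, s', exec, hs'⟩ := ht hb
    exact ⟨_, s', .ite_true hb exec, hs'⟩
  · obtain ⟨t, s', exec, hs'⟩ := hf hb
    exact ⟨_, s', .ite_false hb exec, hs'⟩

theorem exists_exec_run (ω : Tape) (p : Cmd) (s : State) (hp : p.loopFree) :
    ∃ t ≤ p.maxCost, Exec ω p s t (p.run ω s) := by
  induction p generalizing s with
  | skip => exact ⟨_, le_rfl, .skip s⟩
  | nset i x => exact ⟨_, le_rfl, .nset i x s⟩
  | rset i x => exact ⟨_, le_rfl, .rset i x s⟩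
  | nput a idx x => exact ⟨_, le_rfl, .nput a idx x s⟩
  | rput a idx x => exact ⟨_, le_rfl, .rput a idx x s⟩
  | draw i b => exact ⟨_, le_rfl, .draw i b s⟩
  | seq p q ihp ihq =>
    simp only [Cmd.loopFree, Bool.and_eq_true] at hp
    obtain ⟨t, ht, exec⟩ := ihp s hp.1
    obtain ⟨t', ht', exec'⟩ := ihq (p.run ω s) hp.2
    exact ⟨t + t', add_le_add ht ht', .seq exec exec'⟩
  | ite b p q ihp ihq =>
    simp only [Cmd.loopFree, Bool.and_eq_true] at hp
    by_cases hb : b.eval s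
    · obtain ⟨t, ht, exec⟩ := ihp s hp.1
      refine ⟨b.cost + t, by simp only [Cmd.maxCost]; omega, ?_⟩
      rw [Cmd.run, if_pos hb]
      exact .ite_true hb exec
    · obtain ⟨t, ht, exec⟩ := ihq s hp.2
      refine ⟨b.cost + t, by simp only [Cmd.maxCost]; omega, ?_⟩
      rw [Cmd.run, if_neg hb]
      exact .ite_false hb exec
  | _ => simp [Cmd.loopFree] at hp

theorem Runs.of_loopFree (h : ∀ t ≤ p.maxCost, Frame p s (p.run ω s) → Q t (p.run ω s))
    (hp : p.loopFree := by decide) : Runs ω p s Q := by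
  obtain ⟨t, ht, exec⟩ := exists_exec_run ω p s hp
  exact ⟨t, _, exec, h t ht exec.frame⟩

/-- The decrease of the potential `pot` pays for the time. -/
theorem Runs.while {b : Test} (Inv : State → Prop) (pot : State → ℕ) (h0 : Inv s)
    (step : ∀ s', Frame (.while b p) s s' → Inv s' → b.eval s' →
      Runs ω p s' fun t s'' => Inv s'' ∧ b.cost + t + pot s'' ≤ pot s') :
    Runs ω (.while b p) s fun t s' => (Inv s' ∧ ¬ b.eval s') ∧ t + pot s' ≤ pot s + b.cost := by
  induction hn : pot s using Nat.strong_induction_on generalizing s with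
  | _ n ih =>
    subst hn
    by_cases hb : b.eval s
    · obtain ⟨t, s', exec, hI, time⟩ := step s (Frame.refl _ _) h0 hb
      have frame : Frame (.while b p) s s' := exec.frame.mono (List.Subset.refl _)
      have := b.cost_pos
      obtain ⟨t', s'', exec', hs'', time'⟩ := ih (pot s') (by omega) hI
        (fun u hu => step u (frame.trans hu)) rfl
      exact ⟨_, s'', .while_true hb exec exec', hs'', by omega⟩
    · exact ⟨_, s, .while_false hb, ⟨h0, hb⟩, by omega⟩

/-- The decrease of the potential `pot` pays for the time of the body in excess of `T`. -/
theorem Runs.forN {i : ℕ} {n : NExp} {body : Cmd} (k T : ℕ) (Inv : ℕ → State → Prop)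
    (pot : State → ℕ) (count : ∀ s', Frame (forN i n body) s s' → n.eval s' = k) (h0 : Inv 0 s)
    (step : ∀ j < k, ∀ s', Frame (STDMA.forN i n body) s s' → s'.nreg i = j → Inv j s' →
      Runs ω body s' fun t s'' => Inv (j + 1) s'' ∧ t + pot s'' ≤ pot s' + T)
    (inv_setN : ∀ j s' x, Inv j s' → Inv j (s'.setN i x) := by exact fun _ _ _ h => h)
    (pot_setN : ∀ s' x, pot (s'.setN i x) = pot s' := by exact fun _ _ => rfl)
    (hi : Loc.nreg i ∉ body.writes := by decide) :
    Runs ω (STDMA.forN i n body) s fun t s' =>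
      Inv k s' ∧ t + pot s' ≤ pot s + (k + 1) * (T + n.cost + 10) := by
  have exec := Exec.nset (ω := ω) i (.const 0) s
  have frame : Frame (STDMA.forN i n body) s (s.setN i 0) :=
    exec.frame.mono (List.subset_append_left _ _)
  refine Runs.seq ⟨_, s.setN i 0, exec, ?_⟩
  refine (Runs.while (fun s' => s'.nreg i ≤ k ∧ Inv (s'.nreg i) s')
    (fun s' => pot s' + (k - s'.nreg i) * (T + n.cost + 10)) ?_ ?_).mono ?_
  · simpa using inv_setN 0 s 0 h0
  · rintro s' frame' ⟨-, hI⟩ hb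
    have frame' := frame.trans (frame'.mono (List.subset_append_right [Loc.nreg i] _))
    have hlt : s'.nreg i < k := by simpa [Test.eval, NExp.eval, count s' frame'] using hb
    refine Runs.seq ((step _ hlt s' frame' rfl hI).mono ?_)
    rintro t s'' body_frame ⟨hI', time⟩
    have hreg : s''.nreg i = s'.nreg i := body_frame.nreg hi
    refine ⟨_, s''.setN i (s''.nreg i + 1), .nset i (.add (.reg i) (.const 1)) s'', ?_⟩
    obtain ⟨d, hd⟩ : ∃ d, k - s'.nreg i = d + 1 := ⟨k - s'.nreg i - 1, by omega⟩
    have hd' : k - (s'.nreg i + 1) = d := by omega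
    simp only [setN_nreg_self, hreg, pot_setN, hd, hd', add_mul, Test.cost, NExp.cost]
    exact ⟨⟨hlt, inv_setN _ _ _ hI'⟩, by omega⟩
  · rintro t s' frame' ⟨⟨⟨hle, hI⟩, hb⟩, time⟩
    have frame' := frame.trans (frame'.mono (List.subset_append_right [Loc.nreg i] _))
    have hk : k ≤ s'.nreg i := by simpa [Test.eval, NExp.eval, count s' frame'] using hb
    obtain hreg : s'.nreg i = k := by omega
    simp only [setN_nreg_self, pot_setN, hreg, Test.cost, NExp.cost, add_mul, tsub_self,
      tsub_zero] at time hI ⊢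
    exact ⟨hI, by omega⟩

theorem Runs.forN_loopFree {i : ℕ} {n : NExp} {body : Cmd} (k T : ℕ) (Inv : ℕ → State → Prop)
    (count : ∀ s', Frame (STDMA.forN i n body) s s' → n.eval s' = k) (h0 : Inv 0 s)
    (step : ∀ j < k, ∀ s', Frame (STDMA.forN i n body) s s' → s'.nreg i = j → Inv j s' →
      Inv (j + 1) (body.run ω s'))
    (inv_setN : ∀ j s' x, Inv j s' → Inv j (s'.setN i x) := by exact fun _ _ _ h => h)
    (hi : Loc.nreg i ∉ body.writes := by decide) (hp : body.loopFree := by decide)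
    (hT : body.maxCost + n.cost + 10 ≤ T := by decide) :
    Runs ω (STDMA.forN i n body) s fun t s' => Inv k s' ∧ t ≤ T * (k + 1) := by
  refine (Runs.forN k body.maxCost Inv (fun _ => 0) count h0 (fun j hj s' frame hreg hI =>
    Runs.of_loopFree (fun t ht _ => ⟨step j hj s' frame hreg hI, by omega⟩) hp) inv_setN
    (hi := hi)).mono ?_
  rintro t s' - ⟨hI, time⟩
  have : (k + 1) * (body.maxCost + n.cost + 10) ≤ (k + 1) * T := Nat.mul_le_mul_left _ hT
  exact ⟨hI, by rw [mul_comm T]; omega⟩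

theorem Runs.forN_entrywise {β : Type*} {i : ℕ} {n : NExp} {body : Cmd} (k T : ℕ)
    (A : State → ℕ → β) (R : ℕ → β → Prop)
    (count : ∀ s', Frame (STDMA.forN i n body) s s' → n.eval s' = k)
    (step : ∀ j < k, ∀ s', Frame (STDMA.forN i n body) s s' → s'.nreg i = j → A s' j = A s j →
      R j (A (body.run ω s') j) ∧ ∀ l ≠ j, A (body.run ω s') l = A s' l)
    (A_setN : ∀ s' x, A (s'.setN i x) = A s' := by exact fun _ _ => rfl)
    (hi : Loc.nreg i ∉ body.writes := by decide) (hp : body.loopFree := by decide)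
    (hT : body.maxCost + n.cost + 10 ≤ T := by decide) :
    Runs ω (STDMA.forN i n body) s fun t s' => (∀ j < k, R j (A s' j)) ∧ t ≤ T * (k + 1) := by
  refine (Runs.forN_loopFree k T
    (fun j s' => (∀ l < j, R l (A s' l)) ∧ ∀ l, j ≤ l → A s' l = A s l) count
    ⟨fun _ h => absurd h (Nat.not_lt_zero _), fun _ _ => rfl⟩ ?_ ?_ hi hp hT).mono
    fun t s' _ h => ⟨h.1.1, h.2⟩
  · rintro j hj s' frame hreg ⟨hR, rest⟩
    obtain ⟨hj, other⟩ := step j hj s' frame hreg (rest j le_rfl)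
    refine ⟨fun l hl => ?_, fun l hl => by rw [other l (by omega), rest l (by omega)]⟩
    rcases Nat.lt_succ_iff_lt_or_eq.1 hl with hlt | rfl
    · exact other l hlt.ne ▸ hR l hlt
    · exact hj
  · exact fun j s' x h => by rwa [A_setN]

end Logic

/-! ### Colourings -/

section Colorings

variable {N : ℕ} {Φ : Network N} {C : Coloring N} {x : Link N} {r : ℕ}

theorem mem_existing : r ∈ existing C ↔ r ≠ 0 ∧ ∃ h, C h = r := by
  simp only [existing, Finset.mem_image, Finset.mem_filter, Finset.mem_univ, true_and]
  exact ⟨fun ⟨h, h0, hr⟩ => ⟨hr ▸ h0, h, hr⟩, fun ⟨hr0, h, hr⟩ => ⟨h, hr ▸ hr0, hr⟩⟩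

theorem mem_conflicting : r ∈ conflicting C x ↔ r ≠ 0 ∧ ∃ h, C h = r ∧ PrimaryConflict x h := by
  simp only [conflicting, Finset.mem_image, Finset.mem_filter, Finset.mem_univ, true_and]
  exact ⟨fun ⟨h, ⟨h0, hx⟩, hr⟩ => ⟨hr ▸ h0, h, hr, hx⟩,
    fun ⟨hr0, h, hr, hx⟩ => ⟨h, ⟨hr ▸ hr0, hx⟩, hr⟩⟩

theorem firstConflictFreeColor_ne_zero (Φ : Network N) (C : Coloring N) (x : Link N) :
    firstConflictFreeColor Φ C x ≠ 0 := by
  classical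
  unfold firstConflictFreeColor
  split_ifs with hne
  · have hmem := Finset.min'_mem _ hne
    rw [Finset.mem_filter, Finset.mem_sdiff] at hmem
    exact (mem_existing.1 hmem.1.1).1
  · exact Nat.succ_ne_zero _

/-- The link `x` may get the existing colour `r`. -/
def IsAdmissible (Φ : Network N) (C : Coloring N) (x : Link N) (r : ℕ) : Prop :=
  r ∉ conflicting C x ∧ SINRCompliant Φ C x r

theorem isLeast_firstConflictFreeColor {K : ℕ} (hK : existing C = Finset.Icc 1 K) :
    IsLeast {r | r = K + 1 ∨ 1 ≤ r ∧ r ≤ K ∧ IsAdmissible Φ C x r}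
      (firstConflictFreeColor Φ C x) := by
  classical
  have mem_iff : ∀ r, r ∈ (existing C \ conflicting C x).filter (SINRCompliant Φ C x) ↔
      1 ≤ r ∧ r ≤ K ∧ IsAdmissible Φ C x r := fun r => by
    rw [Finset.mem_filter, Finset.mem_sdiff, hK, Finset.mem_Icc, IsAdmissible]
    tauto
  unfold firstConflictFreeColor
  split_ifs with hne
  · have hmin := (mem_iff _).1 (Finset.min'_mem _ hne)
    refine ⟨.inr hmin, ?_⟩
    rintro r (rfl | hr)
    · exact hmin.2.1.trans (Nat.le_succ K)
    · exact Finset.min'_le _ _ ((mem_iff r).2 hr)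
  · refine ⟨.inl (by simp [hK]), ?_⟩
    rintro r (rfl | hr)
    · simp [hK]
    · exact absurd ⟨r, (mem_iff r).2 hr⟩ hne

/-- The link `h` has no primary conflict with `x`, and its SINR remains sufficient when `x` gets
its colour, if `I` is the interference at the receiver of `h` without `x`. -/
def Tolerates (Φ : Network N) (x h : Link N) (I : ℝ) : Prop :=
  ¬ PrimaryConflict x h ∧ Φ.γc ≤ Φ.power h.1 h.2 / (Φ.N₀ + (I + Φ.power x.1 h.2))

open Classical in
/-- The interference at the receiver of `h` from the other links of its colour. -/
def interference (Φ : Network N) (C : Coloring N) (h : Link N) : ℝ :=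
  ∑ g ∈ (Finset.univ.filter fun g => C g = C h).erase h, Φ.power g.1 h.2

open Classical in
/-- The interference at the receiver of the link `x` from the links of colour `r`. -/
def load (Φ : Network N) (C : Coloring N) (x : Link N) (r : ℕ) : ℝ :=
  ∑ g ∈ Finset.univ.filter (fun g => C g = r), Φ.power g.1 x.2

theorem sinrCompliant_iff (hx : C x = 0) (hr : r ≠ 0) :
    SINRCompliant Φ C x r ↔ Φ.γc ≤ Φ.power x.1 x.2 / (Φ.N₀ + load Φ C x r) ∧
      ∀ h, C h = r →
        Φ.γc ≤ Φ.power h.1 h.2 / (Φ.N₀ + (interference Φ C h + Φ.power x.1 h.2)) := by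
  classical
  have hxr : x ∉ Finset.univ.filter fun g => C g = r := by simp [hx, hr.symm]
  unfold SINRCompliant Network.SINR
  rw [Finset.forall_mem_insert, Finset.erase_insert hxr]
  refine and_congr (by rw [load]) (forall_congr' fun h => ?_)
  simp only [Finset.mem_filter, Finset.mem_univ, true_and]
  refine imp_congr_right fun hh => ?_
  have hne : x ≠ h := fun hxh => hr (by rw [← hh, ← hxh, hx])
  rw [Finset.erase_insert_of_ne hne, Finset.sum_insert (by simp [hx, hr.symm]), interference, hh,
    add_comm (Φ.power x.1 h.2)]

theorem isAdmissible_iff (hx : C x = 0) (hr : r ≠ 0) :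
    IsAdmissible Φ C x r ↔ (∀ h, C h = r → Tolerates Φ x h (interference Φ C h)) ∧
      Φ.γc ≤ Φ.power x.1 x.2 / (Φ.N₀ + load Φ C x r) := by
  rw [IsAdmissible, sinrCompliant_iff hx hr, mem_conflicting]
  simp only [Tolerates, ne_eq, hr, not_false_eq_true, true_and, not_exists, not_and]
  exact ⟨fun ⟨hc, hl, hh⟩ => ⟨fun h hr => ⟨hc h hr, hh h hr⟩, hl⟩,
    fun ⟨ht, hl⟩ => ⟨fun h hr => (ht h hr).1, hl, fun h hr => (ht h hr).2⟩⟩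

theorem existing_update (hx : C x = 0) (hr : r ≠ 0) :
    existing (Function.update C x r) = insert r (existing C) := by
  ext c
  rw [Finset.mem_insert, mem_existing, mem_existing]
  constructor
  · rintro ⟨hc, h, rfl⟩
    by_cases hh : h = x
    · exact .inl (by rw [hh, Function.update_self])
    · exact .inr ⟨hc, h, (Function.update_of_ne hh _ _).symm⟩
  · rintro (rfl | ⟨hc, h, rfl⟩)
    · exact ⟨hr, x, Function.update_self ..⟩
    · exact ⟨hc, h, Function.update_of_ne (fun hh => hc (by rw [hh, hx])) _ _⟩

/-- The number of coloured links. -/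
def coloredCount (C : Coloring N) : ℕ := (Finset.univ.filter fun h => C h ≠ 0).card

theorem coloredCount_update (hx : C x = 0) (hr : r ≠ 0) :
    coloredCount (Function.update C x r) = coloredCount C + 1 := by
  classical
  have : (Finset.univ.filter fun h => Function.update C x r h ≠ 0) =
      insert x (Finset.univ.filter fun h => C h ≠ 0) := by
    ext h
    by_cases hh : h = x
    · subst hh; simp [hr]
    · simp [hh]
  rw [coloredCount, this, Finset.card_insert_of_notMem (by simp [hx]), coloredCount]

theorem coloredCount_le (off : ∀ h ∉ Φ.commEdges, C h = 0) :
    coloredCount C ≤ Φ.commEdges.card :=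
  Finset.card_le_card fun h hh => by
    by_contra hn
    exact (Finset.mem_filter.1 hh).2 (off h hn)

theorem card_existing_le (C : Coloring N) : (existing C).card ≤ coloredCount C :=
  Finset.card_image_le

theorem interference_update_self (hx : C x = 0) (hr : r ≠ 0) :
    interference Φ (Function.update C x r) x = load Φ C x r := by
  classical
  rw [interference, load]
  congr 1
  ext g
  by_cases hg : g = x
  · subst hg; simp [hx, hr.symm]
  · simp [hg]

theorem interference_update_of_eq {h : Link N} (hx : C x = 0) (hr : r ≠ 0) (hh : C h = r) :
    interference Φ (Function.update C x r) h = interference Φ C h + Φ.power x.1 h.2 := by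
  classical
  have hne : x ≠ h := fun hxh => hr (by rw [← hh, ← hxh, hx])
  have : (Finset.univ.filter fun g => Function.update C x r g = r) =
      insert x (Finset.univ.filter fun g => C g = r) := by
    ext g
    by_cases hg : g = x
    · subst hg; simp
    · simp [hg]
  rw [interference, Function.update_of_ne hne.symm, hh, this, Finset.erase_insert_of_ne hne,
    Finset.sum_insert (by simp [hx, hr.symm]), add_comm, interference, hh]

theorem interference_update_of_ne {h : Link N} (hx : C x = 0) (hne : h ≠ x) (h0 : C h ≠ 0)
    (hr : C h ≠ r) : interference Φ (Function.update C x r) h = interference Φ C h := by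
  classical
  rw [interference, Function.update_of_ne hne, interference]
  congr 2
  ext g
  by_cases hg : g = x
  · subst hg; simp [hx, h0.symm, hr.symm]
  · simp [hg]

theorem sum_edges_eq_load {ed : Fin Φ.commEdges.card ≃ Φ.commEdges}
    (off : ∀ h ∉ Φ.commEdges, C h = 0) (hr : r ≠ 0) (x : Link N) :
    (∑ i, if C (ed i) = r then Φ.power (ed i).1.1 x.2 else 0) = load Φ C x r := by
  classical
  rw [Equiv.sum_comp ed (fun g => if C g = r then Φ.power g.1.1 x.2 else 0),
    Finset.sum_coe_sort Φ.commEdges (fun g => if C g = r then Φ.power g.1 x.2 else 0),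
    ← Finset.sum_filter, load]
  congr 1
  ext g
  simp only [Finset.mem_filter, Finset.mem_univ, true_and, and_iff_right_iff_imp]
  exact fun hg => not_not.1 fun hn => hr (hg ▸ off g hn)

end Colorings

/-! ### The program: colouring one link -/

section ColorLink

-- The locations of natural numbers and those of real numbers are numbered independently.
abbrev nodesReg : ℕ := 0
abbrev edgesReg : ℕ := 1
abbrev coloredReg : ℕ := 2
abbrev colorsReg : ℕ := 3
abbrev idxReg : ℕ := 4
abbrev txReg : ℕ := 10
abbrev rxReg : ℕ := 11
abbrev newColorReg : ℕ := 12

abbrev srcArr : ℕ := 0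
abbrev dstArr : ℕ := 1
abbrev labelArr : ℕ := 2
abbrev colorArr : ℕ := 3
abbrev blockedArr : ℕ := 10

abbrev powerReg : ℕ := 0
abbrev thresholdReg : ℕ := 1
abbrev lossReg : ℕ := 3
abbrev noiseReg : ℕ := 4

abbrev xArr : ℕ := 0
abbrev yArr : ℕ := 1
abbrev interferenceArr : ℕ := 2
abbrev loadArr : ℕ := 3

/-- The entry of an array at the loop index. -/
abbrev entry (a : ℕ) : NExp := .get a (.reg idxReg)

/-- Equality of two natural numbers. -/
def eqTest (x y : NExp) : Test := .and (.nle x y) (.nle y x)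

/-- The power received at the node `r` from the node `t`. -/
def powerExp (t r : NExp) : RExp :=
  .div (.reg powerReg) (.pow (.pow (.add
    (.mul (.sub (.get xArr t) (.get xArr r)) (.sub (.get xArr t) (.get xArr r)))
    (.mul (.sub (.get yArr t) (.get yArr r)) (.sub (.get yArr t) (.get yArr r))))
    (.div (.const 1) (.const 2))) (.reg lossReg))

def clearBody : Cmd :=
  .seq (.nput blockedArr (.reg idxReg) (.const 0)) (.rput loadArr (.reg idxReg) (.const 0))

def clearLoop : Cmd := forN idxReg (.add (.reg edgesReg) (.const 1)) clearBody

def loadBody : Cmd :=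
  .rput loadArr (entry colorArr)
    (.add (.get loadArr (entry colorArr)) (powerExp (entry srcArr) (.reg rxReg)))

/-- Accumulate, for each colour, the interference at the receiver of the new link. -/
def loadLoop : Cmd := forN idxReg (.reg edgesReg) loadBody

/-- The link at the loop index tolerates the new link. -/
def tolerateTest : Test :=
  .and (.not (eqTest (.reg txReg) (entry srcArr)))
    (.and (.not (eqTest (.reg txReg) (entry dstArr)))
      (.and (.not (eqTest (.reg rxReg) (entry srcArr)))
        (.and (.not (eqTest (.reg rxReg) (entry dstArr)))
          (.rle (.reg thresholdReg) (.div (powerExp (entry srcArr) (entry dstArr))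
            (.add (.reg noiseReg) (.add (.get interferenceArr (.reg idxReg))
              (powerExp (.reg txReg) (entry dstArr)))))))))

def blockBody : Cmd := .ite tolerateTest .skip (.nput blockedArr (entry colorArr) (.const 1))

/-- Block the colours of the links that do not tolerate the new link. -/
def blockLoop : Cmd := forN idxReg (.reg edgesReg) blockBody

def admissibleTest (r : NExp) : Test :=
  .and (.nle (.get blockedArr r) (.const 0))
    (.rle (.reg thresholdReg) (.div (powerExp (.reg txReg) (.reg rxReg))
      (.add (.reg noiseReg) (.get loadArr r))))

def findBody : Cmd :=
  .ite (admissibleTest (.sub (.reg colorsReg) (.reg idxReg)))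
    (.nset newColorReg (.sub (.reg colorsReg) (.reg idxReg))) .skip

/-- Try the existing colours in decreasing order; the last success is the smallest colour. -/
def findLoop : Cmd :=
  .seq (.nset newColorReg (.add (.reg colorsReg) (.const 1)))
    (forN idxReg (.reg colorsReg) findBody)

/-- Find the first conflict free colour. -/
def chooseCmd : Cmd := .seq clearLoop (.seq loadLoop (.seq blockLoop findLoop))

def isNewLinkTest : Test :=
  .and (eqTest (.reg txReg) (entry srcArr)) (eqTest (.reg rxReg) (entry dstArr))

def interferenceBody : Cmd :=
  .ite isNewLinkTest
    (.rput interferenceArr (.reg idxReg) (.get loadArr (.reg newColorReg)))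
    (.ite (eqTest (entry colorArr) (.reg newColorReg))
      (.rput interferenceArr (.reg idxReg)
        (.add (.get interferenceArr (.reg idxReg)) (powerExp (.reg txReg) (entry dstArr))))
      .skip)

def interferenceLoop : Cmd := forN idxReg (.reg edgesReg) interferenceBody

def assignBody : Cmd :=
  .ite isNewLinkTest (.nput colorArr (.reg idxReg) (.reg newColorReg)) .skip

def assignLoop : Cmd := forN idxReg (.reg edgesReg) assignBody

/-- Update the numbers of colours and of coloured links. -/
def countCmd : Cmd :=
  .seq (.ite (.nle (.reg newColorReg) (.reg colorsReg)) .skip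
      (.nset colorsReg (.reg newColorReg)))
    (.nset coloredReg (.add (.reg coloredReg) (.const 1)))

/-- Give the new link the chosen colour. -/
def recordCmd : Cmd := .seq interferenceLoop (.seq assignLoop countCmd)

/-- Colour the link given by the registers `txReg` and `rxReg`. -/
def colorCmd : Cmd := .seq chooseCmd recordCmd

/-- The program changes none of the locations `ls`. -/
abbrev Cmd.Preserves (p : Cmd) (ls : List Loc) : Prop := ∀ l ∈ ls, l ∉ p.writes

/-- The locations of the input. -/
def inputLocs : List Loc :=
  [.nreg nodesReg, .nreg edgesReg, .rreg powerReg, .rreg thresholdReg, .rreg lossReg,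
    .rreg noiseReg, .narr srcArr, .narr dstArr, .rarr xArr, .rarr yArr]

def linkLocs : List Loc := [.nreg txReg, .nreg rxReg]

variable {N : ℕ} {Φ : Network N} {ed : Fin Φ.commEdges.card ≃ Φ.commEdges} {s s' : State} {ω : Tape}
  {p : Cmd} {x : Link N}

/-- The input is in its place. -/
structure Env (Φ : Network N) (ed : Fin Φ.commEdges.card ≃ Φ.commEdges) (s : State) : Prop where
  nodes : s.nreg nodesReg = N
  edges : s.nreg edgesReg = Φ.commEdges.card
  power : s.rreg powerReg = Φ.P
  threshold : s.rreg thresholdReg = Φ.γc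
  loss : s.rreg lossReg = Φ.α
  noise : s.rreg noiseReg = Φ.N₀
  src : ∀ i : Fin Φ.commEdges.card, s.narr srcArr i = (ed i).1.1
  dst : ∀ i : Fin Φ.commEdges.card, s.narr dstArr i = (ed i).1.2
  xpos : ∀ u : Fin N, s.rarr xArr u = Φ.pos u 0
  ypos : ∀ u : Fin N, s.rarr yArr u = Φ.pos u 1

/-- The registers `txReg` and `rxReg` hold the link `x`. -/
structure HoldsLink (s : State) (x : Link N) : Prop where
  tx : s.nreg txReg = x.1
  rx : s.nreg rxReg = x.2

theorem Env.frame (h : Env Φ ed s) (frame : Frame p s s')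
    (hp : p.Preserves inputLocs := by decide) : Env Φ ed s' := by
  have agree : ∀ l ∈ inputLocs, s.AgreeAt s' l := fun l hl => frame l (hp l hl)
  simp only [inputLocs, List.forall_mem_cons, State.AgreeAt] at agree
  obtain ⟨nodes, edges, power, threshold, loss, noise, src, dst, xpos, ypos, -⟩ := agree
  exact ⟨nodes ▸ h.nodes, edges ▸ h.edges, power ▸ h.power, threshold ▸ h.threshold,
    loss ▸ h.loss, noise ▸ h.noise, src ▸ h.src, dst ▸ h.dst, xpos ▸ h.xpos, ypos ▸ h.ypos⟩

theorem HoldsLink.frame (h : HoldsLink s x) (frame : Frame p s s')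
    (hp : p.Preserves linkLocs := by decide) : HoldsLink s' x :=
  ⟨(frame.nreg (hp _ (by decide))).trans h.tx, (frame.nreg (hp _ (by decide))).trans h.rx⟩

theorem eval_eqTest (x y : NExp) : (eqTest x y).eval s ↔ x.eval s = y.eval s := le_antisymm_iff.symm

theorem Env.eval_powerExp (h : Env Φ ed s) {t r : NExp} {u w : Fin N} (ht : t.eval s = u)
    (hr : r.eval s = w) : (powerExp t r).eval s = Φ.power u w := by
  simp only [powerExp, RExp.eval, ht, hr, h.xpos, h.ypos, h.power, h.loss, Network.power,
    EuclideanSpace.dist_eq, Real.sqrt_eq_rpow, Fin.sum_univ_two, Real.dist_eq, sq_abs]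
  norm_num [sq]

theorem Env.eval_tolerateTest (h : Env Φ ed s) (hx : HoldsLink s x) (i : Fin Φ.commEdges.card)
    (hi : s.nreg idxReg = i) :
    tolerateTest.eval s ↔ Tolerates Φ x (ed i) (s.rarr interferenceArr i) := by
  have src : (entry srcArr).eval s = (ed i).1.1 := by simp only [NExp.eval, hi, h.src]
  have dst : (entry dstArr).eval s = (ed i).1.2 := by simp only [NExp.eval, hi, h.dst]
  simp only [tolerateTest, Test.eval, eval_eqTest, RExp.eval, h.eval_powerExp src dst,
    h.eval_powerExp (t := .reg txReg) hx.tx dst, NExp.eval, hi, h.src, h.dst, hx.tx, hx.rx,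
    h.threshold, h.noise, Tolerates, PrimaryConflict, Fin.val_inj, not_or, and_assoc]

theorem Env.eval_isNewLinkTest (h : Env Φ ed s) (hx : HoldsLink s x) (i : Fin Φ.commEdges.card)
    (hi : s.nreg idxReg = i) : isNewLinkTest.eval s ↔ (ed i).1 = x := by
  simp only [isNewLinkTest, Test.eval, eval_eqTest, NExp.eval, hi, h.src, h.dst, hx.tx, hx.rx,
    Fin.val_inj, Prod.ext_iff, eq_comm (a := x.1), eq_comm (a := x.2)]

theorem Env.eval_admissibleTest (h : Env Φ ed s) (hx : HoldsLink s x) (r : NExp) :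
    (admissibleTest r).eval s ↔ s.narr blockedArr (r.eval s) = 0 ∧
      Φ.γc ≤ Φ.power x.1 x.2 / (Φ.N₀ + s.rarr loadArr (r.eval s)) := by
  simp only [admissibleTest, Test.eval, NExp.eval, RExp.eval, h.threshold, h.noise, Nat.le_zero,
    h.eval_powerExp (t := .reg txReg) (r := .reg rxReg) hx.tx hx.rx]

theorem clearLoop_spec (h : Env Φ ed s) : Runs ω clearLoop s fun t s' =>
    (∀ c ≤ Φ.commEdges.card, s'.narr blockedArr c = 0 ∧ s'.rarr loadArr c = 0) ∧
      t ≤ 20 * (Φ.commEdges.card + 2) := by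
  refine Runs.mono (Runs.forN_entrywise (Φ.commEdges.card + 1) 20
    (fun s c => (s.narr blockedArr c, s.rarr loadArr c)) (fun _ y => y.1 = 0 ∧ y.2 = 0)
    (fun s' frame => congrArg (· + 1) (frame.nreg.trans h.edges)) ?_)
    fun t s' _ ⟨zero, time⟩ => ⟨fun c hc => zero c (Nat.lt_succ_of_le hc), time⟩
  intro j _ s' _ hreg _
  simp only [clearBody, Cmd.run, NExp.eval, RExp.eval, hreg, Function.update_self, Nat.cast_zero,
    and_self, true_and]
  intro l hl
  rw [Function.update_of_ne hl, Function.update_of_ne hl]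

theorem sum_filter_val_lt_succ {n j : ℕ} {M : Type*} [AddCommMonoid M] (f : Fin n → M)
    (hj : j < n) : ∑ i with i.val < j + 1, f i = ∑ i with i.val < j, f i + f ⟨j, hj⟩ := by
  have : (Finset.univ.filter fun i : Fin n => i.val < j + 1) =
      insert ⟨j, hj⟩ (Finset.univ.filter fun i : Fin n => i.val < j) := by
    ext i
    simp only [Finset.mem_filter, Finset.mem_univ, true_and, Finset.mem_insert, Fin.ext_iff]
    omega
  rw [this, Finset.sum_insert (by simp), add_comm]

theorem forall_val_lt_succ {n j : ℕ} {P : Fin n → Prop} (hj : j < n) :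
    (∀ i : Fin n, i.val < j + 1 → P i) ↔ (∀ i : Fin n, i.val < j → P i) ∧ P ⟨j, hj⟩ := by
  refine ⟨fun h => ⟨fun i hi => h i (by omega), h ⟨j, hj⟩ (Nat.lt_succ_self j)⟩, ?_⟩
  rintro ⟨h, hlast⟩ i hi
  rcases Nat.lt_succ_iff_lt_or_eq.1 hi with hlt | heq
  · exact h i hlt
  · rwa [show i = ⟨j, hj⟩ from Fin.ext heq]

theorem loadLoop_spec (h : Env Φ ed s) (hx : HoldsLink s x) : Runs ω loadLoop s fun t s' =>
    (∀ c, s'.rarr loadArr c = s.rarr loadArr c +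
      ∑ i : Fin Φ.commEdges.card, if s.narr colorArr i = c then Φ.power (ed i).1.1 x.2 else 0) ∧
      t ≤ 80 * (Φ.commEdges.card + 1) := by
  refine Runs.mono (Runs.forN_loopFree Φ.commEdges.card 80 (fun j s' => ∀ c, s'.rarr loadArr c =
    s.rarr loadArr c + ∑ i : Fin Φ.commEdges.card with i.val < j,
      if s.narr colorArr i = c then Φ.power (ed i).1.1 x.2 else 0)
    (fun s' frame => frame.nreg.trans h.edges) (by simp) ?_)
    fun t s' _ ⟨sum, time⟩ => ⟨by simpa using sum, time⟩
  intro j hj s' frame hreg hI c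
  have power : (powerExp (entry srcArr) (.reg rxReg)).eval s' = Φ.power (ed ⟨j, hj⟩).1.1 x.2 :=
    (h.frame frame).eval_powerExp
      (by simp only [NExp.eval, hreg, (h.frame frame).src ⟨j, hj⟩]) (hx.frame frame).rx
  have color : s'.narr colorArr = s.narr colorArr := frame.narr
  rw [sum_filter_val_lt_succ _ hj, ← add_assoc, ← hI]
  simp only [loadBody, Cmd.run, NExp.eval, RExp.eval, hreg, color, power, Function.update_self]
  split_ifs with hc
  · rw [hc, Function.update_self]
  · rw [Function.update_of_ne (Ne.symm hc), add_zero]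

theorem blockLoop_spec (h : Env Φ ed s) (hx : HoldsLink s x) : Runs ω blockLoop s fun t s' =>
    (∀ c, s'.narr blockedArr c = 0 ↔ s.narr blockedArr c = 0 ∧
      ∀ i : Fin Φ.commEdges.card, s.narr colorArr i = c →
        Tolerates Φ x (ed i) (s.rarr interferenceArr i)) ∧
      t ≤ 200 * (Φ.commEdges.card + 1) := by
  refine Runs.mono (Runs.forN_loopFree Φ.commEdges.card 200 (fun j s' => ∀ c,
    s'.narr blockedArr c = 0 ↔ s.narr blockedArr c = 0 ∧ ∀ i : Fin Φ.commEdges.card, i.val < j →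
      s.narr colorArr i = c → Tolerates Φ x (ed i) (s.rarr interferenceArr i))
    (fun s' frame => frame.nreg.trans h.edges) (by simp) ?_)
    fun t s' _ ⟨blocked, time⟩ => ⟨by simpa using blocked, time⟩
  intro j hj s' frame hreg hI c
  have test := (h.frame frame).eval_tolerateTest (hx.frame frame) ⟨j, hj⟩ hreg
  have color : s'.narr colorArr = s.narr colorArr := frame.narr
  rw [frame.rarr (i := interferenceArr)] at test
  rw [forall_val_lt_succ hj, ← and_assoc, ← hI, ← test]
  simp only [blockBody, Cmd.run]
  split_ifs with hb
  · simp only [hb, implies_true, and_true]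
  · simp only [NExp.eval, hreg, color, hb]
    by_cases hc : s.narr colorArr j = c
    · simp [hc]
    · simp [hc, Function.update_of_ne (Ne.symm hc)]

theorem findLoop_spec (h : Env Φ ed s) (hx : HoldsLink s x) : Runs ω findLoop s fun t s' =>
    IsLeast {r | r = s.nreg colorsReg + 1 ∨ 1 ≤ r ∧ r ≤ s.nreg colorsReg ∧
      s.narr blockedArr r = 0 ∧ Φ.γc ≤ Φ.power x.1 x.2 / (Φ.N₀ + s.rarr loadArr r)}
      (s'.nreg newColorReg) ∧ t ≤ 80 * (s.nreg colorsReg + 1) + 4 := by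
  have exec := Exec.nset (ω := ω) newColorReg (.add (.reg colorsReg) (.const 1)) s
  set K := s.nreg colorsReg
  set s₀ := s.setN newColorReg (K + 1)
  have frame₀ : Frame findLoop s s₀ := exec.frame.mono (List.subset_append_left _ _)
  refine Runs.seq ⟨_, s₀, exec, Runs.mono (Runs.forN_loopFree K 80 (fun j s' => IsLeast
    {r | r = K + 1 ∨ K < r + j ∧ r ≤ K ∧ s.narr blockedArr r = 0 ∧
      Φ.γc ≤ Φ.power x.1 x.2 / (Φ.N₀ + s.rarr loadArr r)} (s'.nreg newColorReg))
    (fun s' frame => frame.nreg) ?_ ?_) ?_⟩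
  · rw [show s₀.nreg newColorReg = K + 1 from setN_nreg_self ..]
    exact ⟨.inl rfl, fun r hr => by rcases hr with hr | hr <;> omega⟩
  · intro j hj s' frame hreg hI
    have frame' : Frame findLoop s s' := frame₀.trans (frame.mono (List.subset_append_right _ _))
    have colors : s'.nreg colorsReg = K := frame'.nreg
    have test := (h.frame frame').eval_admissibleTest (hx.frame frame')
      (.sub (.reg colorsReg) (.reg idxReg))
    simp only [NExp.eval, colors, hreg, frame'.narr (i := blockedArr),
      frame'.rarr (i := loadArr)] at test
    simp only [findBody, Cmd.run]
    split_ifs with hb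
    · simp only [NExp.eval, colors, hreg, setN_nreg_self]
      refine ⟨.inr ⟨by omega, by omega, test.1 hb⟩, fun r hr => ?_⟩
      rcases hr with hr | hr <;> omega
    · convert hI using 3 with r
      refine or_congr_right ⟨fun hr => ⟨?_, hr.2⟩, fun hr => ⟨by omega, hr.2⟩⟩
      have : r ≠ K - j := fun hrj => hb (test.2 (hrj ▸ hr.2.2))
      omega
  · rintro t s' - ⟨least, time⟩
    simp only [Nat.lt_add_left_iff_pos] at least
    exact ⟨least, by simp only [NExp.cost]; omega⟩

end ColorLink

section ColorState

variable {N : ℕ} {Φ : Network N} {ed : Fin Φ.commEdges.card ≃ Φ.commEdges} {s s' : State} {ω : Tape}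
  {p : Cmd} {x : Link N} {C : Coloring N}

/-- The memory holds the partial colouring `C`, the number of its links and of its colours, and the
interference at the receiver of each coloured link. -/
structure ColorState (Φ : Network N) (ed : Fin Φ.commEdges.card ≃ Φ.commEdges) (s : State)
    (C : Coloring N) : Prop where
  off : ∀ h ∉ Φ.commEdges, C h = 0
  color : ∀ i : Fin Φ.commEdges.card, s.narr colorArr i = C (ed i)
  colored : s.nreg coloredReg = coloredCount C
  existing_eq : existing C = Finset.Icc 1 (s.nreg colorsReg)
  interference : ∀ i : Fin Φ.commEdges.card, C (ed i) ≠ 0 →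
    s.rarr interferenceArr i = interference Φ C (ed i)

def colorLocs : List Loc :=
  [.nreg coloredReg, .nreg colorsReg, .narr colorArr, .rarr interferenceArr]

theorem ColorState.frame (h : ColorState Φ ed s C) (frame : Frame p s s')
    (hp : p.Preserves colorLocs := by decide) : ColorState Φ ed s' C := by
  have agree : ∀ l ∈ colorLocs, s.AgreeAt s' l := fun l hl => frame l (hp l hl)
  simp only [colorLocs, List.forall_mem_cons, State.AgreeAt] at agree
  obtain ⟨colored, colors, color, interf, -⟩ := agree
  exact ⟨h.off, color ▸ h.color, colored ▸ h.colored, colors ▸ h.existing_eq,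
    interf ▸ h.interference⟩

theorem ColorState.exists_index (h : ColorState Φ ed s C) {g : Link N} (hg : C g ≠ 0) :
    ∃ i, (ed i).1 = g :=
  ⟨ed.symm ⟨g, not_not.1 fun hn => hg (h.off g hn)⟩, by simp⟩

theorem ColorState.colors_lt (h : ColorState Φ ed s C) (hx : x ∈ Φ.commEdges) (hx0 : C x = 0) :
    s.nreg colorsReg < Φ.commEdges.card := by
  have off : ∀ g ∉ Φ.commEdges, Function.update C x 1 g = 0 := fun g hg => by
    rw [Function.update_of_ne (fun hgx => hg (by rwa [hgx])), h.off g hg]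
  have count := coloredCount_le off
  have colors := card_existing_le C
  rw [coloredCount_update hx0 one_ne_zero] at count
  rw [h.existing_eq, Nat.card_Icc] at colors
  omega

theorem forall_index_tolerates_iff (h : ColorState Φ ed s C) {r : ℕ} (hr : r ≠ 0) :
    (∀ i : Fin Φ.commEdges.card, s.narr colorArr i = r →
      Tolerates Φ x (ed i) (s.rarr interferenceArr i)) ↔
        ∀ g, C g = r → Tolerates Φ x g (interference Φ C g) := by
  refine ⟨fun tolerates g hg => ?_, fun tolerates i hi => ?_⟩
  · obtain ⟨i, rfl⟩ := h.exists_index (hg ▸ hr)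
    rw [← h.interference i (hg ▸ hr)]
    exact tolerates i ((h.color i).trans hg)
  · rw [h.color i] at hi
    rw [h.interference i (hi ▸ hr)]
    exact tolerates _ hi

theorem chooseCmd_spec (hE : Env Φ ed s) (hC : ColorState Φ ed s C) (hL : HoldsLink s x)
    (hx : x ∈ Φ.commEdges) (hx0 : C x = 0) : Runs ω chooseCmd s fun t s' =>
      s'.nreg newColorReg = firstConflictFreeColor Φ C x ∧
      s'.rarr loadArr (s'.nreg newColorReg) = load Φ C x (s'.nreg newColorReg) ∧
      t ≤ 400 * (Φ.commEdges.card + 1) := by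
  have colors_lt := hC.colors_lt hx hx0
  refine Runs.seq ((clearLoop_spec hE).mono ?_)
  rintro t₁ s₁ frame₁ ⟨clear, time₁⟩
  refine Runs.seq ((loadLoop_spec (hE.frame frame₁) (hL.frame frame₁)).mono ?_)
  rintro t₂ s₂ frame₂ ⟨sum, time₂⟩
  have hE₂ := (hE.frame frame₁).frame frame₂
  have hL₂ := (hL.frame frame₁).frame frame₂
  have hC₂ := (hC.frame frame₁).frame frame₂
  refine Runs.seq ((blockLoop_spec hE₂ hL₂).mono ?_)
  rintro t₃ s₃ frame₃ ⟨blocked, time₃⟩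
  refine (findLoop_spec (hE₂.frame frame₃) (hL₂.frame frame₃)).mono ?_
  rintro t₄ s₄ frame₄ ⟨least, time₄⟩
  have colors : s₃.nreg colorsReg = s.nreg colorsReg :=
    frame₃.nreg.trans (frame₂.nreg.trans frame₁.nreg)
  have load_eq : ∀ r, 1 ≤ r → r ≤ s.nreg colorsReg + 1 → s₃.rarr loadArr r = load Φ C x r := by
    intro r hr hrK
    rw [frame₃.rarr, sum, (clear r (by omega)).2, zero_add,
      ← sum_edges_eq_load (ed := ed) hC.off (by omega)]
    simp only [(hC.frame frame₁).color]
  have admissible_iff : ∀ r, 1 ≤ r → r ≤ s.nreg colorsReg →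
      (s₃.narr blockedArr r = 0 ∧
        Φ.γc ≤ Φ.power x.1 x.2 / (Φ.N₀ + s₃.rarr loadArr r) ↔ IsAdmissible Φ C x r) := by
    intro r hr hrK
    have hr0 : r ≠ 0 := by omega
    rw [blocked, frame₂.narr, (clear r (by omega)).1, load_eq r hr (by omega),
      isAdmissible_iff hx0 hr0, eq_self, true_and, forall_index_tolerates_iff hC₂ hr0]
  rw [colors] at least time₄
  have new_eq : s₄.nreg newColorReg = firstConflictFreeColor Φ C x := by
    refine least.unique ?_
    rw [Set.ext fun r => or_congr_right (and_congr_right fun hr => and_congr_right fun hrK =>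
      admissible_iff r hr hrK)]
    exact isLeast_firstConflictFreeColor hC.existing_eq
  refine ⟨new_eq, ?_, by omega⟩
  rw [frame₄.rarr]
  rcases least.1 with hr | ⟨hr, hrK, -⟩
  · exact load_eq _ (by omega) hr.le
  · exact load_eq _ hr (by omega)

theorem interferenceLoop_spec (hE : Env Φ ed s) (hC : ColorState Φ ed s C) (hL : HoldsLink s x)
    (hx0 : C x = 0) (hr : s.nreg newColorReg ≠ 0)
    (hload : s.rarr loadArr (s.nreg newColorReg) = load Φ C x (s.nreg newColorReg)) :
    Runs ω interferenceLoop s fun t s' => (∀ i : Fin Φ.commEdges.card,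
      Function.update C x (s.nreg newColorReg) (ed i) ≠ 0 → s'.rarr interferenceArr i =
        interference Φ (Function.update C x (s.nreg newColorReg)) (ed i)) ∧
      t ≤ 100 * (Φ.commEdges.card + 1) := by
  set r := s.nreg newColorReg
  refine Runs.mono (Runs.forN_entrywise Φ.commEdges.card 100 (fun s => s.rarr interferenceArr)
    (fun j y => ∀ i : Fin Φ.commEdges.card, i = j → Function.update C x r (ed i) ≠ 0 →
      y = interference Φ (Function.update C x r) (ed i))
    (fun s' frame => frame.nreg.trans hE.edges) ?_)
    fun t s' _ ⟨interf, time⟩ => ⟨fun i => interf i i.2 i rfl, time⟩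
  intro j hj s' frame hreg hold
  have new : s'.nreg newColorReg = r := frame.nreg
  have isNew := (hE.frame frame).eval_isNewLinkTest (hL.frame frame) ⟨j, hj⟩ hreg
  have power := (hE.frame frame).eval_powerExp (t := .reg txReg) (r := entry dstArr)
    (w := (ed ⟨j, hj⟩).1.2) (hL.frame frame).tx
    (by simp only [NExp.eval, hreg, (hE.frame frame).dst ⟨j, hj⟩])
  have color : s'.narr colorArr j = C (ed ⟨j, hj⟩) :=
    (congrFun frame.narr j).trans (hC.color ⟨j, hj⟩)
  simp only [interferenceBody, Cmd.run]
  split_ifs with hnew hcolor <;>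
    refine ⟨?_, fun l hl => by simp [NExp.eval, hreg, hl]⟩ <;> rintro i rfl h0
  · simp only [NExp.eval, RExp.eval, hreg, Function.update_self, new, isNew.1 hnew,
      frame.rarr (i := loadArr), hload, interference_update_self hx0 hr]
  · simp only [eval_eqTest, NExp.eval, hreg, color, new] at hcolor
    have h0 : C (ed i) ≠ 0 := hcolor ▸ hr
    simp only [NExp.eval, RExp.eval, hreg, power, Function.update_self, hold,
      interference_update_of_eq hx0 hr hcolor, hC.interference i h0]
  · simp only [eval_eqTest, NExp.eval, hreg, color, new] at hcolor
    have hne : (ed i).1 ≠ x := fun h => hnew (isNew.2 h)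
    rw [Function.update_of_ne hne] at h0
    rw [hold, hC.interference i h0, interference_update_of_ne hx0 hne h0 hcolor]

theorem assignLoop_spec (hE : Env Φ ed s) (hL : HoldsLink s x)
    (color : ∀ i : Fin Φ.commEdges.card, s.narr colorArr i = C (ed i)) :
    Runs ω assignLoop s fun t s' => (∀ i : Fin Φ.commEdges.card,
      s'.narr colorArr i = Function.update C x (s.nreg newColorReg) (ed i)) ∧
      t ≤ 40 * (Φ.commEdges.card + 1) := by
  refine Runs.mono (Runs.forN_entrywise Φ.commEdges.card 40 (fun s => s.narr colorArr)
    (fun j y => ∀ i : Fin Φ.commEdges.card, i = j →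
      y = Function.update C x (s.nreg newColorReg) (ed i))
    (fun s' frame => frame.nreg.trans hE.edges) ?_)
    fun t s' _ ⟨color, time⟩ => ⟨fun i => color i i.2 i rfl, time⟩
  intro j hj s' frame hreg hold
  have isNew := (hE.frame frame).eval_isNewLinkTest (hL.frame frame) ⟨j, hj⟩ hreg
  simp only [assignBody, Cmd.run]
  split_ifs with hnew <;>
    refine ⟨?_, fun l hl => by simp [NExp.eval, hreg, hl]⟩ <;> rintro i rfl
  · simp only [NExp.eval, hreg, Function.update_self, isNew.1 hnew, frame.nreg (i := newColorReg)]
  · rw [Function.update_of_ne fun h => hnew (isNew.2 h), hold, color]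

theorem nreg_countCmd_run (ω : Tape) (s : State) :
    (countCmd.run ω s).nreg colorsReg = max (s.nreg colorsReg) (s.nreg newColorReg) ∧
      (countCmd.run ω s).nreg coloredReg = s.nreg coloredReg + 1 := by
  by_cases h : s.nreg newColorReg ≤ s.nreg colorsReg
  · simp [countCmd, Cmd.run, Test.eval, NExp.eval, State.setN, h]
  · simp [countCmd, Cmd.run, Test.eval, NExp.eval, State.setN, h, (not_le.1 h).le]

theorem recordCmd_spec (hE : Env Φ ed s) (hC : ColorState Φ ed s C) (hL : HoldsLink s x)
    (hx : x ∈ Φ.commEdges) (hx0 : C x = 0) (hr : s.nreg newColorReg ≠ 0)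
    (hrK : s.nreg newColorReg ≤ s.nreg colorsReg + 1)
    (hload : s.rarr loadArr (s.nreg newColorReg) = load Φ C x (s.nreg newColorReg)) :
    Runs ω recordCmd s fun t s' =>
      ColorState Φ ed s' (Function.update C x (s.nreg newColorReg)) ∧
      t ≤ 200 * (Φ.commEdges.card + 1) := by
  refine Runs.seq ((interferenceLoop_spec hE hC hL hx0 hr hload).mono ?_)
  rintro t₁ s₁ frame₁ ⟨interf, time₁⟩
  refine Runs.seq ((assignLoop_spec (hE.frame frame₁) (hL.frame frame₁) (C := C)
    (frame₁.narr (i := colorArr) ▸ hC.color)).mono ?_)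
  rintro t₂ s₂ frame₂ ⟨color, time₂⟩
  have new : s₂.nreg newColorReg = s.nreg newColorReg := frame₂.nreg.trans frame₁.nreg
  have colors : s₂.nreg colorsReg = s.nreg colorsReg := frame₂.nreg.trans frame₁.nreg
  have colored : s₂.nreg coloredReg = s.nreg coloredReg := frame₂.nreg.trans frame₁.nreg
  rw [frame₁.nreg (i := newColorReg)] at color
  refine Runs.of_loopFree fun t₃ time₃ frame₃ => ⟨⟨fun g hg => ?_, fun i => ?_, ?_, ?_, ?_⟩, ?_⟩
  · rw [Function.update_of_ne (fun hgx => hg (by rwa [hgx])), hC.off g hg]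
  · rw [frame₃.narr, color]
  · rw [(nreg_countCmd_run ω s₂).2, colored, coloredCount_update hx0 hr, hC.colored]
  · rw [(nreg_countCmd_run ω s₂).1, colors, new, existing_update hx0 hr, hC.existing_eq]
    ext r
    simp only [Finset.mem_insert, Finset.mem_Icc]
    omega
  · rw [frame₃.rarr, frame₂.rarr]
    exact interf
  · have : countCmd.maxCost ≤ 20 := by decide
    omega

theorem colorCmd_spec (hE : Env Φ ed s) (hC : ColorState Φ ed s C) (hL : HoldsLink s x)
    (hx : x ∈ Φ.commEdges) (hx0 : C x = 0) : Runs ω colorCmd s fun t s' =>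
      ColorState Φ ed s' (Function.update C x (firstConflictFreeColor Φ C x)) ∧
      t ≤ 600 * (Φ.commEdges.card + 1) := by
  refine Runs.seq ((chooseCmd_spec hE hC hL hx hx0).mono ?_)
  rintro t s₁ frame₁ ⟨new, hload, time⟩
  refine (recordCmd_spec (hE.frame frame₁) (hC.frame frame₁) (hL.frame frame₁) hx hx0 ?_ ?_
    hload).mono ?_
  · exact new ▸ firstConflictFreeColor_ne_zero Φ C x
  · rw [new, frame₁.nreg]
    rcases (isLeast_firstConflictFreeColor (Φ := Φ) (x := x) hC.existing_eq).1 with h | h <;> omega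
  · rintro t' s' - ⟨hC', time'⟩
    exact ⟨new ▸ hC', by omega⟩

end ColorState

/-! ### The program: colouring the edges of an oriented forest -/

section Pass

abbrev labelReg : ℕ := 8
abbrev vertexReg : ℕ := 9

abbrev vertexArr : ℕ := 4
abbrev parentArr : ℕ := 7

def parentExp : NExp := .sub (.get parentArr (.reg vertexReg)) (.const 1)

/-- Move the edge between the current vertex and its parent, directed into the vertex if `out`
holds and out of it otherwise, to the registers `txReg` and `rxReg`. -/
def selectLink (out : Bool) : Cmd :=
  .seq (.nset txReg (if out then parentExp else .reg vertexReg))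
    (.nset rxReg (if out then .reg vertexReg else parentExp))

def passBody (out : Bool) : Cmd :=
  .seq (.nset vertexReg (.get vertexArr (.add (.reg labelReg) (.const 1))))
    (.ite (.nle (.const 1) (.get parentArr (.reg vertexReg))) (.seq (selectLink out) colorCmd)
      .skip)

/-- Colour the edges of an out-oriented or in-oriented forest in the order of the labels. -/
def passLoop (out : Bool) : Cmd := forN labelReg (.reg nodesReg) (passBody out)

variable {N : ℕ} {Φ : Network N} {ed : Fin Φ.commEdges.card ≃ Φ.commEdges} {s s' : State}
  {ω : Tape} {C : Coloring N} {L : Equiv.Perm (Fin N)} {parent : Fin N → Option (Fin N)}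
  {out : Bool} {u p : Fin N} {x : Link N}

/-- The array `vertexArr` holds the vertices in the order of their labels. -/
def HasInverse (s : State) (L : Equiv.Perm (Fin N)) : Prop :=
  ∀ j : Fin N, s.narr vertexArr (j + 1) = (L.symm j : ℕ)

/-- The array `parentArr` holds the parents, shifted by one, with `0` for no parent. -/
def HasParents (s : State) (parent : Fin N → Option (Fin N)) : Prop :=
  ∀ u : Fin N, s.narr parentArr u = (parent u).elim 0 fun p => (p : ℕ) + 1

/-- The edge between a vertex and its parent, directed into the vertex if `out` holds and out of it
otherwise. -/
def childEdge (out : Bool) (parent : Fin N → Option (Fin N)) (u : Fin N) : Option (Link N) :=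
  (parent u).map fun p => if out then (p, u) else (u, p)

/-- Give the link, if there is one, its first conflict free colour. -/
def colorOption (Φ : Network N) (C : Coloring N) (y : Option (Link N)) : Coloring N :=
  y.elim C fun x => Function.update C x (firstConflictFreeColor Φ C x)

/-- The edges of an oriented forest in the order of the labels of the children. -/
def passEdges (L : Equiv.Perm (Fin N)) (out : Bool) (parent : Fin N → Option (Fin N)) :
    List (Option (Link N)) :=
  (List.finRange N).map fun j => childEdge out parent (L.symm j)

/-- The time which suffices to colour the links not yet coloured, with some slack for overhead. -/
def colorPotential (e : ℕ) (s : State) : ℕ := (e - s.nreg coloredReg) * (700 * (e + 1))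

theorem childEdge_eq_some : childEdge out parent u = some x ↔
    (if out then x.2 else x.1) = u ∧ parent u = some (if out then x.1 else x.2) := by
  cases out <;> simp only [childEdge, Option.map_eq_some_iff, Prod.ext_iff] <;> aesop

theorem foldl_colorOption_ne_zero (l : List (Option (Link N))) :
    l.foldl (colorOption Φ) C x ≠ 0 ↔ C x ≠ 0 ∨ some x ∈ l := by
  induction l generalizing C with
  | nil => simp
  | cons y l ih =>
    have head : colorOption Φ C y x ≠ 0 ↔ C x ≠ 0 ∨ some x = y := by
      rcases y with _ | y
      · simp [colorOption]
      · by_cases hx : x = y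
        · simp [colorOption, hx, firstConflictFreeColor_ne_zero]
        · simp [colorOption, hx]
    rw [List.foldl_cons, ih, head, List.mem_cons, or_assoc]

theorem some_mem_passEdges : some x ∈ passEdges L out parent ↔
    parent (if out then x.2 else x.1) = some (if out then x.1 else x.2) := by
  simp only [passEdges, List.mem_map, List.mem_finRange, true_and, childEdge_eq_some]
  exact ⟨fun ⟨_, hu, hp⟩ => hu ▸ hp,
    fun hp => ⟨L _, (L.symm_apply_apply _).symm, by simpa using hp⟩⟩

theorem take_succ_passEdges {j : ℕ} (hj : j < N) : (passEdges L out parent).take (j + 1) =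
    (passEdges L out parent).take j ++ [childEdge out parent (L.symm ⟨j, hj⟩)] := by
  rw [List.take_add_one, List.getElem?_eq_getElem (by simpa [passEdges] using hj)]
  simp [passEdges]

theorem some_notMem_take_passEdges {j : ℕ} (hj : j < N)
    (hx : childEdge out parent (L.symm ⟨j, hj⟩) = some x) :
    some x ∉ (passEdges L out parent).take j := by
  simp only [List.mem_take_iff_getElem, passEdges, List.getElem_map, List.getElem_finRange,
    childEdge_eq_some, not_exists] at hx ⊢
  rintro i hi ⟨hu, -⟩
  have := congrArg Fin.val (L.symm.injective (hu.symm.trans hx.1))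
  simp only [Fin.val_cast] at this
  omega

theorem selectLink_spec (hv : s.nreg vertexReg = u) (hp : s.narr parentArr u = p + 1)
    (hx : x = if out then (p, u) else (u, p)) :
    Runs ω (selectLink out) s fun t s' => HoldsLink s' x ∧ t ≤ 20 := by
  cases out <;> refine Runs.of_loopFree fun t time _ => ⟨⟨?_, ?_⟩, time.trans (by decide)⟩ <;>
    simp [selectLink, parentExp, Cmd.run, NExp.eval, State.setN, hv, hp, hx]

theorem passBody_spec (hE : Env Φ ed s) (hC : ColorState Φ ed s C) (hP : HasParents s parent)
    (hu : s.narr vertexArr (s.nreg labelReg + 1) = u)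
    (hx : ∀ x, childEdge out parent u = some x → x ∈ Φ.commEdges ∧ C x = 0) :
    Runs ω (passBody out) s fun t s' =>
      ColorState Φ ed s' (colorOption Φ C (childEdge out parent u)) ∧
        t + colorPotential Φ.commEdges.card s' ≤ colorPotential Φ.commEdges.card s + 20 := by
  have exec := Exec.nset (ω := ω) vertexReg (.get vertexArr (.add (.reg labelReg) (.const 1))) s
  refine Runs.seq ⟨_, _, exec, ?_⟩
  set s₁ : State := { s with nreg := Function.update s.nreg vertexReg _ }
  have vertex : s₁.nreg vertexReg = u := (Function.update_self vertexReg _ s.nreg).trans hu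
  have hparent : s₁.narr parentArr u = (parent u).elim 0 fun p => (p : ℕ) + 1 := hP u
  have hC₁ := hC.frame exec.frame
  have colored : s₁.nreg coloredReg = s.nreg coloredReg := exec.frame.nreg
  rcases hpu : parent u with _ | p <;> rw [hpu] at hparent
  · refine Runs.ite (fun hb => ?_) fun _ => ⟨_, _, .skip s₁, by simpa [colorOption, childEdge, hpu],
      ?_⟩
    · simp [Test.eval, NExp.eval, vertex, hparent] at hb
    · simp only [colorPotential, colored, NExp.cost, Test.cost]
      omega
  · obtain ⟨x, hlink⟩ : ∃ x, x = if out then (p, u) else (u, p) := ⟨_, rfl⟩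
    have edge : childEdge out parent u = some x := by simp [childEdge, hpu, hlink]
    obtain ⟨hx, hx0⟩ := hx x edge
    refine Runs.ite (fun _ => Runs.seq ((selectLink_spec vertex hparent hlink).mono ?_))
      fun hb => ?_
    · rintro t₂ s₂ (frame₂ : Frame (selectLink true) s₁ s₂) ⟨hL, time₂⟩
      refine (colorCmd_spec ((hE.frame exec.frame).frame frame₂) (hC₁.frame frame₂) hL hx
        hx0).mono ?_
      rintro t₃ s₃ - ⟨hC₃, time₃⟩
      have le := coloredCount_le hC₃.off
      have count := coloredCount_update hx0 (firstConflictFreeColor_ne_zero Φ C x)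
      rw [← hC₃.colored] at le
      rw [← hC₃.colored, ← hC.colored] at count
      obtain ⟨d, hd⟩ : ∃ d, Φ.commEdges.card - s.nreg coloredReg = d + 1 :=
        ⟨Φ.commEdges.card - s₃.nreg coloredReg, by omega⟩
      have hd₃ : Φ.commEdges.card - s₃.nreg coloredReg = d := by omega
      rw [edge]
      refine ⟨hC₃, ?_⟩
      simp only [colorPotential, hd, hd₃, add_mul, NExp.cost, Test.cost]
      omega
    · simp [Test.eval, NExp.eval, vertex, hparent] at hb

theorem passLoop_spec (hE : Env Φ ed s) (hC : ColorState Φ ed s C) (hL : HasInverse s L)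
    (hP : HasParents s parent)
    (hx : ∀ u x, childEdge out parent u = some x → x ∈ Φ.commEdges ∧ C x = 0) :
    Runs ω (passLoop out) s fun t s' =>
      ColorState Φ ed s' ((passEdges L out parent).foldl (colorOption Φ) C) ∧
        t + colorPotential Φ.commEdges.card s' ≤
          colorPotential Φ.commEdges.card s + 40 * (N + 1) := by
  refine Runs.mono (Runs.forN N 20 (fun j s' => ColorState Φ ed s'
    (((passEdges L out parent).take j).foldl (colorOption Φ) C)) (colorPotential Φ.commEdges.card)
    (fun s' (frame : Frame (passLoop true) s s') => frame.nreg.trans hE.nodes) (by simpa using hC)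
    ?_ (fun j s' x h => ⟨h.off, h.color, h.colored, h.existing_eq, h.interference⟩)
    (hi := (by decide : Loc.nreg labelReg ∉ (passBody true).writes))) ?_
  · intro j hj s' (frame : Frame (passLoop true) s s') hreg hC'
    have hP' : HasParents s' parent := by rwa [HasParents, frame.narr]
    have vertex : s'.narr vertexArr (s'.nreg labelReg + 1) = L.symm ⟨j, hj⟩ := by
      rw [hreg, frame.narr, hL ⟨j, hj⟩]
    rw [take_succ_passEdges hj, List.foldl_append, List.foldl_cons, List.foldl_nil]
    refine passBody_spec (hE.frame frame) hC' hP' vertex fun x hxu => ⟨(hx _ x hxu).1, ?_⟩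
    by_contra h
    rcases (foldl_colorOption_ne_zero _).1 h with h | h
    · exact h (hx _ x hxu).2
    · exact some_notMem_take_passEdges hj hxu h
  · rintro t s' - ⟨hC', time⟩
    rw [List.take_of_length_le (by simp [passEdges])] at hC'
    refine ⟨hC', time.trans ?_⟩
    simp only [NExp.cost]
    omega

end Pass

section BreadthFirstSearch

variable {V : Type*} {R : SimpleGraph V} {parent : V → Option V}

theorem exists_exit {P : V → Prop} {u w : V} (p : R.Walk u w) (hu : P u) (hw : ¬ P w) :
    ∃ a b, R.Adj a b ∧ P a ∧ ¬ P b ∧ ∃ q : R.Walk u a, q.length + 1 ≤ p.length := by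
  induction p with
  | nil => exact (hw hu).elim
  | @cons u v w adj p ih =>
    by_cases hv : P v
    · obtain ⟨a, b, hab, ha, hb, q, length_q⟩ := ih hv hw
      exact ⟨a, b, hab, ha, hb, .cons adj q, by simpa using length_q⟩
    · exact ⟨u, v, adj, hu, hv, .nil, by simp⟩

/-- The graph with an edge between each vertex and its parent. -/
def parentGraph (parent : V → Option V) : SimpleGraph V :=
  SimpleGraph.fromRel fun a b => parent b = some a

theorem exists_iterate_parent_of_reachable_deleteEdges {u p w : V} (hup : parent u = some p)
    (reachable : ((parentGraph parent).deleteEdges {s(p, u)}).Reachable u w) :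
    Relation.ReflTransGen (fun x y => parent x = some y) w u := by
  rw [SimpleGraph.reachable_iff_reflTransGen] at reachable
  induction reachable with
  | refl => exact .refl
  | @tail b c _ adj ih =>
    rw [SimpleGraph.deleteEdges_adj, parentGraph, SimpleGraph.fromRel_adj] at adj
    obtain ⟨⟨-, hbc | hcb⟩, hne⟩ := adj
    · exact .head hbc ih
    · rcases Relation.ReflTransGen.cases_head ih with rfl | ⟨d, hbd, hdu⟩
      · obtain rfl : p = c := Option.some_injective _ (hup.symm.trans hcb)
        exact absurd Sym2.eq_swap hne
      · obtain rfl : c = d := Option.some_injective _ (hcb.symm.trans hbd)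
        exact hdu

theorem isAcyclic_parentGraph {depth : V → ℕ}
    (depth_lt : ∀ u p, parent u = some p → depth p < depth u) :
    (parentGraph parent).IsAcyclic := by
  have depth_le {w u : V} (h : Relation.ReflTransGen (fun x y => parent x = some y) w u) :
      depth u ≤ depth w := by
    induction h using Relation.ReflTransGen.head_induction_on with
    | refl => exact le_rfl
    | head hxy _ ih => exact ih.trans (depth_lt _ _ hxy).le
  have separates {u p : V} (hup : parent u = some p) :
      ¬ ((parentGraph parent).deleteEdges {s(p, u)}).Reachable u p := fun reachable =>
    (depth_lt u p hup).not_ge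
      (depth_le (exists_iterate_parent_of_reachable_deleteEdges hup reachable))
  rw [SimpleGraph.isAcyclic_iff_forall_adj_isBridge]
  intro a b hab
  rw [SimpleGraph.isBridge_iff]
  rw [parentGraph, SimpleGraph.fromRel_adj] at hab
  rcases hab.2 with hba | hab
  · exact fun reachable => separates hba reachable.symm
  · rw [Sym2.eq_swap]
    exact separates hab

/-- What a breadth first search records: `depth u` is `0` if `u` is not yet visited, and otherwise
one more than the distance of `u` from the root of its tree. -/
structure SearchRecord (V : Type*) where
  depth : V → ℕ
  parent : V → Option V
  root : V → V

/-- The record before the first vertex is visited. -/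
def SearchRecord.empty (V : Type*) : SearchRecord V := ⟨fun _ => 0, fun _ => none, id⟩

/-- Visit the vertex `v` from its parent, or as a new root if it has none. -/
def SearchRecord.visit [DecidableEq V] (r : SearchRecord V) (v : V) (parent : Option V) :
    SearchRecord V where
  depth := Function.update r.depth v (parent.elim 0 r.depth + 1)
  parent := Function.update r.parent v parent
  root := Function.update r.root v (parent.elim v r.root)

/-- Visit `b` from `a`, after making `a` a root if it is not yet visited. -/
def SearchRecord.visitEdge [DecidableEq V] (r : SearchRecord V) (a b : V) : SearchRecord V :=
  (if r.depth a = 0 then r.visit a none else r).visit b (some a)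

/-- The record of a breadth first search of `R` that may have to go on. -/
structure PartialBFS (R : SimpleGraph V) (r : SearchRecord V) : Prop where
  parent_eq_none : ∀ u, r.depth u = 0 → r.parent u = none
  root_eq_self : ∀ u, r.parent u = none → r.root u = u
  of_parent : ∀ u p, r.parent u = some p →
    R.Adj p u ∧ r.depth p ≠ 0 ∧ r.depth u = r.depth p + 1 ∧ r.root u = r.root p
  depth_eq : ∀ u, r.depth u ≠ 0 → r.depth u = R.dist (r.root u) u + 1
  root_eq : ∀ u w, r.depth u ≠ 0 → r.depth w ≠ 0 → R.Reachable u w → r.root u = r.root w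

theorem partialBFS_empty (R : SimpleGraph V) : PartialBFS R (SearchRecord.empty V) := by
  constructor <;> simp [SearchRecord.empty]

namespace PartialBFS

variable {r : SearchRecord V}

theorem parentGraph_adj (h : PartialBFS R r) {a b : V} :
    (parentGraph r.parent).Adj a b ↔ r.parent b = some a ∨ r.parent a = some b := by
  rw [parentGraph, SimpleGraph.fromRel_adj, and_iff_right_iff_imp]
  rintro (hp | hp) rfl <;> exact (h.of_parent _ _ hp).1.ne rfl

theorem parentGraph_le (h : PartialBFS R r) : parentGraph r.parent ≤ R := by
  intro a b hab
  rcases h.parentGraph_adj.1 hab with hp | hp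
  · exact (h.of_parent _ _ hp).1
  · exact (h.of_parent _ _ hp).1.symm

theorem depth_eq_one (h : PartialBFS R r) {u : V} (visited : r.depth u ≠ 0)
    (hu : r.parent u = none) : r.depth u = 1 := by
  rw [h.depth_eq u visited, h.root_eq_self u hu, SimpleGraph.dist_self]

theorem exists_walk_from_root (h : PartialBFS R r) {u : V} {n : ℕ} (hn : r.depth u = n + 1) :
    r.depth (r.root u) ≠ 0 ∧
      ∃ p : (parentGraph r.parent).Walk (r.root u) u, p.length = n := by
  induction n generalizing u with
  | zero =>
    cases hp : r.parent u with
    | none =>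
      rw [h.root_eq_self u hp]
      exact ⟨by lia, .nil, rfl⟩
    | some p => have := h.of_parent u p hp; lia
  | succ n ih =>
    cases hp : r.parent u with
    | none => have := h.depth_eq_one (by lia) hp; lia
    | some p =>
      obtain ⟨-, -, depth_u, root_u⟩ := h.of_parent u p hp
      obtain ⟨root_visited, q, length_q⟩ := ih (u := p) (by lia)
      rw [root_u]
      exact ⟨root_visited, q.concat (h.parentGraph_adj.2 (.inl hp)), by simp [length_q]⟩

theorem root_visited (h : PartialBFS R r) {u : V} (visited : r.depth u ≠ 0) :
    r.depth (r.root u) ≠ 0 :=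
  (h.exists_walk_from_root (Nat.succ_pred_eq_of_ne_zero visited).symm).1

theorem reachable_parentGraph (h : PartialBFS R r) (u : V) :
    (parentGraph r.parent).Reachable (r.root u) u := by
  by_cases visited : r.depth u = 0
  · rw [h.root_eq_self u (h.parent_eq_none u visited)]
  · exact (h.exists_walk_from_root (Nat.succ_pred_eq_of_ne_zero visited).symm).2.choose.reachable

theorem reachable (h : PartialBFS R r) (u : V) : R.Reachable (r.root u) u :=
  (h.reachable_parentGraph u).mono h.parentGraph_le

theorem depth_eq_dist_parentGraph (h : PartialBFS R r) {u : V} (visited : r.depth u ≠ 0) :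
    r.depth u = (parentGraph r.parent).dist (r.root u) u + 1 := by
  obtain ⟨-, p, length_p⟩ :=
    h.exists_walk_from_root (Nat.succ_pred_eq_of_ne_zero visited).symm
  have dist_le_length := SimpleGraph.dist_le p
  have dist_le_dist : R.dist (r.root u) u ≤ (parentGraph r.parent).dist (r.root u) u :=
    p.reachable.dist_anti h.parentGraph_le
  have := h.depth_eq u visited
  rw [length_p] at dist_le_length
  have := Nat.succ_pred_eq_of_ne_zero visited
  lia

theorem isBFSForest (h : PartialBFS R r) (complete : ∀ a b, R.Adj a b → r.depth b ≠ 0) :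
    IsBFSForest R (parentGraph r.parent) r.root where
  le := h.parentGraph_le
  acyclic := isAcyclic_parentGraph (depth := r.depth) fun u p hp => by
    have := h.of_parent u p hp
    lia
  root_eq := by
    have visited {u w : V} (reachable : R.Reachable u w) (hne : u ≠ w) : r.depth u ≠ 0 := by
      obtain ⟨p⟩ := reachable
      cases p with
      | nil => exact (hne rfl).elim
      | cons adj _ => exact complete _ _ adj.symm
    intro u w reachable
    obtain rfl | hne := eq_or_ne u w
    · rfl
    · exact h.root_eq u w (visited reachable hne) (visited reachable.symm hne.symm) reachable
  reachable_root := h.reachable_parentGraph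
  dist_eq := by
    intro u
    by_cases visited : r.depth u = 0
    · rw [h.root_eq_self u (h.parent_eq_none u visited), SimpleGraph.dist_self,
        SimpleGraph.dist_self]
    · have := h.depth_eq_dist_parentGraph visited
      have := h.depth_eq u visited
      lia

theorem adj_and_dist_eq_succ_iff (h : PartialBFS R r) {a b : V} :
    ((parentGraph r.parent).Adj a b ∧ (parentGraph r.parent).dist (r.root b) b =
      (parentGraph r.parent).dist (r.root b) a + 1) ↔ r.parent b = some a := by
  have dist_of_parent {u p : V} (hp : r.parent u = some p) :
      (parentGraph r.parent).dist (r.root u) u = (parentGraph r.parent).dist (r.root p) p + 1 ∧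
        r.root u = r.root p := by
    obtain ⟨-, visited, depth_u, root_u⟩ := h.of_parent _ _ hp
    have := h.depth_eq_dist_parentGraph visited
    have := h.depth_eq_dist_parentGraph (u := u) (by lia)
    exact ⟨by lia, root_u⟩
  constructor
  · rintro ⟨adj, dist_succ⟩
    refine (h.parentGraph_adj.1 adj).resolve_right fun hp => ?_
    obtain ⟨dist_a, root_a⟩ := dist_of_parent hp
    rw [root_a] at dist_a
    lia
  · intro hp
    obtain ⟨dist_b, root_b⟩ := dist_of_parent hp
    refine ⟨h.parentGraph_adj.2 (.inl hp), ?_⟩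
    rw [dist_b, root_b]

theorem dist_root_eq_depth (h : PartialBFS R r) {p v : V} (adj : R.Adj p v)
    (visited : r.depth p ≠ 0) (unvisited : r.depth v = 0)
    (minimal : ∀ a b, R.Adj a b → r.depth a ≠ 0 → r.depth b = 0 → r.depth p ≤ r.depth a) :
    R.dist (r.root p) v = r.depth p := by
  refine le_antisymm ?_ ?_
  · obtain ⟨q, length_q⟩ := (h.reachable p).exists_walk_length_eq_dist
    have := SimpleGraph.dist_le (q.concat adj)
    rwa [SimpleGraph.Walk.length_concat, length_q, ← h.depth_eq p visited] at this
  · obtain ⟨q, length_q⟩ := ((h.reachable p).trans adj.reachable).exists_walk_length_eq_dist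
    obtain ⟨a, b, adj_ab, ha, hb, q', length_q'⟩ := exists_exit (P := fun x => r.depth x ≠ 0) q
      (h.root_visited visited) (not_not.2 unvisited)
    have depth_le := minimal a b adj_ab ha (not_not.1 hb)
    have depth_a := h.depth_eq a ha
    rw [← h.root_eq p a visited ha ((h.reachable p).symm.trans q'.reachable)] at depth_a
    have := SimpleGraph.dist_le q'
    lia

section Visit

variable [DecidableEq V] {v : V}

theorem visit (h : PartialBFS R r) {parent : Option V} (unvisited : r.depth v = 0)
    (adj : ∀ p, parent = some p → R.Adj p v ∧ r.depth p ≠ 0)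
    (dist_eq : R.dist (parent.elim v r.root) v = parent.elim 0 r.depth)
    (root_eq : ∀ w, r.depth w ≠ 0 → R.Reachable v w → parent.elim v r.root = r.root w) :
    PartialBFS R (r.visit v parent) := by
  have ne_of_visited {u : V} (visited : r.depth u ≠ 0) : u ≠ v :=
    fun h => visited (h ▸ unvisited)
  constructor <;> simp only [SearchRecord.visit]
  · intro u hu
    obtain rfl | hne := eq_or_ne u v
    · simp at hu
    · simp only [Function.update_of_ne hne] at hu ⊢
      exact h.parent_eq_none u hu
  · intro u hu
    obtain rfl | hne := eq_or_ne u v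
    · simp_all
    · simp only [Function.update_of_ne hne] at hu ⊢
      exact h.root_eq_self u hu
  · intro u p hp
    obtain rfl | hne := eq_or_ne u v
    · obtain rfl : parent = some p := by simpa using hp
      obtain ⟨adj, visited⟩ := adj p rfl
      simp [Function.update_of_ne (ne_of_visited visited), adj, visited]
    · simp only [Function.update_of_ne hne] at hp ⊢
      have := h.of_parent u p hp
      simpa only [Function.update_of_ne (ne_of_visited this.2.1)] using this
  · intro u hu
    obtain rfl | hne := eq_or_ne u v
    · simp [dist_eq]
    · simp only [Function.update_of_ne hne] at hu ⊢
      exact h.depth_eq u hu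
  · intro u w hu hw reachable
    obtain rfl | hu_ne := eq_or_ne u v <;> obtain rfl | hw_ne := eq_or_ne w u
    · rfl
    · simp only [Function.update_self, Function.update_of_ne hw_ne] at hw ⊢
      exact root_eq w hw reachable
    · rfl
    · obtain rfl | hw_ne := eq_or_ne w v
      · simp only [Function.update_self, Function.update_of_ne hu_ne] at hu ⊢
        exact (root_eq u hu reachable.symm).symm
      · simp only [Function.update_of_ne hu_ne, Function.update_of_ne hw_ne] at hu hw ⊢
        exact h.root_eq u w hu hw reachable

theorem visitRoot (h : PartialBFS R r) (unvisited : r.depth v = 0)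
    (closed : ∀ a b, R.Adj a b → r.depth a ≠ 0 → r.depth b ≠ 0) :
    PartialBFS R (r.visit v none) := by
  refine h.visit unvisited (by simp) (by simp) fun w visited ⟨p⟩ => ?_
  obtain ⟨a, b, adj, ha, hb, -⟩ :=
    exists_exit (P := fun x => r.depth x ≠ 0) p.reverse visited (not_not.2 unvisited)
  exact absurd (closed a b adj ha) hb

theorem visitChild (h : PartialBFS R r) {p : V} (adj : R.Adj p v) (visited : r.depth p ≠ 0)
    (unvisited : r.depth v = 0)
    (minimal : ∀ a b, R.Adj a b → r.depth a ≠ 0 → r.depth b = 0 → r.depth p ≤ r.depth a) :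
    PartialBFS R (r.visit v (some p)) :=
  h.visit unvisited (by simp [adj, visited])
    (h.dist_root_eq_depth adj visited unvisited minimal)
    fun w hw reachable => h.root_eq p w visited hw (adj.reachable.trans reachable)

theorem visitEdge (h : PartialBFS R r) {a b : V} (adj : R.Adj a b) (unvisited : r.depth b = 0)
    (best : ∀ a' b', R.Adj a' b' → r.depth b' = 0 →
      r.depth a' = 0 ∨ r.depth a ≠ 0 ∧ r.depth a ≤ r.depth a') :
    PartialBFS R (r.visitEdge a b) := by
  by_cases ha : r.depth a = 0
  · have closed : ∀ a b, R.Adj a b → r.depth a ≠ 0 → r.depth b ≠ 0 := fun a' b' adj ha' hb' =>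
      (best a' b' adj hb').elim ha' fun ⟨visited, _⟩ => visited ha
    rw [SearchRecord.visitEdge, if_pos ha]
    refine (h.visitRoot ha closed).visitChild adj (by simp [SearchRecord.visit])
      (by simpa [SearchRecord.visit, adj.ne'] using unvisited) fun a' b' _ visited _ => ?_
    simpa [SearchRecord.visit] using Nat.one_le_iff_ne_zero.2 visited
  · rw [SearchRecord.visitEdge, if_neg ha]
    exact h.visitChild adj ha unvisited fun a' b' adj ha' hb' =>
      ((best a' b' adj hb').resolve_left ha').2

end Visit

end PartialBFS

end BreadthFirstSearch

/-! ### The program: breadth first search -/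

section Search

abbrev activeReg : ℕ := 5
abbrev bestReg : ℕ := 6

abbrev depthArr : ℕ := 6

def resetBody : Cmd :=
  .seq (.nput depthArr (.reg idxReg) (.const 0)) (.nput parentArr (.reg idxReg) (.const 0))

def resetLoop : Cmd := forN idxReg (.reg nodesReg) resetBody

/-- The entry of `srcArr` or `dstArr` for the best link found so far, whose index plus one is in
`bestReg`. -/
def bestEntry (a : ℕ) : NExp := .get a (.sub (.reg bestReg) (.const 1))

/-- The link at the loop index is uncoloured and its receiver is unvisited. -/
def candidateTest : Test :=
  .and (.nle (entry colorArr) (.const 0)) (.nle (.get depthArr (entry dstArr)) (.const 0))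

/-- There is a best link, and its transmitter is visited not later than that of the link at the
loop index. -/
def keepTest : Test :=
  .and (.nle (.const 1) (.reg bestReg))
    (.not (.and (.nle (.const 1) (.get depthArr (entry srcArr)))
      (.not (.and (.nle (.const 1) (.get depthArr (bestEntry srcArr)))
        (.nle (.get depthArr (bestEntry srcArr)) (.get depthArr (entry srcArr)))))))

def scanBody : Cmd :=
  .ite (.and candidateTest (.not keepTest)) (.nset bestReg (.add (.reg idxReg) (.const 1))) .skip

def scanLoop : Cmd := forN idxReg (.reg edgesReg) scanBody

def rootCmd : Cmd :=
  .ite (.nle (.get depthArr (bestEntry srcArr)) (.const 0))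
    (.seq (.nput parentArr (bestEntry srcArr) (.const 0))
      (.nput depthArr (bestEntry srcArr) (.const 1))) .skip

def childCmd : Cmd :=
  .seq (.nput parentArr (bestEntry dstArr) (.add (bestEntry srcArr) (.const 1)))
    (.nput depthArr (bestEntry dstArr)
      (.add (.get depthArr (bestEntry srcArr)) (.const 1)))

def extendCmd : Cmd :=
  .ite (.nle (.reg bestReg) (.const 0)) (.nset activeReg (.const 0)) (.seq rootCmd childCmd)

def searchBody : Cmd := .seq (.nset bestReg (.const 0)) (.seq scanLoop extendCmd)

def searchLoop : Cmd := .while (.nle (.const 1) (.reg activeReg)) searchBody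

def searchCmd : Cmd := .seq resetLoop (.seq (.nset activeReg (.const 1)) searchLoop)

variable {N : ℕ} {Φ : Network N} {ed : Fin Φ.commEdges.card ≃ Φ.commEdges} {s s' : State}
  {ω : Tape} {C : Coloring N} {p : Cmd} {r : SearchRecord (Fin N)} {j n : ℕ}
  {R : SimpleGraph (Fin N)} {parent : Fin N → Option (Fin N)}

/-- The arrays `depthArr` and `parentArr` hold the record `r`. -/
structure HoldsRecord (s : State) (r : SearchRecord (Fin N)) : Prop where
  depth : ∀ u : Fin N, s.narr depthArr u = r.depth u
  parent : HasParents s r.parent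

theorem HoldsRecord.frame (h : HoldsRecord s r) (frame : Frame p s s')
    (hp : p.Preserves [.narr depthArr, .narr parentArr] := by decide) : HoldsRecord s' r := by
  have depth : s'.narr depthArr = s.narr depthArr := frame (.narr depthArr) (hp _ (by simp))
  have parent : s'.narr parentArr = s.narr parentArr :=
    frame (.narr parentArr) (hp _ (by simp))
  exact ⟨depth ▸ h.depth, fun u => parent ▸ h.parent u⟩

theorem resetLoop_spec (hE : Env Φ ed s) : Runs ω resetLoop s fun t s' =>
    HoldsRecord s' (SearchRecord.empty (Fin N)) ∧ t ≤ 30 * (N + 1) := by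
  refine Runs.mono (Runs.forN_entrywise N 30 (fun s' u => (s'.narr depthArr u, s'.narr parentArr u))
    (fun _ v => v = (0, 0)) (fun s' frame => frame.nreg.trans hE.nodes) ?_)
    fun t s' _ ⟨zero, time⟩ => ⟨⟨fun u => congrArg Prod.fst (zero u u.2),
      fun u => congrArg Prod.snd (zero u u.2)⟩, time⟩
  intro j _ s' _ hreg _
  constructor
  · simp [resetBody, Cmd.run, NExp.eval, hreg]
  · intro l hl
    simp [resetBody, Cmd.run, NExp.eval, hreg, hl]

/-- A link by which the search can reach a new vertex. -/
def IsCandidate (C : Coloring N) (r : SearchRecord (Fin N)) (x : Link N) : Prop :=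
  C x = 0 ∧ r.depth x.2 = 0

/-- Extending the search by `x` is at least as good as by `y`: links from visited vertices near the
root come first, those from unvisited vertices last. -/
def IsNearer (r : SearchRecord (Fin N)) (x y : Link N) : Prop :=
  r.depth y.1 = 0 ∨ r.depth x.1 ≠ 0 ∧ r.depth x.1 ≤ r.depth y.1

/-- The index `n - 1` is that of a best candidate among the first `j` links; `n = 0` if there is
none. -/
def IsBestCandidate (ed : Fin Φ.commEdges.card ≃ Φ.commEdges) (C : Coloring N)
    (r : SearchRecord (Fin N)) (j n : ℕ) : Prop :=
  (n = 0 ∧ ∀ i, i.val < j → ¬ IsCandidate C r (ed i)) ∨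
    ∃ i, n = i.val + 1 ∧ IsCandidate C r (ed i) ∧
      ∀ i', i'.val < j → IsCandidate C r (ed i') → IsNearer r (ed i) (ed i')

theorem IsBestCandidate.succ (h : IsBestCandidate ed C r j n) (hj : j < Φ.commEdges.card) {n' : ℕ}
    (keep : n' = n ∧ (IsCandidate C r (ed ⟨j, hj⟩) →
        n ≠ 0 ∧ ∀ i, n = i.val + 1 → IsNearer r (ed i) (ed ⟨j, hj⟩)) ∨
      n' = j + 1 ∧ IsCandidate C r (ed ⟨j, hj⟩) ∧
        ∀ i, n = i.val + 1 → ¬ IsNearer r (ed i) (ed ⟨j, hj⟩)) :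
    IsBestCandidate ed C r (j + 1) n' := by
  simp only [IsBestCandidate, forall_val_lt_succ hj]
  rcases keep with ⟨rfl, keep⟩ | ⟨rfl, candidate, better⟩
  · rcases h with ⟨hn, none⟩ | ⟨i, hi, candidate, best⟩
    · exact .inl ⟨hn, none, fun candidate => (keep candidate).1 hn⟩
    · exact .inr ⟨i, hi, candidate, best, fun candidate => (keep candidate).2 i hi⟩
  · refine .inr ⟨⟨j, hj⟩, rfl, candidate, fun i' hi' candidate' => ?_, fun _ => ?_⟩
    · rcases h with ⟨-, none⟩ | ⟨i, hi, -, best⟩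
      · exact absurd candidate' (none i' hi')
      · have := best i' hi' candidate'
        have := better i hi
        unfold IsNearer at *
        omega
    · unfold IsNearer
      omega

theorem eval_candidateTest (hE : Env Φ ed s) (hC : ColorState Φ ed s C) (hr : HoldsRecord s r)
    (hj : j < Φ.commEdges.card) (hreg : s.nreg idxReg = j) :
    candidateTest.eval s ↔ IsCandidate C r (ed ⟨j, hj⟩) := by
  have color := hC.color ⟨j, hj⟩
  have dst := hE.dst ⟨j, hj⟩
  simp only at color dst
  simp [candidateTest, Test.eval, NExp.eval, hreg, color, dst, hr.depth, IsCandidate]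

theorem eval_keepTest (hE : Env Φ ed s) (hr : HoldsRecord s r) {i : Fin Φ.commEdges.card}
    (hj : j < Φ.commEdges.card) (hreg : s.nreg idxReg = j) (best : s.nreg bestReg = i + 1) :
    keepTest.eval s ↔ IsNearer r (ed i) (ed ⟨j, hj⟩) := by
  have src := hE.src ⟨j, hj⟩
  simp only at src
  simp only [keepTest, bestEntry, Test.eval, NExp.eval, hreg, best, src, hE.src i, hr.depth,
    IsNearer, Nat.add_sub_cancel]
  omega

theorem scanLoop_spec (hE : Env Φ ed s) (hC : ColorState Φ ed s C) (hr : HoldsRecord s r)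
    (best : s.nreg bestReg = 0) : Runs ω scanLoop s fun t s' =>
      IsBestCandidate ed C r Φ.commEdges.card (s'.nreg bestReg) ∧
        t ≤ 80 * (Φ.commEdges.card + 1) := by
  refine Runs.forN_loopFree Φ.commEdges.card 80
    (fun j s' => IsBestCandidate ed C r j (s'.nreg bestReg))
    (fun s' frame => frame.nreg.trans hE.edges) (.inl ⟨best, fun _ h => absurd h (by simp)⟩) ?_
  intro j hj s' frame hreg hI
  have candidate_iff := eval_candidateTest (hE.frame frame) (hC.frame frame) (hr.frame frame) hj
    hreg
  have keep_iff (i : Fin Φ.commEdges.card) (hi : s'.nreg bestReg = i + 1) :=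
    eval_keepTest (hE.frame frame) (hr.frame frame) hj hreg hi
  refine hI.succ hj ?_
  by_cases hb : (Test.and candidateTest (.not keepTest)).eval s'
  · right
    refine ⟨?_, candidate_iff.1 hb.1, fun i hi => (keep_iff i hi).not.1 hb.2⟩
    rw [scanBody, Cmd.run, if_pos hb]
    simp [Cmd.run, NExp.eval, hreg]
  · left
    have keep (candidate : IsCandidate C r (ed ⟨j, hj⟩)) : keepTest.eval s' :=
      not_not.1 fun better => hb ⟨candidate_iff.2 candidate, better⟩
    refine ⟨by rw [scanBody, Cmd.run, if_neg hb, Cmd.run], fun candidate =>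
      ⟨Nat.one_le_iff_ne_zero.1 (keep candidate).1, fun i hi => (keep_iff i hi).1 (keep candidate)⟩⟩

theorem rootCmd_run (hE : Env Φ ed s) (hr : HoldsRecord s r) {i : Fin Φ.commEdges.card}
    (best : s.nreg bestReg = i + 1) (ω : Tape) : HoldsRecord (rootCmd.run ω s)
      (if r.depth (ed i).1.1 = 0 then r.visit (ed i).1.1 none else r) := by
  have root_iff : (Test.nle (.get depthArr (bestEntry srcArr)) (.const 0)).eval s ↔
      r.depth (ed i).1.1 = 0 := by
    simp [Test.eval, bestEntry, NExp.eval, best, hE.src, hr.depth]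
  have parent : ∀ u : Fin N, s.narr parentArr u = _ := hr.parent
  rw [rootCmd, Cmd.run]
  simp only [root_iff]
  split_ifs
  · constructor <;> intro u <;> by_cases hu : u = (ed i).1.1 <;>
      simp [Cmd.run, bestEntry, NExp.eval, best, hE.src, SearchRecord.visit, Fin.val_inj, hu,
        hr.depth, parent]
  · exact hr

theorem childCmd_run (hE : Env Φ ed s) (hr : HoldsRecord s r) {i : Fin Φ.commEdges.card}
    (best : s.nreg bestReg = i + 1) (ω : Tape) :
    HoldsRecord (childCmd.run ω s) (r.visit (ed i).1.2 (some (ed i).1.1)) := by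
  have parent : ∀ u : Fin N, s.narr parentArr u = _ := hr.parent
  constructor <;> intro u <;> by_cases hu : u = (ed i).1.2 <;>
    simp [childCmd, Cmd.run, bestEntry, NExp.eval, best, hE.src, hE.dst, SearchRecord.visit,
      Fin.val_inj, hu, hr.depth, parent]

/-- `R` is the graph of the uncoloured edges. -/
def IsUncolored (Φ : Network N) (C : Coloring N) (R : SimpleGraph (Fin N)) : Prop :=
  ∀ x : Link N, R.Adj x.1 x.2 ↔ x ∈ Φ.commEdges ∧ C x = 0

theorem IsUncolored.exists_index (hR : IsUncolored Φ C R)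
    (ed : Fin Φ.commEdges.card ≃ Φ.commEdges) {a b : Fin N} (adj : R.Adj a b) :
    ∃ i, (ed i).1 = (a, b) ∧ C (a, b) = 0 :=
  have h := (hR (a, b)).1 adj
  ⟨ed.symm ⟨_, h.1⟩, by simp, h.2⟩

theorem IsBestCandidate.depth_ne_zero (hR : IsUncolored Φ C R)
    (h : IsBestCandidate ed C r Φ.commEdges.card 0) {a b : Fin N} (adj : R.Adj a b) :
    r.depth b ≠ 0 := by
  rcases h with ⟨-, none⟩ | ⟨i, hi, -⟩
  · obtain ⟨i, hi, color⟩ := hR.exists_index ed adj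
    exact fun unvisited => none i i.2 (by rw [hi]; exact ⟨color, unvisited⟩)
  · exact absurd hi (Nat.succ_ne_zero _).symm

/-- The number of vertices with a parent. -/
def parentCount (parent : Fin N → Option (Fin N)) : ℕ :=
  (Finset.univ.filter fun u => (parent u).isSome).card

theorem parentCount_le (parent : Fin N → Option (Fin N)) : parentCount parent ≤ N :=
  (Finset.card_filter_le _ _).trans (Finset.card_fin N).le

theorem parentCount_update {b : Fin N} (hb : parent b = none) (a : Fin N) :
    parentCount (Function.update parent b (some a)) = parentCount parent + 1 := by
  have insert : (Finset.univ.filter fun u => (Function.update parent b (some a) u).isSome) =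
      insert b (Finset.univ.filter fun u => (parent u).isSome) := by
    ext u
    obtain rfl | hu := eq_or_ne u b <;> simp_all
  rw [parentCount, insert, Finset.card_insert_of_notMem (by simp [hb]), parentCount]

theorem HasParents.card_filter (h : HasParents s parent) :
    (Finset.univ.filter fun u : Fin N => s.narr parentArr u ≠ 0).card = parentCount parent := by
  refine congrArg Finset.card (Finset.filter_congr fun u _ => ?_)
  rw [h u]
  cases parent u <;> simp

theorem PartialBFS.parent_visitEdge (h : PartialBFS R r) (a b : Fin N) :
    (r.visitEdge a b).parent = Function.update r.parent b (some a) := by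
  unfold SearchRecord.visitEdge
  split_ifs with unvisited
  · simp [SearchRecord.visit, ← h.parent_eq_none a unvisited]
  · rfl

theorem IsBestCandidate.exists_visitEdge (hR : IsUncolored Φ C R) (hr : PartialBFS R r)
    (h : IsBestCandidate ed C r Φ.commEdges.card n) (hn : n ≠ 0) :
    ∃ i, n = i.val + 1 ∧ PartialBFS R (r.visitEdge (ed i).1.1 (ed i).1.2) ∧
      parentCount (r.visitEdge (ed i).1.1 (ed i).1.2).parent = parentCount r.parent + 1 := by
  obtain ⟨i, hi, ⟨color, unvisited⟩, best⟩ := h.resolve_left fun h => hn h.1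
  refine ⟨i, hi, hr.visitEdge ((hR _).2 ⟨(ed i).2, color⟩) unvisited fun a b adj hb => ?_, ?_⟩
  · obtain ⟨i', hi', color'⟩ := hR.exists_index ed adj
    have nearer := best i' i'.2 (by rw [hi']; exact ⟨color', hb⟩)
    rwa [IsNearer, hi'] at nearer
  · rw [hr.parent_visitEdge, parentCount_update (hr.parent_eq_none _ unvisited)]

theorem visitEdge_spec (hE : Env Φ ed s) (record : HoldsRecord s r) {i : Fin Φ.commEdges.card}
    (best : s.nreg bestReg = i + 1) : Runs ω (.seq rootCmd childCmd) s fun t s' =>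
      HoldsRecord s' (r.visitEdge (ed i).1.1 (ed i).1.2) ∧ t ≤ 60 := by
  refine Runs.seq <| Runs.of_loopFree fun t ht frame => Runs.of_loopFree fun t' ht' _ =>
    ⟨childCmd_run (hE.frame frame) (rootCmd_run hE record best ω) (frame.nreg.trans best) ω, ?_⟩
  have cost : rootCmd.maxCost + childCmd.maxCost ≤ 60 := by decide
  lia

theorem searchBody_spec (hE : Env Φ ed s) (hC : ColorState Φ ed s C) (hR : IsUncolored Φ C R)
    (hr : PartialBFS R r) (record : HoldsRecord s r) : Runs ω searchBody s fun t s' =>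
      (s'.nreg activeReg = 0 ∧ HoldsRecord s' r ∧ (∀ a b, R.Adj a b → r.depth b ≠ 0) ∨
        s'.nreg activeReg = s.nreg activeReg ∧ ∃ r', PartialBFS R r' ∧ HoldsRecord s' r' ∧
          parentCount r'.parent = parentCount r.parent + 1) ∧
      t ≤ 170 * (Φ.commEdges.card + 1) := by
  refine Runs.seq <| Runs.of_loopFree fun t₁ ht₁ frame₁ => Runs.seq ?_
  have record₁ := record.frame frame₁
  refine Runs.mono (scanLoop_spec (hE.frame frame₁) (hC.frame frame₁) record₁
    (setN_nreg_self ..)) fun t₂ s₂ frame₂ ⟨best, ht₂⟩ => ?_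
  have record₂ := record₁.frame frame₂
  have active : s₂.nreg activeReg = s.nreg activeReg := frame₂.nreg.trans frame₁.nreg
  have cost : (Cmd.nset bestReg (.const 0)).maxCost + (Test.nle (.reg bestReg) (.const 0)).cost +
      (Cmd.nset activeReg (.const 0)).maxCost + 60 ≤ 90 := by decide
  refine Runs.ite (fun found => ?_) (fun found => ?_)
  · have none : s₂.nreg bestReg = 0 := Nat.le_zero.1 found
    rw [none] at best
    exact Runs.of_loopFree fun t₃ ht₃ _ => ⟨.inl ⟨setN_nreg_self ..,
      ⟨record₂.depth, record₂.parent⟩, fun a b => best.depth_ne_zero hR⟩, by lia⟩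
  · obtain ⟨i, hi, hr', count⟩ := best.exists_visitEdge hR hr fun h => found h.le
    refine Runs.mono (visitEdge_spec ((hE.frame frame₁).frame frame₂) record₂ hi)
      fun t₃ s₃ frame₃ ⟨record₃, _⟩ =>
        ⟨.inr ⟨frame₃.nreg.trans active, _, hr', record₃, count⟩, ?_⟩
    lia

theorem searchLoop_spec (hE : Env Φ ed s) (hC : ColorState Φ ed s C) (hR : IsUncolored Φ C R)
    (record : HoldsRecord s (SearchRecord.empty (Fin N))) (active : s.nreg activeReg = 1) :
    Runs ω searchLoop s fun t s' => ∃ r, PartialBFS R r ∧ HasParents s' r.parent ∧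
      (∀ a b, R.Adj a b → r.depth b ≠ 0) ∧
        t ≤ 180 * (Φ.commEdges.card + 1) * (parentCount r.parent + 1) + 10 := by
  set T := 180 * (Φ.commEdges.card + 1)
  let count (s' : State) := (Finset.univ.filter fun u : Fin N => s'.narr parentArr u ≠ 0).card
  have cost : (Test.nle (.const 1) (.reg activeReg)).cost ≤ 10 := by decide
  refine Runs.mono (Runs.while
    (fun s' => s'.nreg activeReg ≤ 1 ∧ ∃ r, PartialBFS R r ∧ HoldsRecord s' r ∧
      (s'.nreg activeReg = 0 → ∀ a b, R.Adj a b → r.depth b ≠ 0))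
    (fun s' => T * (s'.nreg activeReg + (N - count s')))
    ⟨active.le, _, partialBFS_empty R, record, fun h => absurd (active.symm.trans h) one_ne_zero⟩
    ?_) ?_
  · rintro s' frame ⟨active', r, hr, record, -⟩ (running : 1 ≤ s'.nreg activeReg)
    refine Runs.mono (searchBody_spec (hE.frame frame) (hC.frame frame) hR hr record)
      fun t s'' _ ⟨progress, _⟩ => ?_
    have pays {n : ℕ} (hn : n + 1 ≤ s'.nreg activeReg + (N - count s')) :
        (Test.nle (.const 1) (.reg activeReg)).cost + t + T * n ≤
          T * (s'.nreg activeReg + (N - count s')) := by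
      have := Nat.mul_le_mul_left T hn
      lia
    have count_s' : count s' = _ := record.parent.card_filter
    rcases progress with ⟨stopped, record', complete⟩ | ⟨active'', r', hr', record', more⟩
    · have count_s'' : count s'' = _ := record'.parent.card_filter
      exact ⟨⟨by lia, r, hr, record', fun _ => complete⟩, pays (by lia)⟩
    · have count_s'' : count s'' = _ := record'.parent.card_filter
      have := parentCount_le r'.parent
      exact ⟨⟨by lia, r', hr', record', fun h => by lia⟩, pays (by lia)⟩
  · rintro t s' - ⟨⟨⟨-, r, hr, record', complete⟩, stopped⟩, time⟩
    have stopped : s'.nreg activeReg = 0 := Nat.lt_one_iff.1 (not_le.1 stopped)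
    have count_s : count s = 0 := record.parent.card_filter.trans (by simp [parentCount,
      SearchRecord.empty])
    have count_s' : count s' = _ := record'.parent.card_filter
    refine ⟨r, hr, record'.parent, complete stopped, ?_⟩
    have decrease : T * N = T * (N - count s') + T * parentCount r.parent := by
      rw [← Nat.mul_add, count_s', Nat.sub_add_cancel (parentCount_le r.parent)]
    rw [active, stopped, count_s, Nat.sub_zero, Nat.mul_add, Nat.mul_add] at time
    rw [Nat.mul_add]
    lia

theorem searchCmd_spec (hE : Env Φ ed s) (hC : ColorState Φ ed s C) (hR : IsUncolored Φ C R) :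
    Runs ω searchCmd s fun t s' => ∃ r, PartialBFS R r ∧ HasParents s' r.parent ∧
      (∀ a b, R.Adj a b → r.depth b ≠ 0) ∧
        t ≤ 50 * (N + 1) + 180 * (Φ.commEdges.card + 1) * (parentCount r.parent + 1) := by
  refine Runs.seq <| Runs.mono (resetLoop_spec hE) fun t₁ s₁ frame₁ ⟨record, _⟩ =>
    Runs.seq <| Runs.of_loopFree fun t₂ ht₂ frame₂ => ?_
  have cost : (Cmd.nset activeReg (.const 1)).maxCost ≤ 10 := by decide
  refine Runs.mono (searchLoop_spec ((hE.frame frame₁).frame frame₂)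
    ((hC.frame frame₁).frame frame₂) hR (record.frame frame₂) (setN_nreg_self ..))
    fun t₃ s₃ _ ⟨r, hr, parents, complete, ht₃⟩ => ⟨r, hr, parents, complete, ?_⟩
  lia

end Search

/-! ### The program: rounds of search and colouring -/

section Round

def passesCmd : Cmd := .seq (passLoop true) (passLoop false)

/-- Find a breadth first search forest of the uncoloured edges, and colour its edges. -/
def roundCmd : Cmd := .seq searchCmd passesCmd

variable {N : ℕ} {Φ : Network N} {ed : Fin Φ.commEdges.card ≃ Φ.commEdges} {s s' : State}
  {ω : Tape} {C : Coloring N} {r : SearchRecord (Fin N)} {R : SimpleGraph (Fin N)}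
  {parent : Fin N → Option (Fin N)} {L : Equiv.Perm (Fin N)} {x : Link N} {p : Cmd}

/-- Colour the edges of a forest, first those into and then those out of the children. -/
def roundColor (Φ : Network N) (L : Equiv.Perm (Fin N)) (parent : Fin N → Option (Fin N))
    (C : Coloring N) : Coloring N :=
  (passEdges L false parent).foldl (colorOption Φ) ((passEdges L true parent).foldl
    (colorOption Φ) C)

theorem roundColor_ne_zero : roundColor Φ L parent C x ≠ 0 ↔
    C x ≠ 0 ∨ parent x.2 = some x.1 ∨ parent x.1 = some x.2 := by
  simp [roundColor, foldl_colorOption_ne_zero, some_mem_passEdges, or_assoc]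

theorem HasInverse.frame (h : HasInverse s L) (frame : Frame p s s')
    (hp : Loc.narr vertexArr ∉ p.writes := by decide) : HasInverse s' L := by
  rwa [HasInverse, frame.narr hp]

theorem IsUncolored.roundColor (hR : IsUncolored Φ C R) (L : Equiv.Perm (Fin N))
    (hr : PartialBFS R r) :
    IsUncolored Φ (roundColor Φ L r.parent C) (R \ parentGraph r.parent) := by
  intro x
  rw [SimpleGraph.sdiff_adj, hr.parentGraph_adj, hR x, ← not_ne_iff (a := STDMA.roundColor ..),
    roundColor_ne_zero]
  tauto

theorem PartialBFS.parentCount_pos (hr : PartialBFS R r)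
    (complete : ∀ a b, R.Adj a b → r.depth b ≠ 0) (hR : R ≠ ⊥) : 0 < parentCount r.parent := by
  obtain ⟨a, b, adj⟩ := SimpleGraph.ne_bot_iff_exists_adj.1 hR
  have same_root := hr.root_eq a b (complete b a adj.symm) (complete a b adj) adj.reachable
  suffices h : ∃ u, r.parent u ≠ none by
    obtain ⟨u, hu⟩ := h
    exact Finset.card_pos.2 ⟨u, by simpa [Option.isSome_iff_ne_none] using hu⟩
  by_contra! none
  rw [hr.root_eq_self a (none a), hr.root_eq_self b (none b)] at same_root
  exact adj.ne same_root

theorem coloredCount_add_parentCount_le (uncolored : ∀ u p, parent u = some p → C (p, u) = 0) :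
    coloredCount C + parentCount parent ≤ coloredCount (roundColor Φ L parent C) := by
  classical
  let edge (u : Fin N) : Link N := ((parent u).getD u, u)
  have parent_eq {u : Fin N} (hu : (parent u).isSome) : parent u = some (edge u).1 := by
    obtain ⟨p, hp⟩ := Option.isSome_iff_exists.1 hu
    simp [edge, hp]
  have disjoint : Disjoint (Finset.univ.filter fun x => C x ≠ 0)
      ((Finset.univ.filter fun u => (parent u).isSome).image edge) := by
    simp only [Finset.disjoint_left, Finset.mem_image, Finset.mem_filter_univ]
    rintro _ hx ⟨u, hu, rfl⟩
    exact hx (uncolored u _ (parent_eq hu))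
  rw [parentCount, ← Finset.card_image_of_injective (f := edge) _ fun u u' h => congrArg Prod.snd h,
    coloredCount, ← Finset.card_union_of_disjoint disjoint]
  refine Finset.card_le_card fun x => ?_
  simp only [Finset.mem_union, Finset.mem_image, Finset.mem_filter_univ, roundColor_ne_zero]
  rintro (hx | ⟨u, hu, rfl⟩)
  · exact .inl hx
  · exact .inr (.inl (parent_eq hu))

theorem passesCmd_spec (hE : Env Φ ed s) (hC : ColorState Φ ed s C) (hR : IsUncolored Φ C R)
    (hL : HasInverse s L) (hr : PartialBFS R r) (hP : HasParents s r.parent) :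
    Runs ω passesCmd s fun t s' => ColorState Φ ed s' (roundColor Φ L r.parent C) ∧
      t + colorPotential Φ.commEdges.card s' ≤
        colorPotential Φ.commEdges.card s + 80 * (N + 1) := by
  refine Runs.seq <| Runs.mono (passLoop_spec hE hC hL hP fun u x hx => ?_)
    fun t₁ s₁ (frame : Frame (passLoop true) s s₁) ⟨hC₁, _⟩ => ?_
  · obtain ⟨rfl, hx⟩ : x.2 = u ∧ r.parent u = some x.1 := childEdge_eq_some.1 hx
    exact (hR x).1 (hr.of_parent _ _ hx).1
  have hP₁ : HasParents s₁ r.parent := by rwa [HasParents, frame.narr]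
  refine Runs.mono (passLoop_spec (hE.frame frame) hC₁ (hL.frame frame) hP₁ fun u x hx => ?_)
    fun t₂ s₂ _ ⟨hC₂, _⟩ => ⟨hC₂, ?_⟩
  · obtain ⟨rfl, hx⟩ : x.1 = u ∧ r.parent u = some x.2 := by
      simpa using childEdge_eq_some.1 hx
    obtain ⟨mem, color⟩ := (hR x).1 (hr.of_parent _ _ hx).1.symm
    refine ⟨mem, ?_⟩
    by_contra colored
    have hx' : r.parent x.2 = some x.1 := some_mem_passEdges.1
      (((foldl_colorOption_ne_zero _).1 colored).resolve_left (not_not.2 color))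
    have := hr.of_parent _ _ hx'
    have := hr.of_parent _ _ hx
    lia
  · lia

theorem colorPotential_eq_add {e : ℕ} (mono : s.nreg coloredReg ≤ s'.nreg coloredReg)
    (le : s'.nreg coloredReg ≤ e) : colorPotential e s = colorPotential e s' +
      (s'.nreg coloredReg - s.nreg coloredReg) * (700 * (e + 1)) := by
  rw [colorPotential, colorPotential, ← Nat.add_mul]
  congr 1
  lia

theorem roundTime_le {N e n d t₁ t₂ : ℕ} (search : t₁ ≤ 50 * (N + 1) + 180 * (e + 1) * (n + 1))
    (passes : t₂ ≤ d * (700 * (e + 1)) + 80 * (N + 1)) (n_pos : 0 < n) (n_le : n ≤ d) :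
    t₁ + t₂ ≤ 1100 * (N + e + 2) * d := by
  have nodes : N + 1 ≤ (N + 1) * d := Nat.le_mul_of_pos_right _ (n_pos.trans_le n_le)
  have edges : (e + 1) * (n + 1) ≤ (e + 1) * (2 * d) := Nat.mul_le_mul_left _ (by lia)
  nlinarith

theorem roundCmd_spec (hE : Env Φ ed s) (hC : ColorState Φ ed s C) (hR : IsUncolored Φ C R)
    (hL : HasInverse s L) (hR_ne : R ≠ ⊥) : Runs ω roundCmd s fun t s' =>
      ∃ r, PartialBFS R r ∧ (∀ a b, R.Adj a b → r.depth b ≠ 0) ∧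
        ColorState Φ ed s' (roundColor Φ L r.parent C) ∧
        s.nreg coloredReg < s'.nreg coloredReg ∧
        t ≤ 1100 * (N + Φ.commEdges.card + 2) * (s'.nreg coloredReg - s.nreg coloredReg) := by
  refine Runs.seq <| Runs.mono (searchCmd_spec hE hC hR) fun t₁ s₁ frame ⟨r, hr, hP, complete, _⟩ =>
    Runs.mono (passesCmd_spec (hE.frame frame) (hC.frame frame) hR (hL.frame frame) hr hP)
      fun t₂ s₂ _ ⟨hC₂, _⟩ => ?_
  have parents_pos := hr.parentCount_pos complete hR_ne
  have progress := coloredCount_add_parentCount_le (Φ := Φ) (L := L) fun u p hp =>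
    ((hR (p, u)).1 (hr.of_parent u p hp).1).2
  have colored_le := coloredCount_le hC₂.off
  have unchanged : s₁.nreg coloredReg = s.nreg coloredReg := frame.nreg
  rw [← hC.colored, ← hC₂.colored] at progress
  rw [← hC₂.colored] at colored_le
  have potential := colorPotential_eq_add (s := s₁) (by lia) colored_le
  rw [unchanged] at potential
  exact ⟨r, hr, complete, hC₂, by lia, roundTime_le ‹_› (by lia) parents_pos (by lia)⟩

end Round

/-! ### The program: the main loop -/

section Rounds

variable {V : Type*} {G : SimpleGraph V} {F F' : ℕ → SimpleGraph V} {records : ℕ → SearchRecord V}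
  {r : SearchRecord V} {m : ℕ}

theorem residual_congr (h : ∀ i < m, F i = F' i) : residual G F m = residual G F' m := by
  induction m with
  | zero => rfl
  | succ m ih => rw [residual, residual, ih fun i hi => h i (by lia), h m (by lia)]

/-- The forest found by the `i`-th search. -/
abbrev searchForest (records : ℕ → SearchRecord V) (i : ℕ) : SimpleGraph V :=
  parentGraph (records i).parent

/-- The records of `m` successive breadth first searches, each of the edges left over by the
previous ones. -/
structure Rounds (G : SimpleGraph V) (m : ℕ) (records : ℕ → SearchRecord V) : Prop where
  bfs : ∀ i < m, PartialBFS (residual G (searchForest records) i) (records i)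
  complete : ∀ i < m, ∀ a b, (residual G (searchForest records) i).Adj a b →
    (records i).depth b ≠ 0
  ne_bot : ∀ i < m, residual G (searchForest records) i ≠ ⊥

theorem Rounds.succ (h : Rounds G m records)
    (bfs : PartialBFS (residual G (searchForest records) m) r)
    (complete : ∀ a b, (residual G (searchForest records) m).Adj a b → r.depth b ≠ 0)
    (ne_bot : residual G (searchForest records) m ≠ ⊥) :
    Rounds G (m + 1) (Function.update records m r) := by
  have residual_eq {i : ℕ} (hi : i ≤ m) :
      residual G (searchForest (Function.update records m r)) i =
        residual G (searchForest records) i :=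
    residual_congr fun j hj => by rw [searchForest, Function.update_of_ne (by lia)]
  have old {i : ℕ} (hi : i < m) : Function.update records m r i = records i :=
    Function.update_of_ne hi.ne _ _
  constructor <;> intro i hi <;> rw [residual_eq (by lia)] <;>
    rcases Nat.lt_succ_iff_lt_or_eq.1 hi with hi | rfl
  · exact old hi ▸ h.bfs i hi
  · rwa [Function.update_self]
  · exact old hi ▸ h.complete i hi
  · rwa [Function.update_self]
  · exact h.ne_bot i hi
  · exact ne_bot

/-- The decomposition into the forests found by the searches. -/
def Rounds.decomposition (h : Rounds G m records)
    (exhausted : residual G (searchForest records) m = ⊥) : BFSDecomposition G where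
  m := m
  F := searchForest records
  root i := (records i).root
  isBFSForest i hi := (h.bfs i hi).isBFSForest (h.complete i hi)
  residual_ne_bot := h.ne_bot
  residual_eq_bot := exhausted

end Rounds

section MainLoop

def moreTest : Test := .not (.nle (.reg edgesReg) (.reg coloredReg))

/-- Rounds of search and colouring until all edges are coloured. -/
def mainLoop : Cmd := .while moreTest roundCmd

variable {N m i : ℕ} {Φ : Network N} {ed : Fin Φ.commEdges.card ≃ Φ.commEdges} {s : State}
  {ω : Tape} {C : Coloring N} {R : SimpleGraph (Fin N)} {L : Equiv.Perm (Fin N)}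
  {records : ℕ → SearchRecord (Fin N)} {r : SearchRecord (Fin N)} {u : Fin N} {x : Link N}

/-- The colouring after `m` rounds, in which the searches leave the given records. -/
def scheduleRounds (Φ : Network N) (L : Equiv.Perm (Fin N)) (records : ℕ → SearchRecord (Fin N)) :
    ℕ → Coloring N
  | 0 => fun _ => 0
  | m + 1 => roundColor Φ L (records m).parent (scheduleRounds Φ L records m)

theorem scheduleRounds_update :
    scheduleRounds Φ L (Function.update records m r) (m + 1) =
      roundColor Φ L r.parent (scheduleRounds Φ L records m) := by
  have old : ∀ i ≤ m, scheduleRounds Φ L (Function.update records m r) i =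
      scheduleRounds Φ L records i := fun i hi => by
    induction i with
    | zero => rfl
    | succ i ih =>
      rw [scheduleRounds, scheduleRounds, ih (by lia), Function.update_of_ne (by lia)]
  rw [scheduleRounds, old m le_rfl, Function.update_self]

theorem Rounds.isUncolored (h : Rounds Φ.graph m records) (hi : i ≤ m) :
    IsUncolored Φ (scheduleRounds Φ L records i) (residual Φ.graph (searchForest records) i) := by
  induction i with
  | zero => simp [IsUncolored, residual, scheduleRounds, Network.commEdges]
  | succ i ih => exact (ih (by lia)).roundColor L (h.bfs i hi)

theorem Rounds.isEdgeOf_iff (h : Rounds Φ.graph m records)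
    (exhausted : residual Φ.graph (searchForest records) m = ⊥) (hi : i < m) :
    ((h.decomposition exhausted).IsEdgeOf (2 * i) u x ↔
        childEdge true (records i).parent u = some x) ∧
      ((h.decomposition exhausted).IsEdgeOf (2 * i + 1) u x ↔
        childEdge false (records i).parent u = some x) := by
  have into := (h.bfs i hi).adj_and_dist_eq_succ_iff (a := x.1) (b := x.2)
  have out := (h.bfs i hi).adj_and_dist_eq_succ_iff (a := x.2) (b := x.1)
  rw [SimpleGraph.adj_comm] at out
  have half : (2 * i + 1) / 2 = i := by lia
  simp only [BFSDecomposition.IsEdgeOf, BFSDecomposition.oriented, Rounds.decomposition,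
    even_two_mul, Nat.not_even_two_mul_add_one, if_true, if_false, half,
    Nat.mul_div_cancel_left i two_pos, into, out, childEdge_eq_some, Bool.false_eq_true]
  exact ⟨and_comm.trans <| and_congr_right fun h => h ▸ Iff.rfl,
    and_comm.trans <| and_congr_right fun h => h ▸ Iff.rfl⟩

theorem colorStep_eq {D : BFSDecomposition Φ.graph} {edgeOf : Fin N → Option (Link N)}
    (h : ∀ u x, D.IsEdgeOf i u x ↔ edgeOf u = some x) (j : Fin N) :
    colorStep Φ L D C (i, j) = colorOption Φ C (edgeOf (L.symm j)) := by
  rw [colorStep]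
  split_ifs with exists_edge
  · rw [(h _ _).1 exists_edge.choose_spec, colorOption, Option.elim_some]
  · rw [Option.eq_none_iff_forall_ne_some.2 fun x hx => exists_edge ⟨x, (h _ _).2 hx⟩]
    rfl

theorem foldl_colorStep {D : BFSDecomposition Φ.graph} {out : Bool} {parent}
    (h : ∀ u x, D.IsEdgeOf i u x ↔ childEdge out parent u = some x) :
    ((List.finRange N).map fun j => (i, j)).foldl (colorStep Φ L D) C =
      (passEdges L out parent).foldl (colorOption Φ) C := by
  simp only [passEdges, List.foldl_map, colorStep_eq h]

theorem Rounds.conflictFreeLinkSchedule_eq (h : Rounds Φ.graph m records)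
    (exhausted : residual Φ.graph (searchForest records) m = ⊥) (L : Equiv.Perm (Fin N)) :
    conflictFreeLinkSchedule Φ L (h.decomposition exhausted) = scheduleRounds Φ L records m := by
  set D := h.decomposition exhausted
  have fold_rounds : ∀ i ≤ m, ((List.range (2 * i)).flatMap fun i => (List.finRange N).map
      fun j => (i, j)).foldl (colorStep Φ L D) (fun _ => 0) = scheduleRounds Φ L records i := by
    intro i hi
    induction i with
    | zero => rfl
    | succ i ih =>
      have edges u x := h.isEdgeOf_iff exhausted (i := i) (u := u) (x := x) (by lia)
      rw [Nat.mul_succ, List.range_succ, List.range_succ]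
      simp only [List.flatMap_append, List.flatMap_singleton, List.foldl_append, ih (by lia)]
      rw [foldl_colorStep fun u x => (edges u x).1, foldl_colorStep fun u x => (edges u x).2]
      rfl
  exact fold_rounds m le_rfl

theorem IsUncolored.eq_bot_iff (hR : IsUncolored Φ C R) (off : ∀ x ∉ Φ.commEdges, C x = 0) :
    R = ⊥ ↔ coloredCount C = Φ.commEdges.card := by
  have off : (Finset.univ.filter fun x => C x ≠ 0) ⊆ Φ.commEdges := fun x hx =>
    not_not.1 fun hn => (Finset.mem_filter.1 hx).2 (off x hn)
  have colored_iff : R = ⊥ ↔ Φ.commEdges ⊆ Finset.univ.filter fun x => C x ≠ 0 := by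
    rw [SimpleGraph.eq_bot_iff_forall_not_adj]
    simp only [Finset.subset_iff, Finset.mem_filter_univ, Prod.forall, hR (_, _), not_and]
  rw [colored_iff, coloredCount]
  exact ⟨fun h => (Finset.card_le_card off).antisymm (Finset.card_le_card h),
    fun h => (Finset.eq_of_subset_of_card_le off h.ge).ge⟩

theorem roundPotential_le {T b t e n n' : ℕ} (time : t ≤ T * (n' - n)) (lt : n < n')
    (le : n' ≤ e) : b + t + (e - n') * (T + b) ≤ (e - n) * (T + b) := by
  have split : e - n = (e - n') + (n' - n) := by lia
  have test : b ≤ b * (n' - n) := Nat.le_mul_of_pos_right b (Nat.sub_pos_of_lt lt)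
  rw [split]
  nlinarith

theorem mainLoop_spec (hE : Env Φ ed s) (hC : ColorState Φ ed s fun _ => 0) (hL : HasInverse s L) :
    Runs ω mainLoop s fun t s' => ∃ D : BFSDecomposition Φ.graph,
      HasColors Φ ed s' (conflictFreeLinkSchedule Φ L D) ∧
      t ≤ Φ.commEdges.card * (1100 * (N + Φ.commEdges.card + 2) + 4) + 4 := by
  refine Runs.mono (Runs.while
    (fun s' => ∃ m records, Rounds Φ.graph m records ∧
      ColorState Φ ed s' (scheduleRounds Φ L records m))
    (fun s' => (Φ.commEdges.card - s'.nreg coloredReg) *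
      (1100 * (N + Φ.commEdges.card + 2) + moreTest.cost))
    ⟨0, fun _ => .empty _, ⟨by simp, by simp, by simp⟩, hC⟩ ?_) ?_
  · rintro s₁ frame₁ ⟨m, records, rounds, hC₁⟩ more
    have hE₁ := hE.frame frame₁
    have uncolored := rounds.isUncolored (L := L) le_rfl
    have colored_lt : s₁.nreg coloredReg < Φ.commEdges.card := by
      simpa [moreTest, Test.eval, NExp.eval, hE₁.edges] using more
    have ne_bot : residual Φ.graph (searchForest records) m ≠ ⊥ := fun h =>
      colored_lt.ne (hC₁.colored.trans ((uncolored.eq_bot_iff hC₁.off).1 h))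
    refine Runs.mono (roundCmd_spec hE₁ hC₁ uncolored (hL.frame frame₁) ne_bot)
      fun t s₂ _ ⟨r, bfs, complete, hC₂, progress, time⟩ => ?_
    have colored_le := coloredCount_le hC₂.off
    rw [← hC₂.colored] at colored_le
    exact ⟨⟨m + 1, _, rounds.succ bfs complete ne_bot, scheduleRounds_update ▸ hC₂⟩,
      roundPotential_le time progress colored_le⟩
  · rintro t s₁ frame₁ ⟨⟨⟨m, records, rounds, hC₁⟩, no_more⟩, time⟩
    have colored_ge : Φ.commEdges.card ≤ s₁.nreg coloredReg := by
      simpa [moreTest, Test.eval, NExp.eval, (hE.frame frame₁).edges] using no_more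
    have exhausted := ((rounds.isUncolored (L := L) le_rfl).eq_bot_iff hC₁.off).2
      ((coloredCount_le hC₁.off).antisymm (hC₁.colored ▸ colored_ge))
    refine ⟨rounds.decomposition exhausted, ?_, ?_⟩
    · rw [rounds.conflictFreeLinkSchedule_eq exhausted L]
      exact hC₁.color
    · exact (Nat.le_add_right _ _).trans <| time.trans <|
        Nat.add_le_add_right (Nat.mul_le_mul_right _ (Nat.sub_le _ _)) _

end MainLoop

/-! ### The random labelling -/

section RandomLabelling

/-- The incremental shuffle: the last of `n + 1` entries changes places with the entry at the
position `c n`. -/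
def shufflePerm (c : ℕ → ℕ) : ℕ → Equiv.Perm ℕ
  | 0 => 1
  | n + 1 => shufflePerm c n * Equiv.swap (c n) n

variable {c c' : ℕ → ℕ} {n i : ℕ} {σ : Equiv.Perm ℕ}

theorem shufflePerm_apply_of_le (hc : ∀ k, c k ≤ k) (hi : n ≤ i) : shufflePerm c n i = i := by
  induction n with
  | zero => rfl
  | succ n ih =>
    have := hc n
    rw [shufflePerm, Equiv.Perm.mul_apply, Equiv.swap_apply_of_ne_of_ne (by lia) (by lia),
      ih (by lia)]

theorem shufflePerm_lt_iff (hc : ∀ k, c k ≤ k) : shufflePerm c n i < n ↔ i < n := by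
  rw [← not_le, ← not_le, not_iff_not]
  refine ⟨fun h => ?_, fun h => by rwa [shufflePerm_apply_of_le hc h]⟩
  rwa [← (shufflePerm c n).injective (shufflePerm_apply_of_le hc h)]

theorem shufflePerm_succ_apply_choice (hc : ∀ k, c k ≤ k) : shufflePerm c (n + 1) (c n) = n := by
  rw [shufflePerm, Equiv.Perm.mul_apply, Equiv.swap_apply_left, shufflePerm_apply_of_le hc le_rfl]

theorem shufflePerm_eq_iff (hc : ∀ k, c k ≤ k) (hc' : ∀ k, c' k ≤ k) :
    shufflePerm c n = shufflePerm c' n ↔ ∀ k < n, c k = c' k := by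
  induction n with
  | zero => simp [shufflePerm]
  | succ n ih =>
    rw [Nat.forall_lt_succ_right, ← ih]
    constructor
    · intro h
      have last : c n = c' n := (shufflePerm c' (n + 1)).injective <| by
        rw [← h, shufflePerm_succ_apply_choice hc, h, shufflePerm_succ_apply_choice hc']
      rw [shufflePerm, shufflePerm, last] at h
      exact ⟨mul_right_cancel h, last⟩
    · rintro ⟨h, last⟩
      rw [shufflePerm, shufflePerm, h, last]

theorem exists_shufflePerm_eq (hσ : ∀ i, n ≤ i → σ i = i) :
    ∃ c, (∀ k, c k ≤ k) ∧ shufflePerm c n = σ := by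
  induction n generalizing σ with
  | zero => exact ⟨fun _ => 0, fun _ => Nat.zero_le _, Equiv.ext fun i => (hσ i i.zero_le).symm⟩
  | succ n ih =>
    have choice_le : σ.symm n ≤ n := by
      by_contra! h
      have := hσ _ h
      rw [Equiv.apply_symm_apply] at this
      lia
    obtain ⟨c, hc, eq⟩ := ih (σ := σ * Equiv.swap (σ.symm n) n) fun i hi => by
      rcases hi.eq_or_lt with rfl | hi
      · simp
      · rw [Equiv.Perm.mul_apply, Equiv.swap_apply_of_ne_of_ne (by lia) (by lia), hσ i hi]
    have hc' : ∀ k, Function.update c n (σ.symm n) k ≤ k := fun k => by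
      rcases eq_or_ne k n with rfl | hk
      · rwa [Function.update_self]
      · rw [Function.update_of_ne hk]
        exact hc k
    refine ⟨_, hc', ?_⟩
    rw [shufflePerm, (shufflePerm_eq_iff hc' hc).2 fun k hk => Function.update_of_ne hk.ne _ _, eq,
      Function.update_self, Equiv.mul_swap_mul_self]

theorem tapeMeasure_cylinder (hc : ∀ k, c k ≤ k) :
    tapeMeasure {ω | ∀ k < n, (ω (k, k) : ℕ) = c k} = 1 / (n.factorial : ENNReal) := by
  let S : Finset (ℕ × ℕ) := (Finset.range n).image fun k => (k, k)
  let t (p : ℕ × ℕ) : Set (Fin (p.2 + 1)) := {x | (x : ℕ) = c p.1}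
  have cylinder : {ω : Tape | ∀ k < n, (ω (k, k) : ℕ) = c k} = Set.pi S t := by
    ext ω
    simp [S, t, Set.mem_pi]
  have factor (k : ℕ) : (PMF.uniformOfFintype (Fin (k + 1))).toMeasure (t (k, k)) =
      ((k + 1 : ℕ) : ENNReal)⁻¹ := by
    have singleton : t (k, k) = {⟨c k, Nat.lt_succ_of_le (hc k)⟩} := by
      ext x
      simp [t, Fin.ext_iff]
    rw [singleton, PMF.toMeasure_apply_singleton _ _ (.of_discrete), PMF.uniformOfFintype_apply,
      Fintype.card_fin]
  rw [cylinder, tapeMeasure, MeasureTheory.Measure.infinitePi_pi _ fun _ _ => .of_discrete,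
    Finset.prod_image fun a _ b _ h => (Prod.mk.inj h).1, Finset.prod_congr rfl fun k _ => factor k,
    one_div, ← Finset.prod_range_add_one_eq_factorial, Nat.cast_prod, ENNReal.prod_inv_distrib]
  exact fun _ _ _ _ _ => .inr (ENNReal.natCast_ne_top _)

theorem Tape.apply_le (ω : Tape) (k : ℕ) : (ω (k, k) : ℕ) ≤ k := Nat.lt_succ_iff.1 (ω (k, k)).2

/-- The labelling drawn from the tape by an incremental shuffle. -/
def randomLabelling (ω : Tape) (n : ℕ) : Equiv.Perm (Fin n) :=
  Fin.equivSubtype.symm.permCongr <|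
    (shufflePerm (fun k => ω (k, k)) n).subtypePerm fun _ => shufflePerm_lt_iff (Tape.apply_le ω)

theorem randomLabelling_apply (ω : Tape) (j : Fin n) :
    (randomLabelling ω n j : ℕ) = shufflePerm (fun k => ω (k, k)) n j := rfl

theorem randomLabelling_eq_iff {ω : Tape} {L : Equiv.Perm (Fin n)} : randomLabelling ω n = L ↔
    shufflePerm (fun k => ω (k, k)) n = L.extendDomain Fin.equivSubtype := by
  constructor
  · rintro rfl
    ext i
    by_cases hi : i < n
    · rw [Equiv.Perm.extendDomain_apply_subtype (b := i) _ _ hi]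
      rfl
    · rw [Equiv.Perm.extendDomain_apply_not_subtype (b := i) _ _ hi,
        shufflePerm_apply_of_le (Tape.apply_le ω) (not_lt.1 hi)]
  · intro h
    ext j
    rw [randomLabelling_apply, h, Equiv.Perm.extendDomain_apply_subtype (b := (j : ℕ)) _ _ j.2]
    rfl

theorem tapeMeasure_randomLabelling_eq (L : Equiv.Perm (Fin n)) :
    tapeMeasure {ω | randomLabelling ω n = L} = 1 / (n.factorial : ENNReal) := by
  obtain ⟨c, hc, eq⟩ := exists_shufflePerm_eq (σ := L.extendDomain Fin.equivSubtype) fun i hi =>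
    Equiv.Perm.extendDomain_apply_not_subtype _ _ (not_lt.2 hi)
  simp only [randomLabelling_eq_iff, ← eq, shufflePerm_eq_iff (Tape.apply_le _) hc]
  exact tapeMeasure_cylinder hc

end RandomLabelling

/-! ### The program -/

section Program

abbrev choiceReg : ℕ := 5

def shuffleBody : Cmd :=
  .seq (.draw choiceReg (.reg idxReg))
    (.seq (.nput labelArr (.reg idxReg) (.get labelArr (.reg choiceReg)))
      (.nput labelArr (.reg choiceReg) (.add (.reg idxReg) (.const 1))))

def shuffleLoop : Cmd := forN idxReg (.reg nodesReg) shuffleBody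

def invertBody : Cmd := .nput vertexArr (entry labelArr) (.reg idxReg)

/-- Compute the vertex of each label. -/
def invertLoop : Cmd := forN idxReg (.reg nodesReg) invertBody

def labelCmd : Cmd := .seq shuffleLoop invertLoop

/-- The program for ConflictFreeLinkSchedule. -/
def scheduleCmd : Cmd := .seq labelCmd mainLoop

variable {N : ℕ} {Φ : Network N} {ed : Fin Φ.commEdges.card ≃ Φ.commEdges} {s : State} {ω : Tape}
  {L : Equiv.Perm (Fin N)}

theorem shuffleBody_run {j : ℕ} (idx : s.nreg idxReg = j) (draws : s.draws = j)
    (labels : ∀ i < j, s.narr labelArr i = shufflePerm (fun k => ω (k, k)) j i + 1) :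
    ∀ i < j + 1, (shuffleBody.run ω s).narr labelArr i =
      shufflePerm (fun k => ω (k, k)) (j + 1) i + 1 := by
  intro i hi
  set c : ℕ → ℕ := fun k => ω (k, k)
  have choice : (ω (s.draws, s.nreg idxReg) : ℕ) = c j := by rw [draws, idx]
  have choice_le : c j ≤ j := Tape.apply_le ω j
  simp only [shuffleBody, Cmd.run, NExp.eval, Function.update_self, choice,
    Function.update_of_ne (show idxReg ≠ choiceReg by decide), idx]
  rcases eq_or_ne i (c j) with eq_choice | ne_choice
  · rw [eq_choice, Function.update_self, shufflePerm_succ_apply_choice (Tape.apply_le ω)]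
  rw [Function.update_of_ne ne_choice, shufflePerm, Equiv.Perm.mul_apply]
  rcases eq_or_ne i j with rfl | ne_last
  · rw [Function.update_self, Equiv.swap_apply_right, labels _ (by lia)]
  · rw [Function.update_of_ne ne_last, Equiv.swap_apply_of_ne_of_ne ne_choice ne_last,
      labels i (by lia)]

theorem shuffleLoop_spec (hN : s.nreg nodesReg = N) (draws : s.draws = 0) :
    Runs ω shuffleLoop s fun t s' => HasLabels s' (randomLabelling ω N) ∧ t ≤ 30 * (N + 1) := by
  refine Runs.mono (Runs.forN_loopFree N 30 (fun j s' => s'.draws = j ∧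
    ∀ i < j, s'.narr labelArr i = shufflePerm (fun k => ω (k, k)) j i + 1)
    (fun s' frame => frame.nreg.trans hN) ⟨draws, by simp⟩ ?_)
    fun t s' _ ⟨⟨_, labels⟩, time⟩ => ⟨fun j => labels j j.2, time⟩
  rintro j - s' - idx ⟨draws, labels⟩
  exact ⟨congrArg (· + 1) draws, shuffleBody_run idx draws labels⟩

theorem invertLoop_spec (hN : s.nreg nodesReg = N) (hL : HasLabels s L) :
    Runs ω invertLoop s fun t s' => HasInverse s' L ∧ t ≤ 20 * (N + 1) := by
  refine Runs.mono (Runs.forN_loopFree N 20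
    (fun j s' => ∀ i : Fin N, i < j → s'.narr vertexArr (L i + 1) = i)
    (fun s' frame => frame.nreg.trans hN) (by simp) ?_)
    fun t s' _ ⟨inverse, time⟩ => ⟨fun j => ?_, time⟩
  · intro j hj s' frame idx inverse i hi
    have label : s'.narr labelArr j = L ⟨j, hj⟩ + 1 := by
      rw [frame.narr]
      exact hL ⟨j, hj⟩
    simp only [invertBody, Cmd.run, NExp.eval, idx, label, Function.update_self]
    rcases Nat.lt_succ_iff_lt_or_eq.1 hi with hi | rfl
    · have : L i ≠ L ⟨j, hj⟩ := fun h => hi.ne (congrArg Fin.val (L.injective h))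
      rw [Function.update_of_ne (by lia), inverse i hi]
    · rw [Function.update_self]
  · simpa using inverse (L.symm j) (L.symm j).2

theorem env_input : Env Φ ed (input Φ ed) := by
  constructor <;> simp [input]

theorem colorState_input : ColorState Φ ed (input Φ ed) fun _ => 0 := by
  constructor <;> simp [input, existing, coloredCount]

theorem labelCmd_spec : Runs ω labelCmd (input Φ ed) fun t s' =>
    HasLabels s' (randomLabelling ω N) ∧ HasInverse s' (randomLabelling ω N) ∧
      t ≤ 50 * (N + 1) := by
  refine Runs.seq <|
    Runs.mono (shuffleLoop_spec (N := N) rfl rfl) fun t₁ s₁ frame₁ ⟨labels, _⟩ => ?_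
  have hE := (env_input (Φ := Φ) (ed := ed)).frame frame₁
  refine Runs.mono (invertLoop_spec hE.nodes labels) fun t₂ s₂ frame₂ ⟨inverse, _⟩ =>
    ⟨?_, inverse, by lia⟩
  rwa [HasLabels, frame₂.narr]

theorem scheduleCmd_spec : Runs ω scheduleCmd (input Φ ed) fun t s' =>
    ∃ D : BFSDecomposition Φ.graph, HasLabels s' (randomLabelling ω N) ∧
      HasColors Φ ed s' (conflictFreeLinkSchedule Φ (randomLabelling ω N) D) ∧
      t ≤ 1200 * ((N + Φ.commEdges.card + 2) * (Φ.commEdges.card + 1)) := by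
  refine Runs.seq <| Runs.mono labelCmd_spec fun t₁ s₁ frame₁ ⟨labels, inverse, _⟩ => ?_
  refine Runs.mono (mainLoop_spec (env_input.frame frame₁) (colorState_input.frame frame₁) inverse)
    fun t₂ s₂ frame₂ ⟨D, colors, time₂⟩ => ⟨D, ?_, colors, by nlinarith⟩
  rwa [HasLabels, frame₂.narr]

theorem two_le_of_commEdges_nonempty (h : Φ.commEdges.Nonempty) : 2 ≤ N := by
  obtain ⟨⟨a, b⟩, hx⟩ := h
  simp only [Network.commEdges, Finset.mem_filter_univ] at hx
  have ne : (a : ℕ) ≠ b := Fin.val_ne_of_ne hx.ne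
  lia

theorem randomLabelling_eq_of_hasLabels {t : ℕ} (run : Exec ω scheduleCmd (input Φ ed) t s)
    (labels : HasLabels s L) : randomLabelling ω N = L := by
  obtain ⟨t', s', run', -, labels', -⟩ := scheduleCmd_spec (Φ := Φ) (ed := ed) (ω := ω)
  obtain ⟨-, rfl⟩ := run.unique run'
  ext j
  exact Nat.succ_injective ((labels' j).symm.trans (labels j))

theorem time_le {v e θ t : ℕ} {c : ℝ} (hv : 2 ≤ v) (he : 0 < e) (thickness_ge : e ≤ 32 * v * θ)
    (ht : t ≤ c * ((v + e + 2) * (e + 1))) (hc : 0 ≤ c) :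
    (t : ℝ) ≤ 64 * c * (e * v * Real.log v + e * v * θ) := by
  have hv : (2 : ℝ) ≤ v := by exact_mod_cast hv
  have he : (1 : ℝ) ≤ e := by exact_mod_cast he
  have thickness_ge : (e : ℝ) ≤ 32 * v * θ := by exact_mod_cast thickness_ge
  have half_le_log : (1 / 2 : ℝ) ≤ Real.log v := by
    linarith [Real.log_two_gt_d9, Real.log_le_log two_pos hv]
  have e_mul_v : (e : ℝ) * v * (1 / 2) ≤ e * v * Real.log v := by gcongr
  have e_mul_e : (e : ℝ) * e ≤ e * (32 * v * θ) := by gcongr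
  calc (t : ℝ) ≤ c * ((v + e + 2) * (e + 1)) := ht
    _ ≤ c * ((2 * v + e) * (2 * e)) := by gcongr c * (?_ * ?_) <;> linarith
    _ ≤ c * (64 * (e * v * Real.log v + e * v * θ)) := by
      refine mul_le_mul_of_nonneg_left ?_ hc
      linarith [show (0 : ℝ) ≤ e * v by positivity]
    _ = _ := by ring

end Program

end STDMA

end

theorem mainTheorem1 :
    ∃ (prog : Cmd) (c : ℝ), 0 < c ∧
      ∀ (v : ℕ) (Φ : Network v) (ed : Fin Φ.commEdges.card ≃ Φ.commEdges),
        0 < Φ.commEdges.card →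
        (∀ ω : Tape, ∃ (t : ℕ) (s : State) (L : Equiv.Perm (Fin v))
            (D : BFSDecomposition Φ.graph),
          Exec ω prog (input Φ ed) t s ∧
          HasLabels s L ∧
          HasColors Φ ed s (conflictFreeLinkSchedule Φ L D) ∧
          (t : ℝ) ≤ c * ((Φ.commEdges.card : ℝ) * v * Real.log v +
            (Φ.commEdges.card : ℝ) * v * thickness Φ.graph)) ∧
        ∀ L : Equiv.Perm (Fin v),
          tapeMeasure {ω | ∃ t s, Exec ω prog (input Φ ed) t s ∧ HasLabels s L} =
            1 / (v.factorial : ENNReal) := by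
  refine ⟨scheduleCmd, 64 * 1200, by norm_num, fun v Φ ed he => ⟨fun ω => ?_, fun L => ?_⟩⟩
  · obtain ⟨t, s, run, D, labels, colors, time⟩ := scheduleCmd_spec (Φ := Φ) (ed := ed) (ω := ω)
    have hv := two_le_of_commEdges_nonempty (Finset.card_pos.1 he)
    exact ⟨t, s, randomLabelling ω v, D, run, labels, colors,
      time_le hv he Φ.card_commEdges_le (by exact_mod_cast time) (by norm_num)⟩
  · rw [← tapeMeasure_randomLabelling_eq L]
    congr 1 with ω
    constructor
    · rintro ⟨t, s, run, labels⟩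
      exact randomLabelling_eq_of_hasLabels run labels
    · rintro rfl
      obtain ⟨t, s, run, D, labels, -⟩ := scheduleCmd_spec (Φ := Φ) (ed := ed) (ω := ω)
      exact ⟨t, s, run, labels⟩
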